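/- Let $G=(V,E)$ be a finite directed graph with $E\subseteq V\times V$, $s,t\in V$, let $c:E\to\mathbb{Q}$ be edge costs (of arbitrary sign), let $E'\subseteq E$ be a set of important edges, $\alpha\in(0,1)\cap\mathbb{Q}$, and let $x^1,\dots,x^N$ be given $s$-$t$ edge progressions with coefficients $\tilde\lambda_1,\dots,\tilde\lambda_N\in\mathbb{Q}$ (of arbitrary sign). An $s$-$t$ edge progression is a sequence $s=v_0,e_1,v_1,\dots,e_m,v_m=t$ with $m\ge 0$ and $e_j=(v_{j-1},v_j)\in E$; vertices and edges may be repeated. Let $\mathcal{X}$ be the set of $s$-$t$ edge progressions. For $x\in\mathcal{X}$ let $c(x)=\sum_{j=1}^m c(e_j)$ (each traversal of an edge counts), let $\chi_{E'}(x)\in\{0,1\}^{E'}$ indicate which edges of $E'$ occur in $x$, and let $H$ be the Hamming distance. Consider the problem $$\min_{x\in\mathcal{X}}\ \alpha\, c(x)+(1-\alpha)\sum_{i=1}^N\tilde\lambda_i\,H\big(\chi_{E'}(x),\chi_{E'}(x^i)\big).$$ There is an algorithm that, on every such instance for which $G$ contains no directed cycle of negative cost with respect to $c$, outputs an optimal edge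 progression (or reports that $\mathcal{X}=\emptyset$), and whose running time is polynomial in the input length whenever $|E'|$ is bounded by a constant: for every $k\in\mathbb{N}$ there is a polynomial $p_k$ such that the running time is at most $p_k(\text{input length})$ on all instances with $|E'|\le k$. (Numbers are encoded in binary, the graph by its adjacency matrix and the $x^i$ by their vertex sequences; running time is measured on a random access machine with logarithmic cost.) -/

import Mathlib

/-! ## Random access machines with logarithmic cost -/

namespace RAM

/-- Number of bits needed to write down an integer (sign included); it is always positive. -/
def bitLength (z : ℤ) : ℕ := Nat.size z.natAbs + 1

/-- A configuration: integer registers (addressed by the program text), an unbounded integer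
memory (addressed indirectly), the unread part of the input tape, and the output tape. -/
structure Config where
  reg : ℕ → ℤ
  mem : ℕ → ℤ
  input : List ℤ
  output : List ℤ

/-- The initial configuration: everything is zero, the input is on the input tape. -/
def Config.init (inp : List ℤ) : Config where
  reg := fun _ => 0
  mem := fun _ => 0
  input := inp
  output := []

/-- Arithmetic operations. -/
inductive Op
  | add
  | sub
  | mul
  | div

/-- The meaning of the operations (`div` is integer division, with value `0` for divisor `0`). -/
def Op.eval : Op → ℤ → ℤ → ℤ
  | .add, x, y => x + y
  | .sub, x, y => x - y
  | .mul, x, y => x * y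
  | .div, x, y => x / y

/-- Elementary instructions; natural-number arguments are register numbers.
* `const d z` : `reg d := z`
* `arith op d a b` : `reg d := op (reg a) (reg b)`
* `load d a` : `reg d := mem (reg a)`
* `store a b` : `mem (reg a) := reg b`
* `read d` : `reg d :=` next entry of the input tape (`0` if the input is exhausted)
* `write a` : append `reg a` to the output tape -/
inductive Instr
  | const (d : ℕ) (z : ℤ)
  | arith (op : Op) (d a b : ℕ)
  | load (d a : ℕ)
  | store (a b : ℕ)
  | read (d : ℕ)
  | write (a : ℕ)

/-- The effect of an elementary instruction. -/
def Instr.apply : Instr → Config → Config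
  | .const d z, σ => { σ with reg := Function.update σ.reg d z }
  | .arith op d a b, σ =>
      { σ with reg := Function.update σ.reg d (op.eval (σ.reg a) (σ.reg b)) }
  | .load d a, σ => { σ with reg := Function.update σ.reg d (σ.mem (σ.reg a).toNat) }
  | .store a b, σ => { σ with mem := Function.update σ.mem (σ.reg a).toNat (σ.reg b) }
  | .read d, σ =>
      { σ with reg := Function.update σ.reg d (σ.input.headD 0), input := σ.input.tail }
  | .write a, σ => { σ with output := σ.output ++ [σ.reg a] }

/-- The logarithmic cost of an elementary instruction: one plus the bit lengths of all operands
and of all indirectly used memory addresses. -/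
def Instr.cost : Instr → Config → ℕ
  | .const _ z, _ => 1 + bitLength z
  | .arith _ _ a b, σ => 1 + bitLength (σ.reg a) + bitLength (σ.reg b)
  | .load _ a, σ => 1 + bitLength (σ.reg a) + bitLength (σ.mem (σ.reg a).toNat)
  | .store a b, σ => 1 + bitLength (σ.reg a) + bitLength (σ.reg b)
  | .read _, σ => 1 + bitLength (σ.input.headD 0)
  | .write a, σ => 1 + bitLength (σ.reg a)

/-- Programs; the control structures test whether a register is positive. -/
inductive Prog
  | skip
  | instr (i : Instr)
  | seq (p q : Prog)
  | ite (a : ℕ) (p q : Prog)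
  | loop (a : ℕ) (p : Prog)

/-- `Run p σ c τ`: started in configuration `σ`, the program `p` terminates in configuration `τ`
with total cost `c`. The program `loop a p` is `while 0 < reg a do p`. -/
inductive Run : Prog → Config → ℕ → Config → Prop
  | skip (σ : Config) : Run .skip σ 1 σ
  | instr (i : Instr) (σ : Config) : Run (.instr i) σ (i.cost σ) (i.apply σ)
  | seq {p q : Prog} {σ τ υ : Config} {c d : ℕ} (hp : Run p σ c τ) (hq : Run q τ d υ) :
      Run (.seq p q) σ (c + d) υ
  | ite_pos {a : ℕ} {p q : Prog} {σ τ : Config} {c : ℕ} (ha : 0 < σ.reg a)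
      (hp : Run p σ c τ) : Run (.ite a p q) σ (1 + bitLength (σ.reg a) + c) τ
  | ite_neg {a : ℕ} {p q : Prog} {σ τ : Config} {c : ℕ} (ha : ¬ 0 < σ.reg a)
      (hq : Run q σ c τ) : Run (.ite a p q) σ (1 + bitLength (σ.reg a) + c) τ
  | loop_stop {a : ℕ} {p : Prog} {σ : Config} (ha : ¬ 0 < σ.reg a) :
      Run (.loop a p) σ (1 + bitLength (σ.reg a)) σ
  | loop_step {a : ℕ} {p : Prog} {σ τ υ : Config} {c d : ℕ} (ha : 0 < σ.reg a)
      (hp : Run p σ c τ) (hl : Run (.loop a p) τ d υ) :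
      Run (.loop a p) σ (1 + bitLength (σ.reg a) + c + d) υ

/-- On input `inp`, the program `P` terminates with cost at most `T` and output `out`. -/
def OutputsInTime (P : Prog) (inp out : List ℤ) (T : ℕ) : Prop :=
  ∃ (c : ℕ) (τ : Config), Run P (Config.init inp) c τ ∧ c ≤ T ∧ τ.output = out

/-- The length of an input: the total number of bits of its entries. -/
def inputSize (inp : List ℤ) : ℕ := (inp.map bitLength).sum

end RAM

/-! ## Edge progressions in directed graphs and the explainable shortest walk problem -/

namespace WSExpH

/-- The sequence of edges traversed by a sequence of vertices. -/
def edgeSeq {V : Type} (w : List V) : List (V × V) := w.zip w.tail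

/-- `w` is (the vertex sequence of) an edge progression from `s` to `t` in the directed graph with
edge set `E`. Vertices and edges may be repeated, and the progression may have no edges. -/
def IsEdgeProgression {V : Type} (E : Finset (V × V)) (s t : V) (w : List V) : Prop :=
  w.head? = some s ∧ w.getLast? = some t ∧ ∀ e ∈ edgeSeq w, e ∈ E

/-- `w` is the vertex sequence `v, …, v` of a directed cycle: a closed edge progression with at
least one edge and no repeated vertex except that the first one is also the last one. -/
def IsCycle {V : Type} (E : Finset (V × V)) (w : List V) : Prop :=
  (∃ v, IsEdgeProgression E v v w) ∧ edgeSeq w ≠ [] ∧ w.tail.Nodup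

/-- The cost of an edge progression; every traversal of an edge counts. -/
def cost {V : Type} (c : V × V → ℚ) (w : List V) : ℚ := ((edgeSeq w).map c).sum

/-- The indicator vector of the edges of `E'` that occur in `w`. -/
def indicator {V : Type} [DecidableEq V] (E' : Finset (V × V)) (w : List V) : E' → Bool :=
  fun e => decide (e.1 ∈ edgeSeq w)

/-- A problem instance: a directed graph on the vertices `0, …, n - 1`, rational edge costs
(only the values of `c` on `E` matter), the important edges `E'`, the weight `α`, and `N`
historic edge progressions with their coefficients. -/
structure Instance where
  n : ℕ
  E : Finset (Fin n × Fin n)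
  s : Fin n
  t : Fin n
  c : Fin n × Fin n → ℚ
  E' : Finset (Fin n × Fin n)
  E'_subset : E' ⊆ E
  α : ℚ
  α_pos : 0 < α
  α_lt_one : α < 1
  N : ℕ
  hist : Fin N → List (Fin n)
  hist_mem : ∀ i, IsEdgeProgression E s t (hist i)
  lam : Fin N → ℚ

namespace Instance

variable (I : Instance)

/-- The feasible solutions: the edge progressions from `s` to `t`. -/
def feasible : Set (List (Fin I.n)) := {w | IsEdgeProgression I.E I.s I.t w}

/-- The objective function. -/
def objective (w : List (Fin I.n)) : ℚ :=
  I.α * cost I.c w + (1 - I.α) *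
    ∑ i, I.lam i * (hammingDist (indicator I.E' w) (indicator I.E' (I.hist i)) : ℚ)

/-- The graph has no cycle of negative cost. -/
def NoNegativeCycle : Prop := ∀ w, IsCycle I.E w → 0 ≤ cost I.c w

/-- `o` is a correct answer: a feasible solution of minimum objective value, or `none` if there is
no feasible solution. -/
def IsAnswer : Option (List (Fin I.n)) → Prop
  | some w => w ∈ I.feasible ∧ ∀ w' ∈ I.feasible, I.objective w ≤ I.objective w'
  | none => I.feasible = ∅

/-- A rational number is given by its numerator and denominator. -/
def encodeRat (q : ℚ) : List ℤ := [q.num, (q.den : ℤ)]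

/-- The entry of the adjacency matrix for a pair of vertices: whether it is an edge, the cost of
the edge, and whether it is an important edge. -/
def encodePair (e : Fin I.n × Fin I.n) : List ℤ :=
  if e ∈ I.E then 1 :: encodeRat (I.c e) ++ [if e ∈ I.E' then 1 else 0] else [0, 0, 1, 0]

/-- The `i`-th historic solution: its coefficient, its number of vertices, its vertices. -/
def encodeHist (i : Fin I.N) : List ℤ :=
  encodeRat (I.lam i) ++ ((I.hist i).length : ℤ) :: (I.hist i).map (fun v => ((v : ℕ) : ℤ))

/-- An instance as a sequence of integers. -/
def encode : List ℤ :=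
  [(I.n : ℤ), ((I.s : ℕ) : ℤ), ((I.t : ℕ) : ℤ)] ++ encodeRat I.α ++
    (List.finRange I.n).flatMap (fun u => (List.finRange I.n).flatMap fun v => I.encodePair (u, v))
    ++ (I.N : ℤ) :: (List.finRange I.N).flatMap I.encodeHist

/-- An answer as a sequence of integers: the vertices of the edge progression, or nothing. (Every
edge progression has at least one vertex.) -/
def encodeAnswer : Option (List (Fin I.n)) → List ℤ
  | some w => w.map (fun v => ((v : ℕ) : ℤ))
  | none => []

end Instance

end WSExpH

/-! ## Structured programs on top of the random access machine -/

namespace RAM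

/-! For a single important edge the Hamming term is a constant plus, if the edge is used, `+1` or
`-1` according to whether the historic progression avoids or uses it. Hence, up to a constant, the
objective charges `α c(e)` for every traversal of `e` and, at the first traversal of an important
edge only, a bonus of arbitrary sign. After multiplication by a common denominator this is the
integral weight `Net.val 0` of a network (`objective_eq`).

Whether a bonus is still due depends only on the set `S` of important edges used so far, so the
relevant states are the pairs `(v, S)`, of which there are `M = n * 2 ^ |E'|`. If a progression
visits a state twice, the segment in between is closed and uses no new important edge. It therefore
collects no bonus, and its cost is nonnegative because a closed progression decomposes into cycles
(`cost_closed_nonneg`). Deleting it does not increase the weight (`exists_shorter`), so progressions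
with at most `M` vertices suffice. Among these, a Bellman recursion over the number of remaining
vertices finds an optimal one: `Table.lower` and `Table.exists_follows` give the two inequalities.

For the running time, all numbers that occur must have polynomial length. Denominators are
multiplied up without cancellation, and since the lengths of the factors add up to at most the input
length, the products stay below `2 ^ len` (`dc_le`, `prod_le`); table entries grow by at most `wmax`
per layer. Every stored number is thus at most `bound`, whose length is linear in the input length
and `|E'|` (`unit_bound_le`).

The machine program is written in a small structured language. `Wp` combines correctness, a time
bound in multiples of `unit B`, and the invariant that all stored numbers are at most `B`. The total
cost is the number of units (`time_le`, of order `M * M * n` for the table) times the unit. -/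

theorem bitLength_pos (z : ℤ) : 1 ≤ bitLength z := Nat.le_add_left 1 _

theorem bitLength_mono {x y : ℤ} (h : |x| ≤ |y|) : bitLength x ≤ bitLength y := by
  unfold bitLength
  have : x.natAbs ≤ y.natAbs := by rw [Int.abs_eq_natAbs, Int.abs_eq_natAbs] at h; omega
  exact Nat.add_le_add_right (Nat.size_le_size this) 1

theorem bitLength_le_natAbs (z : ℤ) : bitLength z ≤ z.natAbs + 1 :=
  Nat.add_le_add_right (Nat.size_le.2 Nat.lt_two_pow_self) 1

theorem natAbs_lt_two_pow (z : ℤ) : z.natAbs < 2 ^ (bitLength z - 1) := by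
  simpa [bitLength] using Nat.lt_size_self z.natAbs

theorem bitLength_le_succ {z : ℤ} {n : ℕ} : bitLength z ≤ n + 1 ↔ z.natAbs < 2 ^ n := by
  simp [bitLength, Nat.size_le]

/-- With `|x| < 2 ^ a` and `|y| < 2 ^ b`, products are below `2 ^ (a + b)` and sums below `2 ^ (a +
b + 1)`, while integer division does not increase the absolute value. Lengths therefore add up along
an expression, which is what `Ex.wt` counts. -/
theorem bitLength_eval_le (op : Op) (x y : ℤ) :
    bitLength (op.eval x y) ≤ bitLength x + bitLength y := by
  have hx := natAbs_lt_two_pow x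
  have hy := natAbs_lt_two_pow y
  obtain ⟨a, ha⟩ := Nat.exists_eq_add_of_le' (bitLength_pos x)
  obtain ⟨b, hb⟩ := Nat.exists_eq_add_of_le' (bitLength_pos y)
  rw [ha] at hx ⊢
  rw [hb] at hy ⊢
  simp only [Nat.add_sub_cancel] at hx hy
  have e : a + 1 + (b + 1) = (a + b + 1) + 1 := by ring
  rw [e, bitLength_le_succ]
  have hadd : x.natAbs + y.natAbs < 2 ^ (a + b + 1) := by
    have h1 : 2 ^ a ≤ 2 ^ (a + b) := Nat.pow_le_pow_right (by norm_num) (by omega)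
    have h2 : 2 ^ b ≤ 2 ^ (a + b) := Nat.pow_le_pow_right (by norm_num) (by omega)
    rw [pow_succ]; omega
  cases op with
  | add => exact (Int.natAbs_add_le x y).trans_lt hadd
  | sub => exact (Int.natAbs_sub_le x y).trans_lt hadd
  | mul =>
    simp only [Op.eval, Int.natAbs_mul]
    calc x.natAbs * y.natAbs < 2 ^ a * 2 ^ b := Nat.mul_lt_mul'' hx hy
      _ = 2 ^ (a + b) := (pow_add 2 a b).symm
      _ ≤ _ := Nat.pow_le_pow_right (by norm_num) (by omega)
  | div =>
    simp only [Op.eval]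
    have h1 : (x / y).natAbs ≤ x.natAbs := Int.natAbs_ediv_le_natAbs x y
    omega

/-- States of structured programs: variables, eight arrays, the input and the output tape. -/
structure St where
  v : ℕ → ℤ
  arr : Fin 8 → ℕ → ℤ
  inp : List ℤ
  out : List ℤ

/-- Assignment to a variable. -/
def St.setv (st : St) (x : ℕ) (z : ℤ) : St := { st with v := Function.update st.v x z }

/-- Assignment to an array entry. -/
def St.seta (st : St) (a : Fin 8) (i : ℕ) (z : ℤ) : St :=
  { st with arr := Function.update st.arr a (Function.update (st.arr a) i z) }

/-- Replacement of the input tape. -/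
def St.seti (st : St) (l : List ℤ) : St := { st with inp := l }

/-- Appending to the output tape. -/
def St.addo (st : St) (z : ℤ) : St := { st with out := st.out ++ [z] }

section simps
variable (st : St) (x y : ℕ) (z : ℤ) (a b : Fin 8) (i j : ℕ) (l : List ℤ)

@[simp] theorem St.setv_v : (st.setv x z).v y = if y = x then z else st.v y := by
  simp [St.setv, Function.update_apply]
@[simp] theorem St.setv_arr : (st.setv x z).arr = st.arr := rfl
@[simp] theorem St.setv_inp : (st.setv x z).inp = st.inp := rfl
@[simp] theorem St.setv_out : (st.setv x z).out = st.out := rfl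
@[simp] theorem St.seta_v : (st.seta a i z).v = st.v := rfl
@[simp] theorem St.seta_inp : (st.seta a i z).inp = st.inp := rfl
@[simp] theorem St.seta_out : (st.seta a i z).out = st.out := rfl
@[simp] theorem St.seta_arr :
    (st.seta a i z).arr b j = if b = a ∧ j = i then z else st.arr b j := by
  by_cases h : b = a
  · subst h; simp [St.seta, Function.update_apply]
  · simp [St.seta, h]
@[simp] theorem St.seti_v : (st.seti l).v = st.v := rfl
@[simp] theorem St.seti_arr : (st.seti l).arr = st.arr := rfl
@[simp] theorem St.seti_inp : (st.seti l).inp = l := rfl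
@[simp] theorem St.seti_out : (st.seti l).out = st.out := rfl
@[simp] theorem St.addo_v : (st.addo z).v = st.v := rfl
@[simp] theorem St.addo_arr : (st.addo z).arr = st.arr := rfl
@[simp] theorem St.addo_inp : (st.addo z).inp = st.inp := rfl
@[simp] theorem St.addo_out : (st.addo z).out = st.out ++ [z] := rfl

end simps

/-- The machine configuration `σ` represents the state `st`: variables are kept in the registers
with even numbers, and entry `i` of array `a` is kept in the memory cell `8 * i + a`. -/
structure Sim (σ : Config) (st : St) : Prop where
  reg : ∀ x, σ.reg (2 * x) = st.v x
  mem : ∀ (a : Fin 8) i, σ.mem (8 * i + a) = st.arr a i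
  inp : σ.input = st.inp
  out : σ.output = st.out

/-- All numbers in the state are bounded by `B`. -/
structure St.Bdd (B : ℕ) (st : St) : Prop where
  v : ∀ x, |st.v x| ≤ (B : ℤ)
  arr : ∀ a i, |st.arr a i| ≤ (B : ℤ)
  inp : ∀ z ∈ st.inp, |z| ≤ (B : ℤ)

/-- Arithmetic expressions. -/
inductive Ex
  | lit (z : ℤ)
  | var (x : ℕ)
  | bin (op : Op) (a b : Ex)
  | get (a : Fin 8) (i : Ex)

namespace Ex

instance : Add Ex := ⟨bin .add⟩
instance : Sub Ex := ⟨bin .sub⟩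
instance : Mul Ex := ⟨bin .mul⟩
instance : Div Ex := ⟨bin .div⟩

/-- The value of an expression. -/
def eval (st : St) : Ex → ℤ
  | lit z => z
  | var x => st.v x
  | bin op a b => op.eval (eval st a) (eval st b)
  | get a i => st.arr a (eval st i).toNat

/-- No array is accessed at a negative position. -/
def ok (st : St) : Ex → Prop
  | lit _ => True
  | var _ => True
  | bin _ a b => ok st a ∧ ok st b
  | get _ i => ok st i ∧ 0 ≤ eval st i

section simps
variable (st : St) (x : ℕ) (z : ℤ) (a b : Ex) (r : Fin 8)
@[simp] theorem eval_lit : (lit z).eval st = z := rfl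
@[simp] theorem eval_var : (var x).eval st = st.v x := rfl
@[simp] theorem eval_add : (a + b).eval st = a.eval st + b.eval st := rfl
@[simp] theorem eval_sub : (a - b).eval st = a.eval st - b.eval st := rfl
@[simp] theorem eval_mul : (a * b).eval st = a.eval st * b.eval st := rfl
@[simp] theorem eval_div : (a / b).eval st = a.eval st / b.eval st := rfl
@[simp] theorem eval_get : (get r a).eval st = st.arr r (a.eval st).toNat := rfl
@[simp] theorem ok_lit : (lit z).ok st := trivial
@[simp] theorem ok_var : (var x).ok st := trivial
@[simp] theorem ok_add : (a + b).ok st ↔ a.ok st ∧ b.ok st := Iff.rfl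
@[simp] theorem ok_sub : (a - b).ok st ↔ a.ok st ∧ b.ok st := Iff.rfl
@[simp] theorem ok_mul : (a * b).ok st ↔ a.ok st ∧ b.ok st := Iff.rfl
@[simp] theorem ok_div : (a / b).ok st ↔ a.ok st ∧ b.ok st := Iff.rfl
@[simp] theorem ok_get : (get r a).ok st ↔ a.ok st ∧ 0 ≤ a.eval st := Iff.rfl
end simps

/-- The length of the value of an expression is at most `wt` times the maximum length of the
numbers in the state. -/
def wt : Ex → ℕ
  | lit z => z.natAbs + 1
  | var _ => 1
  | bin _ a b => wt a + wt b
  | get _ _ => 1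

/-- A bound for the evaluation time, in multiples of the maximum length of the numbers in the
state. -/
def time : Ex → ℕ
  | lit z => z.natAbs + 2
  | var _ => 5
  | bin _ a b => time a + time b + 1 + wt a + wt b
  -- The index is paid for three times: in the multiplication by 8, in the addition of the array
  -- number, and as the address of the load.
  | get _ i => time i + 3 * wt i + 100

/-- Code that computes an expression in register `2 * d + 1`. -/
def comp : Ex → ℕ → Prog
  | lit z, d => .instr (.const (2 * d + 1) z)
  -- The machine has no copy instruction; a register is copied by adding zero.
  | var x, d => .seq (.instr (.const (2 * d + 1) 0))
      (.instr (.arith .add (2 * d + 1) (2 * x) (2 * d + 1)))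
  | bin op a b, d => .seq (comp a d) (.seq (comp b (d + 1))
      (.instr (.arith op (2 * d + 1) (2 * d + 1) (2 * d + 3))))
  | get a i, d => .seq (comp i d) (.seq (.instr (.const (2 * d + 3) 8))
      (.seq (.instr (.arith .mul (2 * d + 1) (2 * d + 1) (2 * d + 3)))
      (.seq (.instr (.const (2 * d + 3) (a : ℕ)))
      (.seq (.instr (.arith .add (2 * d + 1) (2 * d + 1) (2 * d + 3)))
      (.instr (.load (2 * d + 1) (2 * d + 1)))))))

end Ex

/-- The cost unit that belongs to the bound `B` for all numbers. -/
def unit (B : ℕ) : ℕ := bitLength (B : ℤ)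

theorem unit_pos (B : ℕ) : 1 ≤ unit B := bitLength_pos _

theorem bitLength_le_unit {B : ℕ} {z : ℤ} (h : |z| ≤ (B : ℤ)) : bitLength z ≤ unit B :=
  bitLength_mono (by simpa using h)

theorem Ex.bitLength_eval_le {B : ℕ} {st : St} (hb : st.Bdd B) :
    ∀ e : Ex, bitLength (e.eval st) ≤ e.wt * unit B
  | lit z => (bitLength_le_natAbs z).trans (Nat.le_mul_of_pos_right _ (unit_pos B))
  | var x => by simpa [wt] using bitLength_le_unit (hb.v x)
  | bin op a b => by
    have := bitLength_eval_le hb a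
    have := bitLength_eval_le hb b
    have := RAM.bitLength_eval_le op (a.eval st) (b.eval st)
    simp only [eval, wt, add_mul]; omega
  | get a i => by simpa [wt] using bitLength_le_unit (hb.arr a _)

/-- Two configurations that differ only in the odd registers from `2 * d + 1` on. -/
structure Agree (d : ℕ) (σ τ : Config) : Prop where
  reg : ∀ r, (2 ∣ r ∨ r < 2 * d + 1) → τ.reg r = σ.reg r
  mem : τ.mem = σ.mem
  inp : τ.input = σ.input
  out : τ.output = σ.output

theorem Agree.trans {d e : ℕ} {σ τ υ : Config} (h : Agree d σ τ) (h' : Agree e τ υ)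
    (hd : d ≤ e) : Agree d σ υ where
  reg r hr := (h'.reg r (hr.imp_right (by omega))).trans (h.reg r hr)
  mem := h'.mem.trans h.mem
  inp := h'.inp.trans h.inp
  out := h'.out.trans h.out

theorem Agree.sim {d : ℕ} {σ τ : Config} {st : St} (h : Agree d σ τ) (hs : Sim σ st) :
    Sim τ st where
  reg x := (h.reg _ (Or.inl ⟨x, rfl⟩)).trans (hs.reg x)
  mem a i := by rw [h.mem, hs.mem]
  inp := h.inp.trans hs.inp
  out := h.out.trans hs.out

theorem agree_update {d : ℕ} (σ : Config) {r : ℕ} (z : ℤ) (h : 2 * d + 1 ≤ r) (h2 : ¬ 2 ∣ r) :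
    Agree d σ { σ with reg := Function.update σ.reg r z } where
  reg q hq := Function.update_of_ne (by rintro rfl; omega) _ _
  mem := rfl
  inp := rfl
  out := rfl

/-- The odd registers serve as an evaluation stack. Code at depth `d` writes only odd registers from
`2 * d + 1` on, so evaluating a right operand at depth `d + 1` preserves the left one, and
variables, being in even registers, are never disturbed. `Agree d` expresses this. -/
theorem Ex.comp_run {B : ℕ} {st : St} (hb : st.Bdd B) :
    ∀ (e : Ex) (d : ℕ) (σ : Config), Sim σ st → e.ok st → ∃ c τ, Run (e.comp d) σ c τ ∧
      c ≤ e.time * unit B ∧ τ.reg (2 * d + 1) = e.eval st ∧ Agree d σ τ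
  | lit z, d, σ, _, _ => by
    refine ⟨_, _, .instr _ _, ?_, by simp [Instr.apply], agree_update _ _ (by omega) (by omega)⟩
    have := bitLength_le_natAbs z
    refine le_trans ?_ (Nat.le_mul_of_pos_right _ (unit_pos B))
    simp only [Instr.cost, time]; omega
  | var x, d, σ, hs, _ => by
    refine ⟨_, _, .seq (.instr _ _) (.instr _ _), ?_, ?_,
      (agree_update _ _ (by omega) (by omega)).trans
        (agree_update _ _ (by omega) (by omega)) le_rfl⟩
    · have h1 := bitLength_le_unit (hb.v x)
      have h2 := unit_pos B
      have h0 : bitLength 0 = 1 := by simp [bitLength]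
      have h3 : 2 * x ≠ 2 * d + 1 := by omega
      simp only [Instr.cost, Instr.apply, time, Function.update_self,
        Function.update_of_ne h3, hs.reg, h0]
      omega
    · have h3 : 2 * x ≠ 2 * d + 1 := by omega
      simp [Instr.apply, Op.eval, Function.update_of_ne h3, hs.reg]
  | bin op a b, d, σ, hs, ho => by
    obtain ⟨c₁, τ₁, r₁, k₁, e₁, g₁⟩ := comp_run hb a d σ hs ho.1
    obtain ⟨c₂, τ₂, r₂, k₂, e₂, g₂⟩ := comp_run hb b (d + 1) τ₁ (g₁.sim hs) ho.2
    have e₁' : τ₂.reg (2 * d + 1) = a.eval st := by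
      rw [g₂.reg _ (Or.inr (by omega)), e₁]
    have e₂' : τ₂.reg (2 * d + 3) = b.eval st := e₂
    refine ⟨_, _, .seq r₁ (.seq r₂ (.instr _ _)), ?_, ?_,
      (g₁.trans g₂ (by omega)).trans (agree_update _ _ (by omega) (by omega)) le_rfl⟩
    · have h1 := bitLength_eval_le hb a
      have h2 := bitLength_eval_le hb b
      have h3 := unit_pos B
      simp only [Instr.cost, e₁', e₂', time, add_mul]
      omega
    · simp [Instr.apply, e₁', e₂', eval]
  | get a i, d, σ, hs, ho => by
    obtain ⟨c₁, τ₁, r₁, k₁, e₁, g₁⟩ := comp_run hb i d σ hs ho.1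
    have hi : 0 ≤ i.eval st := ho.2
    have n1 : 2 * d + 1 ≠ 2 * d + 3 := by omega
    have n2 : 2 * d + 3 ≠ 2 * d + 1 := by omega
    have hm := (g₁.sim hs).mem a (i.eval st).toNat
    have ha : (i.eval st * 8 + ((a : ℕ) : ℤ)).toNat = 8 * (i.eval st).toNat + a := by omega
    refine ⟨_, _, .seq r₁ (.seq (.instr _ _) (.seq (.instr _ _) (.seq (.instr _ _)
      (.seq (.instr _ _) (.instr _ _))))), ?_, ?_, ?_⟩
    · have h1 := bitLength_eval_le hb i
      have h2 := RAM.bitLength_eval_le .mul (i.eval st) 8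
      have h3 := RAM.bitLength_eval_le .add (i.eval st * 8) ((a : ℕ) : ℤ)
      have h8 : bitLength 8 ≤ 9 := bitLength_le_natAbs 8
      have ha' := bitLength_le_natAbs ((a : ℕ) : ℤ)
      have hm' := bitLength_le_unit (hb.arr a (i.eval st).toNat)
      have hu := unit_pos B
      have := a.2
      simp only [Op.eval] at h2 h3
      simp only [Instr.cost, Instr.apply, Op.eval, Function.update_self, e₁, ne_eq, n1,
        not_false_eq_true, Function.update_of_ne, ha, hm, time, add_mul]
      simp only [Int.natAbs_natCast] at ha'
      rw [mul_assoc 3]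
      omega
    · simp [Instr.apply, Op.eval, e₁, ha, hm]
    · exact ((((g₁.trans (agree_update _ _ (by omega) (by omega)) le_rfl).trans
        (agree_update _ _ (by omega) (by omega)) le_rfl).trans
        (agree_update _ _ (by omega) (by omega)) le_rfl).trans
        (agree_update _ _ (by omega) (by omega)) le_rfl).trans
        (agree_update _ _ (by omega) (by omega)) le_rfl

/-! ### Commands and their weakest preconditions -/

namespace Prog

/-- `x := e` -/
def set (x : ℕ) (e : Ex) : Prog :=
  .seq (e.comp 0) (.seq (.instr (.const 3 0)) (.instr (.arith .add (2 * x) 1 3)))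

/-- `a[i] := e` -/
def put (a : Fin 8) (i e : Ex) : Prog :=
  .seq ((Ex.lit 8 * i + Ex.lit (a : ℕ)).comp 0) (.seq (e.comp 1) (.instr (.store 1 3)))

/-- `read x` -/
def input (x : ℕ) : Prog := .instr (.read (2 * x))

/-- `write e` -/
def output (e : Ex) : Prog := .seq (e.comp 0) (.instr (.write 1))

/-- `if 0 < e then p else q` -/
def cond (e : Ex) (p q : Prog) : Prog := .seq (e.comp 0) (.ite 1 p q)

/-- `while 0 < x do p` -/
def loopv (x : ℕ) (p : Prog) : Prog := .loop (2 * x) p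

/-- `for i < e do p`, where `k` is an auxiliary variable -/
def for_ (i k : ℕ) (e : Ex) (p : Prog) : Prog :=
  .seq (set k e) (.seq (set i (.lit 0)) (loopv k (.seq p (.seq (set i (.var i + .lit 1))
    (set k (.var k - .lit 1))))))

end Prog

/-- Started in state `st`, with all numbers bounded by `B`, the program `p` terminates after at
most `T` units of time in a state with property `Q`, again with all numbers bounded by `B`. -/
def Wp (B : ℕ) (p : Prog) (T : ℕ) (st : St) (Q : St → Prop) : Prop :=
  ∀ σ, Sim σ st → st.Bdd B → ∃ c τ st', Run p σ c τ ∧ c ≤ T * unit B ∧ Sim τ st' ∧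
    st'.Bdd B ∧ Q st'

namespace Wp

variable {B T T₁ T₂ : ℕ} {st : St} {Q R : St → Prop} {p q : Prog}

theorem mono (h : Wp B p T₁ st R) (hT : T₁ ≤ T) (hQ : ∀ st', R st' → Q st') :
    Wp B p T st Q := fun σ hs hb =>
  let ⟨c, τ, st', h1, h2, h3, h4, h5⟩ := h σ hs hb
  ⟨c, τ, st', h1, h2.trans (Nat.mul_le_mul_right _ hT), h3, h4, hQ _ h5⟩

theorem weaken_time (h : Wp B p T₁ st Q) (hT : T₁ ≤ T) : Wp B p T st Q :=
  h.mono hT fun _ => id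

theorem seq (h : Wp B p T₁ st fun st' => Wp B q T₂ st' Q) : Wp B (.seq p q) (T₁ + T₂) st Q := by
  intro σ hs hb
  obtain ⟨c₁, τ₁, st₁, h1, h2, h3, h4, h5⟩ := h σ hs hb
  obtain ⟨c₂, τ₂, st₂, k1, k2, k3, k4, k5⟩ := h5 τ₁ h3 h4
  exact ⟨_, _, _, .seq h1 k1, by rw [add_mul]; omega, k3, k4, k5⟩

theorem skip (h : Q st) : Wp B .skip 1 st Q := fun σ hs hb =>
  ⟨_, _, _, .skip σ, by simpa using unit_pos B, hs, hb, h⟩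

theorem _root_.RAM.Sim.setv {σ : Config} (hs : Sim σ st) (x : ℕ) (z : ℤ) :
    Sim { σ with reg := Function.update σ.reg (2 * x) z } (st.setv x z) where
  reg y := by simp [Function.update_apply, hs.reg]
  mem := hs.mem
  inp := hs.inp
  out := hs.out

theorem _root_.RAM.St.Bdd.setv (hb : st.Bdd B) (x : ℕ) {z : ℤ} (hz : |z| ≤ (B : ℤ)) :
    (st.setv x z).Bdd B where
  v y := by rw [St.setv_v]; split_ifs; exacts [hz, hb.v y]
  arr := hb.arr
  inp := hb.inp

/-- Only the value that is stored has to respect the bound `B`; intermediate values of `e` may be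
larger, and their length is accounted for in `Ex.time`. -/
theorem set {x : ℕ} {e : Ex} (ho : e.ok st) (hz : |e.eval st| ≤ (B : ℤ))
    (h : Q (st.setv x (e.eval st))) : Wp B (.set x e) (e.time + 5) st Q := by
  intro σ hs hb
  obtain ⟨c, τ, r, k, he, g⟩ := e.comp_run hb 0 σ hs ho
  have he' : τ.reg 1 = e.eval st := he
  refine ⟨_, _, _, .seq r (.seq (.instr _ _) (.instr _ _)), ?_, ?_, hb.setv x hz, h⟩
  · have h1 := bitLength_le_unit hz
    have h2 := unit_pos B
    have h0 : bitLength 0 = 1 := by simp [bitLength]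
    simp only [Instr.cost, Instr.apply, Function.update_self, h0, add_mul, he', ne_eq,
      OfNat.one_ne_ofNat, not_false_eq_true, Function.update_of_ne]
    omega
  · have g' : Agree 0 σ _ := g.trans (agree_update (d := 0) τ (r := 3) 0 (by omega) (by omega))
      le_rfl
    simpa [Instr.apply, Op.eval, he'] using (g'.sim hs).setv x (e.eval st)

theorem put {a : Fin 8} {i e : Ex} (hi : i.ok st) (hi0 : 0 ≤ i.eval st) (ho : e.ok st)
    (hz : |e.eval st| ≤ (B : ℤ)) (h : Q (st.seta a (i.eval st).toNat (e.eval st))) :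
    Wp B (.put a i e) (i.time + e.time + 3 * i.wt + 100) st Q := by
  intro σ hs hb
  obtain ⟨c₁, τ₁, r₁, k₁, e₁, g₁⟩ := (Ex.lit 8 * i + Ex.lit (a : ℕ)).comp_run hb 0 σ hs
    (by simpa using hi)
  obtain ⟨c₂, τ₂, r₂, k₂, e₂, g₂⟩ := e.comp_run hb 1 τ₁ (g₁.sim hs) ho
  have e₁' : τ₂.reg 1 = 8 * i.eval st + (a : ℕ) := by
    rw [g₂.reg _ (Or.inr (by omega))]; simpa using e₁
  have e₂' : τ₂.reg 3 = e.eval st := e₂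
  have hs' : Sim τ₂ st := g₂.sim (g₁.sim hs)
  have ha : (8 * i.eval st + ((a : ℕ) : ℤ)).toNat = 8 * (i.eval st).toNat + a := by omega
  refine ⟨_, _, _, .seq r₁ (.seq r₂ (.instr _ _)), ?_, ?_, ?_, h⟩
  · have h1 := bitLength_le_unit hz
    have h2 := unit_pos B
    have h3 := Ex.bitLength_eval_le hb (Ex.lit 8 * i + Ex.lit (a : ℕ))
    have h4 : (Ex.lit 8 * i + Ex.lit (a : ℕ)).wt = 9 + i.wt + (a + 1) := rfl
    have h5 : (Ex.lit 8 * i + Ex.lit (a : ℕ)).time =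
      (10 + i.time + 1 + 9 + i.wt) + (a + 2) + 1 + (9 + i.wt) + (a + 1) := rfl
    have h6 : (Ex.lit 8 * i + Ex.lit (a : ℕ)).eval st = 8 * i.eval st + (a : ℕ) := rfl
    rw [h6, h4] at h3
    rw [h5] at k₁
    have h7 : (a : ℕ) * RAM.unit B ≤ 7 * RAM.unit B := Nat.mul_le_mul_right _ (by omega)
    simp only [Instr.cost, e₁', e₂', add_mul, one_mul] at h3 k₁ ⊢
    rw [mul_assoc 3]
    omega
  · refine ⟨hs'.reg, fun b j => ?_, hs'.inp, hs'.out⟩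
    have h1 := hs'.mem b j
    simp only [Instr.apply, e₁', e₂', ha, St.seta_arr, Function.update_apply, h1]
    refine if_congr ?_ rfl rfl
    rw [Fin.ext_iff]
    omega
  · refine ⟨hb.v, fun b j => ?_, hb.inp⟩
    rw [St.seta_arr]; split_ifs; exacts [hz, hb.arr b j]

theorem set_eq {x : ℕ} {e : Ex} (z : ℤ) (ho : e.ok st) (he : e.eval st = z)
    (hz : |z| ≤ (B : ℤ)) (h : Q (st.setv x z)) : Wp B (.set x e) (e.time + 5) st Q :=
  set ho (he ▸ hz) (he ▸ h)

theorem put_eq {a : Fin 8} {i e : Ex} (j : ℕ) (z : ℤ) (hi : i.ok st) (hj : i.eval st = j)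
    (ho : e.ok st) (he : e.eval st = z) (hz : |z| ≤ (B : ℤ)) (h : Q (st.seta a j z)) :
    Wp B (.put a i e) (i.time + e.time + 3 * i.wt + 100) st Q :=
  put hi (by omega) ho (he ▸ hz) (by rw [hj, he]; exact h)

theorem input {x : ℕ} {z : ℤ} {l : List ℤ} (hi : st.inp = z :: l)
    (h : |z| ≤ (B : ℤ) → Q ((st.seti l).setv x z)) : Wp B (.input x) 2 st Q := by
  intro σ hs hb
  have hz : |z| ≤ (B : ℤ) := hb.inp z (by simp [hi])
  refine ⟨_, _, _, .instr _ _, ?_, ?_, ?_, h hz⟩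
  · have h1 := bitLength_le_unit hz
    have h2 := unit_pos B
    simp only [Instr.cost, hs.inp, hi, List.headD_cons]; omega
  · have := hs.setv x z
    exact ⟨by simpa [Instr.apply, hs.inp, hi] using this.reg, hs.mem,
      by simp [Instr.apply, hs.inp, hi], hs.out⟩
  · refine ⟨(hb.setv x hz).v, hb.arr, fun y hy => hb.inp y ?_⟩
    simp only [St.setv_inp, St.seti_inp] at hy
    simp [hi, hy]

theorem output {e : Ex} (ho : e.ok st) (h : Q (st.addo (e.eval st))) :
    Wp B (.output e) (e.time + e.wt + 1) st Q := by
  intro σ hs hb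
  obtain ⟨c, τ, r, k, he, g⟩ := e.comp_run hb 0 σ hs ho
  have he' : τ.reg 1 = e.eval st := he
  have hs' := g.sim hs
  refine ⟨_, _, st.addo (e.eval st), .seq r (.instr _ _), ?_, ?_, ⟨hb.v, hb.arr, hb.inp⟩, h⟩
  · have h1 := Ex.bitLength_eval_le hb e
    have h2 := unit_pos B
    simp only [Instr.cost, he', add_mul]; omega
  · exact ⟨hs'.reg, hs'.mem, hs'.inp, by simp [Instr.apply, he', hs'.out]⟩

theorem cond {e : Ex} (ho : e.ok st) (hp : 0 < e.eval st → Wp B p T₁ st Q)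
    (hq : e.eval st ≤ 0 → Wp B q T₂ st Q) :
    Wp B (.cond e p q) (e.time + e.wt + 1 + max T₁ T₂) st Q := by
  intro σ hs hb
  obtain ⟨c, τ, r, k, he, g⟩ := e.comp_run hb 0 σ hs ho
  have he' : τ.reg 1 = e.eval st := he
  have h1 := Ex.bitLength_eval_le hb e
  have h2 := unit_pos B
  have m1 : T₁ * RAM.unit B ≤ max T₁ T₂ * RAM.unit B := Nat.mul_le_mul_right _ (le_max_left _ _)
  have m2 : T₂ * RAM.unit B ≤ max T₁ T₂ * RAM.unit B := Nat.mul_le_mul_right _ (le_max_right _ _)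
  by_cases h0 : 0 < e.eval st
  · obtain ⟨c', τ', st', h1', h2', h3', h4', h5'⟩ := hp h0 τ (g.sim hs) hb
    refine ⟨_, _, _, .seq r (.ite_pos (he' ▸ h0) h1'), ?_, h3', h4', h5'⟩
    simp only [he', add_mul]; omega
  · obtain ⟨c', τ', st', h1', h2', h3', h4', h5'⟩ := hq (not_lt.1 h0) τ (g.sim hs) hb
    refine ⟨_, _, _, .seq r (.ite_neg (he' ▸ h0) h1'), ?_, h3', h4', h5'⟩
    simp only [he', add_mul]; omega

/-- Elapsed time is subtracted from a given budget instead of being summed up. For straight-line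
code with a numeral as budget the side conditions are then settled by `decide`. -/
theorem step (hT : T₁ ≤ T) (h : Wp B p T₁ st fun st' => Wp B q (T - T₁) st' Q) :
    Wp B (.seq p q) T st Q := (seq h).weaken_time (by omega)

theorem cond_step {e : Ex} (ho : e.ok st) (hT : e.time + e.wt + 1 ≤ T)
    (hp : 0 < e.eval st → Wp B p (T - (e.time + e.wt + 1)) st Q)
    (hq : e.eval st ≤ 0 → Wp B q (T - (e.time + e.wt + 1)) st Q) :
    Wp B (.cond e p q) T st Q := (cond ho hp hq).weaken_time (by rw [max_self]; omega)

/-- The index of `J` is the number of iterations still to come, so termination is part of the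
invariant. Each test of the loop variable costs at most two units. -/
theorem loopv {x : ℕ} (J : ℕ → St → Prop) (h0 : ∀ st', J 0 st' → st'.v x ≤ 0 ∧ Q st')
    (hs : ∀ j st', J (j + 1) st' → 0 < st'.v x ∧ Wp B p T st' (J j)) :
    ∀ n st, J n st → Wp B (.loopv x p) (n * (T + 2) + 2) st Q := by
  intro n
  induction n with
  | zero =>
    intro st h σ hσ hb
    refine ⟨_, _, _, RAM.Run.loop_stop (by rw [hσ.reg]; exact not_lt.2 (h0 _ h).1), ?_, hσ, hb,
      (h0 _ h).2⟩
    have h1 := bitLength_le_unit (hb.v x)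
    have h2 := unit_pos B
    rw [hσ.reg]; omega
  | succ n ih =>
    intro st h σ hσ hb
    obtain ⟨c₁, τ₁, st₁, h1, h2, h3, h4, h5⟩ := (hs n st h).2 σ hσ hb
    obtain ⟨c₂, τ₂, st₂, k1, k2, k3, k4, k5⟩ := ih st₁ h5 τ₁ h3 h4
    refine ⟨_, _, _, .loop_step (by rw [hσ.reg]; exact (hs n st h).1) h1 k1, ?_, k3, k4, k5⟩
    have e1 := bitLength_le_unit (hb.v x)
    have e2 := unit_pos B
    rw [hσ.reg]
    have e3 : ((n + 1) * (T + 2) + 2) * RAM.unit B =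
      (n * (T + 2) + 2) * RAM.unit B + T * RAM.unit B + 2 * RAM.unit B := by ring
    omega

/-- The counting loop: `J j` holds before iteration `j`, and it does not depend on the loop
variables. -/
theorem for_ {i k : ℕ} {e : Ex} (n : ℕ) (J : ℕ → St → Prop) (hik : i ≠ k) (ho : e.ok st)
    (he : e.eval st = n) (hn : n ≤ B) (hJ : ∀ j st' y z, J j st' → J j ((st'.setv k y).setv i z))
    (h0 : J 0 st)
    (hs : ∀ j st', j < n → J j st' → st'.v i = j → Wp B p T st'
      fun st'' => st''.v i = j ∧ st''.v k = st'.v k ∧ J (j + 1) st'')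
    (hQ : ∀ st', J n st' → Q st') :
    Wp B (.for_ i k e p) (n * (T + 50) + e.time + 50) st Q := by
  refine Wp.weaken_time (Wp.seq (Wp.set ho (by rw [he]; simpa using hn) (Wp.seq (Wp.set trivial
    -- Here `m` is the number of remaining iterations, kept in `k`, while `i` holds `n - m`. The two
    -- updates at the end of the body take 17 units each.
    (by simp) (loopv (B := B) (T := T + (17 + 17))
      (fun m st' => m ≤ n ∧ J (n - m) st' ∧ st'.v k = m ∧ st'.v i = ((n - m : ℕ) : ℤ))
      ?_ ?_ n _ ?_))))) (T₁ := e.time + 5 + (2 + 5 + (n * (T + (17 + 17) + 2) + 2))) ?_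
  · rintro st' ⟨-, h1, h2, -⟩
    exact ⟨by simp [h2], hQ _ (by simpa using h1)⟩
  · rintro m st' ⟨hm, h1, h2, h3⟩
    refine ⟨by rw [h2]; positivity, Wp.seq ((hs _ st' (by omega) h1 h3).mono le_rfl ?_)⟩
    rintro st'' ⟨k1, k2, k3⟩
    have e1 : n - (m + 1) + 1 = n - m := by omega
    refine Wp.seq (Wp.set ?_ ?_ (Wp.set ?_ ?_ ?_))
    · simp
    · simp only [Ex.eval_add, Ex.eval_var, k1, Ex.eval_lit]; rw [abs_le]; omega
    · simp
    · simp only [Ex.eval_sub, Ex.eval_var, St.setv_v, if_neg hik.symm, k2, h2, Ex.eval_lit]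
      rw [abs_le]; push_cast; omega
    · refine ⟨by omega, ?_, ?_, ?_⟩
      · have := hJ _ _ (st''.v k - 1) (st''.v i + 1) k3
        rw [e1] at this
        convert this using 1
        simp only [Ex.eval_add, Ex.eval_sub, Ex.eval_var, Ex.eval_lit, St.setv_v,
          if_neg hik.symm]
        simp only [St.setv]
        rw [Function.update_comm hik]
      · simp [hik.symm, k2, h2]
      · simp only [Ex.eval_add, Ex.eval_sub, Ex.eval_var, Ex.eval_lit, St.setv_v, if_neg hik]
        simp only [if_true, k1]; omega
  · refine ⟨le_rfl, ?_, ?_, ?_⟩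
    · simpa [he] using hJ 0 st n 0 h0
    · simp [hik.symm, he]
    · simp
  · have : n * (T + (17 + 17) + 2) ≤ n * (T + 50) := Nat.mul_le_mul_left _ (by omega)
    omega

end Wp

end RAM
/-! ## Edge progressions -/

namespace WSExpH

section Walks

variable {V : Type}

@[simp] theorem edgeSeq_nil : edgeSeq ([] : List V) = [] := rfl

@[simp] theorem edgeSeq_singleton (v : V) : edgeSeq [v] = [] := rfl

@[simp] theorem edgeSeq_cons_cons (v w : V) (x : List V) :
    edgeSeq (v :: w :: x) = (v, w) :: edgeSeq (w :: x) := rfl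

theorem edgeSeq_append_cons (p : List V) (v : V) (r : List V) :
    edgeSeq (p ++ v :: r) = edgeSeq (p ++ [v]) ++ edgeSeq (v :: r) := by
  induction p with
  | nil => simp
  | cons a p ih => cases p <;> simp_all

variable {E : Finset (V × V)} {s t v w : V}

theorem IsEdgeProgression.split {p r : List V} (h : IsEdgeProgression E s t (p ++ v :: r)) :
    IsEdgeProgression E s v (p ++ [v]) ∧ IsEdgeProgression E v t (v :: r) := by
  obtain ⟨h1, h2, h3⟩ := h
  rw [edgeSeq_append_cons] at h3
  refine ⟨⟨?_, by simp, fun e he => h3 e (by simp [he])⟩,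
    ⟨by simp, ?_, fun e he => h3 e (by simp [he])⟩⟩
  · cases p <;> simpa using h1
  · simpa [List.getLast?_append] using h2

theorem IsEdgeProgression.join {p r : List V} (h : IsEdgeProgression E s v (p ++ [v]))
    (h' : IsEdgeProgression E v t (v :: r)) : IsEdgeProgression E s t (p ++ v :: r) := by
  refine ⟨?_, ?_, ?_⟩
  · have := h.1; cases p <;> simpa using this
  · simpa [List.getLast?_append] using h'.2.1
  · rw [edgeSeq_append_cons]
    intro e he
    rcases List.mem_append.1 he with he | he
    exacts [h.2.2 e he, h'.2.2 e he]

theorem IsEdgeProgression.cases {x : List V} (h : IsEdgeProgression E v t x) :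
    (v = t ∧ x = [v]) ∨ ∃ w r, x = v :: w :: r ∧ (v, w) ∈ E ∧
      IsEdgeProgression E w t (w :: r) := by
  obtain ⟨h1, h2, h3⟩ := h
  match x with
  | [] => simp at h1
  | [a] =>
    simp only [List.head?_cons, Option.some.injEq] at h1
    simp only [List.getLast?_singleton, Option.some.injEq] at h2
    subst h1; exact Or.inl ⟨h2, rfl⟩
  | a :: w :: r =>
    simp only [List.head?_cons, Option.some.injEq] at h1
    subst h1
    refine Or.inr ⟨w, r, rfl, h3 _ (by simp), by simp, by simpa using h2, fun e he => h3 e ?_⟩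
    simp [he]

theorem IsEdgeProgression.cons {x : List V} (hvw : (v, w) ∈ E)
    (h : IsEdgeProgression E w t x) : IsEdgeProgression E v t (v :: x) := by
  obtain ⟨h1, h2, h3⟩ := h
  match x with
  | [] => simp at h1
  | a :: r =>
    simp only [List.head?_cons, Option.some.injEq] at h1
    subst h1
    exact ⟨by simp, by simpa using h2, by simpa using ⟨hvw, fun a b hab => h3 (a, b) hab⟩⟩

theorem edgeSeq_cons_of {x : List V} (h : IsEdgeProgression E w t x) :
    edgeSeq (v :: x) = (v, w) :: edgeSeq x := by
  rcases h.cases with ⟨-, rfl⟩ | ⟨a, r, rfl, -⟩ <;> rfl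

theorem exists_eq_of_not_nodup {l : List V} (h : ¬ l.Nodup) :
    ∃ a x b d, l = a ++ x :: (b ++ x :: d) := by
  induction l with
  | nil => simp at h
  | cons y l ih =>
    by_cases hy : y ∈ l
    · obtain ⟨b, d, rfl⟩ := List.append_of_mem hy
      exact ⟨[], y, b, d, rfl⟩
    · obtain ⟨a, x, b, d, rfl⟩ := ih fun hl => h (List.nodup_cons.2 ⟨hy, hl⟩)
      exact ⟨y :: a, x, b, d, rfl⟩

theorem cost_append_cons (c : V × V → ℚ) (p : List V) (v : V) (r : List V) :
    cost c (p ++ v :: r) = cost c (p ++ [v]) + cost c (v :: r) := by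
  simp [cost, edgeSeq_append_cons p v r]

/-- Without cycles of negative cost, closed edge progressions have nonnegative cost. -/
theorem cost_closed_nonneg {c : V × V → ℚ} (hc : ∀ w, IsCycle E w → 0 ≤ cost c w) :
    ∀ (m : ℕ) (x : List V) (v : V), x.length ≤ m → IsEdgeProgression E v v x → 0 ≤ cost c x := by
  intro m
  induction m with
  | zero =>
    intro x v hx h
    have : x = [] := List.length_eq_zero_iff.1 (by omega)
    subst this; simp [cost]
  | succ m ih =>
    intro x v hx h
    rcases h.cases with ⟨-, rfl⟩ | ⟨w, r, rfl, -, -⟩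
    · simp [cost]
    by_cases hd : (w :: r).Nodup
    · exact hc _ ⟨⟨v, h⟩, by simp, hd⟩
    -- At a repeated vertex `y`, the closed segment from `y` to `y` is cut out. It and the remainder
    -- are shorter closed progressions, and their costs add up to the original cost.
    · obtain ⟨a, y, b, d, e⟩ := exists_eq_of_not_nodup hd
      rw [e] at h hx ⊢
      simp only [List.length_cons, List.length_append] at hx
      have h1 := IsEdgeProgression.split (p := v :: a) h
      have h2 := IsEdgeProgression.split (p := y :: b) h1.2
      have k1 := ih _ _ (by simp; omega) (h1.1.join h2.2)
      have k2 := ih _ _ (by simp; omega) h2.1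
      have e1 := cost_append_cons c (v :: a) y (b ++ y :: d)
      have e2 := cost_append_cons c (y :: b) y d
      have e3 := cost_append_cons c (v :: a) y d
      simp only [List.cons_append] at e1 e2 e3 k1 k2 ⊢
      linarith

end Walks

/-! ### Networks with important edges -/

/-- A directed graph with integral edge weights `W` and integral weights `G` of the important
edges, which are numbered `0, …, k - 1`. -/
structure Net (n : ℕ) where
  E : Finset (Fin n × Fin n)
  E' : Finset (Fin n × Fin n)
  t : Fin n
  W : Fin n × Fin n → ℤ
  G : Fin n × Fin n → ℤ
  num : Fin n × Fin n → ℕ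
  k : ℕ
  num_lt : ∀ e ∈ E', num e < k
  num_inj : ∀ e ∈ E', ∀ f ∈ E', num e = num f → e = f
  G_eq_zero : ∀ e ∉ E', G e = 0

namespace Net

variable {n : ℕ} (N : Net n)

/-- The bit that represents an edge in sets of important edges. -/
def pw (e : Fin n × Fin n) : ℕ := if e ∈ N.E' then 2 ^ N.num e else 0

/-- `1` if the edge does not belong to the set `S`, and `0` if it does. -/
def fresh (S : ℕ) (e : Fin n × Fin n) : ℕ := 1 - S / N.pw e % 2

/-- The set of important edges after a traversal of `e`. -/
def step (S : ℕ) (e : Fin n × Fin n) : ℕ := S + N.fresh S e * N.pw e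

/-- Membership in sets of important edges. -/
def Has (S : ℕ) (e : Fin n × Fin n) : Prop := e ∈ N.E' ∧ S.testBit (N.num e) = true

theorem fresh_le (S : ℕ) (e : Fin n × Fin n) : N.fresh S e ≤ 1 := Nat.sub_le _ _

theorem fresh_eq_zero {S : ℕ} {e : Fin n × Fin n} (h : N.Has S e) : N.fresh S e = 0 := by
  have := h.2
  rw [Nat.testBit_eq_decide_div_mod_eq, decide_eq_true_eq] at this
  simp [fresh, pw, h.1, this]

/-- For an edge that is not important, `pw` is 0 and division by 0 yields 0, so `fresh` is 1. This
is harmless, as `pw` and `G` vanish there, and it spares the program a case distinction. -/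
theorem fresh_eq_one {S : ℕ} {e : Fin n × Fin n} (h : ¬ N.Has S e) : N.fresh S e = 1 := by
  unfold fresh pw
  split_ifs with he
  · have : ¬ S.testBit (N.num e) = true := fun h' => h ⟨he, h'⟩
    rw [Nat.testBit_eq_decide_div_mod_eq, decide_eq_true_eq] at this
    omega
  · simp

/-- The machine has no bit operations; an absent element is inserted into a set by adding its power
of two. -/
theorem _root_.Nat.add_two_pow_eq_or {S i : ℕ} (h : S.testBit i = false) :
    S + 2 ^ i = S ||| 2 ^ i := by
  have hm : S / 2 ^ i % 2 = 0 := by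
    rw [Nat.testBit_eq_decide_div_mod_eq, decide_eq_false_iff_not] at h
    omega
  obtain ⟨a, ha⟩ := Nat.dvd_of_mod_eq_zero hm
  have hb : S % 2 ^ i < 2 ^ i := Nat.mod_lt _ (by positivity)
  have hS : S = 2 ^ i * (2 * a) + S % 2 ^ i := by rw [← ha]; exact (Nat.div_add_mod _ _).symm
  generalize S % 2 ^ i = b at hb hS
  subst hS
  apply Nat.eq_of_testBit_eq
  intro j
  have e : 2 ^ i * (2 * a) + b + 2 ^ i = 2 ^ i * (2 * a + 1) + b := by ring
  rw [e, Nat.testBit_or, Nat.testBit_two_pow_mul_add _ hb, Nat.testBit_two_pow_mul_add _ hb,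
    Nat.testBit_two_pow]
  rcases lt_trichotomy j i with hj | rfl | hj
  · simp [hj, hj.ne']
  · simp
  · obtain ⟨c, rfl⟩ := Nat.exists_eq_add_of_lt hj
    have : i + c + 1 - i = c + 1 := by omega
    have h2 : (2 * a + 1) / 2 = a := by omega
    simp [this, Nat.testBit_succ, h2]
    omega

theorem step_eq_or (S : ℕ) (e : Fin n × Fin n) (he : e ∈ N.E') :
    N.step S e = S ||| 2 ^ N.num e := by
  have hp : N.pw e = 2 ^ N.num e := by simp [pw, he]
  by_cases h : N.Has S e
  · rw [step, N.fresh_eq_zero h, Nat.zero_mul, Nat.add_zero]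
    apply Nat.eq_of_testBit_eq
    intro i
    by_cases hi : N.num e = i
    · subst hi; simp [h.2]
    · simp [hi]
  · have h' : S.testBit (N.num e) = false := by
      by_contra h'; exact h ⟨he, by simpa using h'⟩
    rw [step, N.fresh_eq_one h, Nat.one_mul, hp]
    exact Nat.add_two_pow_eq_or h'

theorem step_of_notMem (S : ℕ) {e : Fin n × Fin n} (he : e ∉ N.E') : N.step S e = S := by
  simp [step, pw, he]

theorem step_lt {S : ℕ} (hS : S < 2 ^ N.k) (e : Fin n × Fin n) : N.step S e < 2 ^ N.k := by
  by_cases he : e ∈ N.E'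
  · rw [step_eq_or _ _ _ he]
    exact Nat.or_lt_two_pow hS (Nat.pow_lt_pow_right (by norm_num) (N.num_lt e he))
  · rwa [step_of_notMem _ _ he]

theorem has_step (S : ℕ) (e f : Fin n × Fin n) :
    N.Has (N.step S e) f ↔ N.Has S f ∨ (f = e ∧ e ∈ N.E') := by
  by_cases he : e ∈ N.E'
  · rw [step_eq_or _ _ _ he]
    unfold Has
    by_cases hf : f ∈ N.E'
    · have : N.num e = N.num f ↔ f = e :=
        ⟨fun h => N.num_inj f hf e he h.symm, fun h => by rw [h]⟩
      simp [hf, he, Nat.testBit_two_pow, this]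
    · have : f ≠ e := fun h => hf (h ▸ he)
      simp [hf, this]
  · simp [step_of_notMem _ _ he, he]

/-- The set of important edges after the traversal of a sequence of edges. -/
def after : ℕ → List (Fin n × Fin n) → ℕ
  | S, [] => S
  | S, e :: l => after (N.step S e) l

/-- The weight of a sequence of edges, if the important edges in `S` have been paid before. -/
def ev : ℕ → List (Fin n × Fin n) → ℤ
  | _, [] => 0
  | S, e :: l => N.W e + N.fresh S e * N.G e + ev (N.step S e) l

theorem after_append (S : ℕ) (l l' : List (Fin n × Fin n)) :
    N.after S (l ++ l') = N.after (N.after S l) l' := by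
  induction l generalizing S with
  | nil => rfl
  | cons e l ih => exact ih _

theorem ev_append (S : ℕ) (l l' : List (Fin n × Fin n)) :
    N.ev S (l ++ l') = N.ev S l + N.ev (N.after S l) l' := by
  induction l generalizing S with
  | nil => simp [ev, after]
  | cons e l ih => simp [ev, after, ih, add_assoc]

theorem after_lt {S : ℕ} (hS : S < 2 ^ N.k) (l : List (Fin n × Fin n)) :
    N.after S l < 2 ^ N.k := by
  induction l generalizing S with
  | nil => exact hS
  | cons e l ih => exact ih (N.step_lt hS e)

theorem has_after (S : ℕ) (l : List (Fin n × Fin n)) (f : Fin n × Fin n) :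
    N.Has (N.after S l) f ↔ N.Has S f ∨ (f ∈ l ∧ f ∈ N.E') := by
  induction l generalizing S with
  | nil => simp [after]
  | cons e l ih =>
    simp only [after, ih, has_step, List.mem_cons]
    constructor
    · rintro ((h | ⟨rfl, h⟩) | ⟨h, h'⟩) <;> tauto
    · rintro (h | ⟨rfl | h, h'⟩) <;> tauto

open Classical in
-- Each bonus is collected at the first traversal only, so the total bonus depends just on which
-- edges occur. In the induction, an important edge not in `S` is charged either as the head `e` or
-- in the tail, but not in both, since `step` has put `e` into the set.
theorem ev_eq (S : ℕ) (l : List (Fin n × Fin n)) :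
    N.ev S l = (l.map N.W).sum + ∑ f ∈ N.E', if f ∈ l ∧ ¬ N.Has S f then N.G f else 0 := by
  induction l generalizing S with
  | nil => simp [ev]
  | cons e l ih =>
    have key : N.fresh S e * N.G e =
        ∑ f ∈ N.E', if f = e ∧ ¬ N.Has S f then N.G f else 0 := by
      by_cases he : e ∈ N.E'
      · rw [Finset.sum_eq_single_of_mem e he (fun f _ hf => if_neg (by tauto))]
        by_cases h : N.Has S e
        · simp [h, N.fresh_eq_zero h]
        · simp [h, N.fresh_eq_one h]
      · rw [N.G_eq_zero e he, mul_zero, Finset.sum_eq_zero]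
        intro f hf
        rw [if_neg]
        rintro ⟨rfl, -⟩
        exact he hf
    simp only [ev, ih, List.map_cons, List.sum_cons, key]
    have : ∀ f ∈ N.E', (if f ∈ e :: l ∧ ¬ N.Has S f then N.G f else 0) =
        (if f = e ∧ ¬ N.Has S f then N.G f else 0) +
          if f ∈ l ∧ ¬ N.Has (N.step S e) f then N.G f else 0 := by
      intro f hf
      simp only [has_step, List.mem_cons]
      by_cases h1 : f = e
      · subst h1; by_cases h2 : N.Has S f <;> simp [h2, hf]
      · simp [h1]
    rw [Finset.sum_congr rfl this, Finset.sum_add_distrib]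
    ring

/-- A segment that does not change the set of important edges costs the sum of its weights. -/
theorem ev_of_after_eq {S : ℕ} {l : List (Fin n × Fin n)} (h : N.after S l = S) :
    N.ev S l = (l.map N.W).sum := by
  classical
  rw [ev_eq, Finset.sum_eq_zero, add_zero]
  intro f hf
  refine if_neg fun h' => h'.2 ?_
  rw [← h, has_after]
  exact Or.inr ⟨h'.1, hf⟩

/-- The weight of an edge progression. -/
def val (S : ℕ) (x : List (Fin n)) : ℤ := N.ev S (edgeSeq x)

/-- The predicate that closed edge progressions have nonnegative weight. -/
def Conservative : Prop :=
  ∀ v x, IsEdgeProgression N.E v v x → 0 ≤ ((edgeSeq x).map N.W).sum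

/-- Edge progressions with more vertices than there are pairs of a vertex and a set of important
edges can be shortened. -/
theorem exists_shorter (hN : N.Conservative) {s : Fin n} {x : List (Fin n)}
    (hx : IsEdgeProgression N.E s N.t x) (hl : n * 2 ^ N.k < x.length) :
    ∃ y, IsEdgeProgression N.E s N.t y ∧ y.length < x.length ∧ N.val 0 y ≤ N.val 0 x := by
  -- Position `i` is mapped to the state on arrival there; the prefix that ends in vertex `i` has `i
  -- + 1` vertices. More positions than states force a repetition.
  let f : Fin x.length → Fin n × Fin (2 ^ N.k) := fun i =>
    (x[i], ⟨N.after 0 (edgeSeq (x.take (i + 1))), N.after_lt (by positivity) _⟩)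
  obtain ⟨i, j, hij, hf⟩ : ∃ i j : Fin x.length, i < j ∧ f i = f j := by
    have : ¬ Function.Injective f := by
      intro h
      have := Fintype.card_le_of_injective f h
      simp only [Fintype.card_fin, Fintype.card_prod] at this
      omega
    simp only [Function.Injective, not_forall] at this
    obtain ⟨i, j, h, hne⟩ := this
    rcases lt_or_gt_of_ne hne with h' | h'
    exacts [⟨i, j, h', h⟩, ⟨j, i, h', h.symm⟩]
  simp only [f, Prod.mk.injEq, Fin.mk.injEq, Fin.getElem_fin] at hf
  obtain ⟨hv, hS⟩ := hf
  have hij' : (i : ℕ) < j := hij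
  obtain ⟨p, v, m, r, e, ei, ej⟩ : ∃ p v m r, x = p ++ v :: (m ++ v :: r) ∧
      x.take (i + 1) = p ++ [v] ∧ x.take (j + 1) = p ++ v :: (m ++ [v]) := by
    refine ⟨x.take i, x[(i : ℕ)], (x.drop (i + 1)).take (j - i - 1), x.drop (j + 1), ?_, ?_, ?_⟩
    · have h1 : (x.drop (i + 1)).drop (j - i - 1) = x[(i : ℕ)] :: x.drop (j + 1) := by
        rw [List.drop_drop, show (i : ℕ) + 1 + (j - i - 1) = j by omega, hv]
        exact List.drop_eq_getElem_cons j.2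
      rw [← h1, List.take_append_drop, ← List.drop_eq_getElem_cons i.2, List.take_append_drop]
    · exact (List.take_append_getElem i.2).symm
    · have h1 : (x.drop (i + 1)).take (j - i - 1) ++ [x[(i : ℕ)]] =
          (x.drop (i + 1)).take (j - i) := by
        have h2 : (j : ℕ) - i - 1 < (x.drop (i + 1)).length := by simp; omega
        have h3 := List.take_append_getElem h2
        rw [show (j : ℕ) - i - 1 + 1 = j - i by omega] at h3
        rw [← h3, List.getElem_drop, hv]
        simp only [show (i : ℕ) + 1 + (j - i - 1) = j by omega]
      rw [h1, ← List.take_succ_cons, ← List.drop_eq_getElem_cons i.2]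
      have := List.take_add (l := x) (i := i) (j := j - i + 1)
      rw [← this]; congr 1; omega
  rw [ei, ej] at hS
  subst e
  have h1 := hx.split
  have h2 := IsEdgeProgression.split (p := v :: m) h1.2
  have e1 := edgeSeq_append_cons p v (m ++ v :: r)
  have e2 := edgeSeq_append_cons (v :: m) v r
  have e3 := edgeSeq_append_cons p v (m ++ [v])
  have e4 := edgeSeq_append_cons p v r
  simp only [List.cons_append] at e1 e2 e3 e4 h2
  rw [e3, after_append] at hS
  refine ⟨p ++ v :: r, h1.1.join h2.2, by simp, ?_⟩
  -- The set is the same before and after the closed segment. So the remainder keeps its weight when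
  -- the segment is deleted, and the segment itself carries no bonus and has nonnegative weight.
  simp only [val, e1, e2, e4, ev_append, ← hS]
  rw [N.ev_of_after_eq hS.symm]
  have := hN v _ h2.1
  linarith

theorem exists_short (hN : N.Conservative) {s : Fin n} (m : ℕ) :
    ∀ x : List (Fin n), x.length ≤ m → IsEdgeProgression N.E s N.t x →
      ∃ y, IsEdgeProgression N.E s N.t y ∧ y.length ≤ n * 2 ^ N.k ∧ N.val 0 y ≤ N.val 0 x := by
  induction m with
  | zero => exact fun x hx h => ⟨x, h, by omega, le_rfl⟩
  | succ m ih =>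
    intro x hx h
    by_cases hl : x.length ≤ n * 2 ^ N.k
    · exact ⟨x, h, hl, le_rfl⟩
    · obtain ⟨y, h1, h2, h3⟩ := N.exists_shorter hN h (by omega)
      obtain ⟨z, k1, k2, k3⟩ := ih y (by omega) h1
      exact ⟨z, k1, k2, k3.trans h3⟩

/-! ### Dynamic programming tables -/

/-- The value of going from `v` to `w`, given the values `f` at the next vertex. -/
def via (f : Fin n → ℕ → ℤ) (v : Fin n) (S : ℕ) (w : Fin n) : ℤ :=
  N.W (v, w) + N.fresh S (v, w) * N.G (v, w) + f w (N.step S (v, w))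

/-- The decision `d'` (`0`: infeasible, `1`: stop, `w + 2`: go to `w`) with value `f'` is optimal
in state `(v, S)` among stopping and going to vertices less than `m`, given the decisions `d` and
the values `f` at the next vertex. -/
structure Best (d f : Fin n → ℕ → ℤ) (v : Fin n) (S m : ℕ) (d' f' : ℤ) : Prop where
  valid : (d' = 0 ∧ f' = 0) ∨ (d' = 1 ∧ v = N.t ∧ f' = 0) ∨ ∃ w : Fin n, (v, w) ∈ N.E ∧
    d w (N.step S (v, w)) ≠ 0 ∧ d' = ((w : ℕ) : ℤ) + 2 ∧ f' = N.via f v S w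
  halt : v = N.t → d' ≠ 0 ∧ f' ≤ 0
  go : ∀ w : Fin n, (w : ℕ) < m → (v, w) ∈ N.E → d w (N.step S (v, w)) ≠ 0 →
    d' ≠ 0 ∧ f' ≤ N.via f v S w

/-- The tables `d` and `f`, indexed by the number of remaining vertices, are correct. -/
structure Table (d f : ℕ → Fin n → ℕ → ℤ) (m : ℕ) : Prop where
  zero : ∀ v, ∀ S < 2 ^ N.k, d 0 v S = 0 ∧ f 0 v S = 0
  succ : ∀ j < m, ∀ v, ∀ S < 2 ^ N.k, N.Best (d j) (f j) v S n (d (j + 1) v S) (f (j + 1) v S)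

variable {N} {d f : ℕ → Fin n → ℕ → ℤ} {m : ℕ}

/-- Bellman's argument: the first edge leads to a state one layer below. Negative weights do no harm
here, because the number of vertices is bounded; `Conservative` is needed only to see that `n * 2 ^
k` layers suffice. -/
theorem Table.lower (h : N.Table d f m) : ∀ j ≤ m, ∀ v, ∀ S < 2 ^ N.k, ∀ x : List (Fin n),
    x.length ≤ j → IsEdgeProgression N.E v N.t x → d j v S ≠ 0 ∧ f j v S ≤ N.val S x := by
  intro j
  induction j with
  | zero =>
    intro _ v S _ x hx hp
    have : x = [] := List.length_eq_zero_iff.1 (by omega)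
    subst this; simp [IsEdgeProgression] at hp
  | succ j ih =>
    intro hj v S hS x hx hp
    have hb := h.succ j (by omega) v S hS
    rcases hp.cases with ⟨hv, rfl⟩ | ⟨w, r, rfl, hvw, hr⟩
    · simpa [val, ev] using hb.halt hv
    · obtain ⟨h1, h2⟩ := ih (by omega) w _ (N.step_lt hS (v, w)) (w :: r)
        (by simp at hx ⊢; omega) hr
      obtain ⟨h3, h4⟩ := hb.go w w.2 hvw h1
      refine ⟨h3, h4.trans ?_⟩
      simp only [val, edgeSeq_cons_cons, ev, via] at h2 ⊢
      linarith

/-- `x` is the edge progression given by the decisions `d`. -/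
def Follows (N : Net n) (d : ℕ → Fin n → ℕ → ℤ) : ℕ → Fin n → ℕ → List (Fin n) → Prop
  | 0, _, _, _ => False
  | j + 1, v, S, x => (d (j + 1) v S = 1 ∧ x = [v]) ∨ ∃ (w : Fin n) (y : List (Fin n)),
      d (j + 1) v S = ((w : ℕ) : ℤ) + 2 ∧ x = v :: y ∧ Follows N d j w (N.step S (v, w)) y

/-- The counterpart of `Table.lower`: the table value is attained by the progression that the
decisions describe, so the bound is tight. -/
theorem Table.exists_follows (h : N.Table d f m) : ∀ j ≤ m, ∀ v, ∀ S < 2 ^ N.k, d j v S ≠ 0 →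
    ∃ x, N.Follows d j v S x ∧ x.length ≤ j ∧ IsEdgeProgression N.E v N.t x ∧
      N.val S x = f j v S := by
  intro j
  induction j with
  | zero => exact fun _ v S hS hd => absurd (h.zero v S hS).1 hd
  | succ j ih =>
    intro hj v S hS hd
    rcases (h.succ j (by omega) v S hS).valid with ⟨h1, -⟩ | ⟨h1, h2, h3⟩ | ⟨w, h1, h2, h3, h4⟩
    · exact absurd h1 hd
    · exact ⟨[v], Or.inl ⟨h1, rfl⟩, by simp, ⟨by simp, by simp [h2], by simp⟩,
        by simp [val, ev, h3]⟩
    · obtain ⟨x, k1, k2, k3, k4⟩ := ih (by omega) w _ (N.step_lt hS (v, w)) h2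
      refine ⟨v :: x, Or.inr ⟨w, x, h3, rfl, k1⟩, by simpa using k2, k3.cons h1, ?_⟩
      rw [h4, via, ← k4, val, edgeSeq_cons_of k3]
      rfl

/-- If the table for the start vertex has no entry, then there is no edge progression. -/
theorem Table.infeasible (hN : N.Conservative) (h : N.Table d f (n * 2 ^ N.k)) {s : Fin n}
    (hd : d (n * 2 ^ N.k) s 0 = 0) (x : List (Fin n)) : ¬ IsEdgeProgression N.E s N.t x := by
  intro hx
  obtain ⟨y, h1, h2, -⟩ := N.exists_short hN _ x le_rfl hx
  exact (h.lower _ le_rfl s 0 (by positivity) y h2 h1).1 hd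

/-- The edge progression found by dynamic programming is optimal. -/
theorem Table.optimal (hN : N.Conservative) (h : N.Table d f (n * 2 ^ N.k)) {s : Fin n}
    (hd : d (n * 2 ^ N.k) s 0 ≠ 0) :
    ∃ x, N.Follows d (n * 2 ^ N.k) s 0 x ∧ x.length ≤ n * 2 ^ N.k ∧
      IsEdgeProgression N.E s N.t x ∧
      ∀ y, IsEdgeProgression N.E s N.t y → N.val 0 x ≤ N.val 0 y := by
  obtain ⟨x, h1, h2, h3, h4⟩ := h.exists_follows _ le_rfl s 0 (by positivity) hd
  refine ⟨x, h1, h2, h3, fun y hy => ?_⟩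
  obtain ⟨z, k1, k2, k3⟩ := N.exists_short hN _ y le_rfl hy
  rw [h4]
  exact ((h.lower _ le_rfl s 0 (by positivity) z k2 k1).2).trans k3

end Net

end WSExpH
/-! ## The network of an instance -/

namespace RAM

theorem inputSize_append (l l' : List ℤ) : inputSize (l ++ l') = inputSize l + inputSize l' := by
  simp [inputSize]

theorem inputSize_cons (z : ℤ) (l : List ℤ) : inputSize (z :: l) = bitLength z + inputSize l := by
  simp [inputSize]

theorem inputSize_flatMap_range (f : ℕ → List ℤ) (m : ℕ) :
    inputSize ((List.range m).flatMap f) = ∑ j ∈ Finset.range m, inputSize (f j) := by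
  induction m with
  | zero => simp [inputSize]
  | succ m ih => rw [List.range_succ, List.flatMap_append, inputSize_append, ih,
      Finset.sum_range_succ]; simp

theorem length_le_inputSize (l : List ℤ) : l.length ≤ inputSize l := by
  induction l with
  | nil => simp
  | cons z l ih =>
    rw [inputSize_cons]
    have := bitLength_pos z
    simp only [List.length_cons]; omega

theorem abs_lt_two_pow_bitLength (z : ℤ) : |z| < 2 ^ bitLength z := by
  have h := (natAbs_lt_two_pow z).trans_le
    (Nat.pow_le_pow_right (n := 2) (by norm_num) (Nat.sub_le _ 1))
  rw [Int.abs_eq_natAbs]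
  exact_mod_cast h

theorem abs_le_of_mem {l : List ℤ} {z : ℤ} (h : z ∈ l) : |z| ≤ 2 ^ inputSize l := by
  refine (abs_lt_two_pow_bitLength z).le.trans ?_
  refine pow_le_pow_right₀ (by norm_num) ?_
  exact List.single_le_sum (by simp) _ (List.mem_map_of_mem h)

end RAM

theorem List.flatMap_finRange {β : Type*} (n : ℕ) (f : Fin n → List β) (g : ℕ → List β)
    (h : ∀ i : Fin n, f i = g i) : (List.finRange n).flatMap f = (List.range n).flatMap g := by
  rw [← List.map_coe_finRange_eq_range, List.flatMap_map]
  exact List.flatMap_congr fun i _ => h i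

/-- Merges the row and column loops, so that the program reads and processes the matrix with a
single counter `u * n + v`. -/
theorem List.flatMap_range_mul {β : Type*} (n : ℕ) (g : ℕ → List β) (m : ℕ) :
    (List.range m).flatMap (fun u => (List.range n).flatMap fun v => g (u * n + v)) =
      (List.range (m * n)).flatMap g := by
  induction m with
  | zero => simp
  | succ m ih =>
    rw [List.range_succ, List.flatMap_append, ih, Nat.succ_mul, List.range_add,
      List.flatMap_append, List.flatMap_map]
    simp

namespace WSExpH.Instance

variable (I : Instance)

theorem n_pos : 0 < I.n := I.s.pos

/-- The position of a pair of vertices in the adjacency matrix. -/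
def ix (e : Fin I.n × Fin I.n) : ℕ := e.1 * I.n + e.2

/-- The pair of vertices at a position of the adjacency matrix. -/
def pair (m : ℕ) : Fin I.n × Fin I.n :=
  (⟨m / I.n % I.n, Nat.mod_lt _ I.n_pos⟩, ⟨m % I.n, Nat.mod_lt _ I.n_pos⟩)

@[simp] theorem pair_ix (e : Fin I.n × Fin I.n) : I.pair (I.ix e) = e := by
  obtain ⟨u, v⟩ := e
  have h : ((u : ℕ) * I.n + v) / I.n = u := by
    rw [Nat.add_comm, Nat.add_mul_div_right _ _ I.n_pos, Nat.div_eq_of_lt v.2, Nat.zero_add]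
  simp only [pair, ix, Prod.mk.injEq, Fin.ext_iff]
  rw [h, Nat.mod_eq_of_lt u.2, Nat.mul_add_mod_self_right, Nat.mod_eq_of_lt v.2]
  exact ⟨rfl, rfl⟩

theorem ix_lt (e : Fin I.n × Fin I.n) : I.ix e < I.n * I.n := by
  have h1 := e.1.2
  have h2 := e.2.2
  unfold ix
  nlinarith

theorem ix_pair {m : ℕ} (h : m < I.n * I.n) : I.ix (I.pair m) = m := by
  have : m / I.n < I.n := Nat.div_lt_of_lt_mul h
  simp only [ix, pair, Nat.mod_eq_of_lt this]
  exact Nat.div_add_mod' m I.n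

theorem ix_inj {e f : Fin I.n × Fin I.n} (h : I.ix e = I.ix f) : e = f := by
  rw [← I.pair_ix e, h, pair_ix]

/-- Whether a position of the adjacency matrix belongs to an important edge. -/
def imp (m : ℕ) : Prop := I.pair m ∈ I.E'

instance : DecidablePred I.imp := fun _ => inferInstanceAs (Decidable (_ ∈ _))

/-- An important edge is numbered by the count of important positions before its own. Such numbers
can be assigned while the matrix is being read, and they are exactly those below `|E'|`. -/
theorem count_imp : Nat.count I.imp (I.n * I.n) = I.E'.card := by
  rw [Nat.count_eq_card_filter_range]
  refine Finset.card_bij' (fun m _ => I.pair m) (fun e _ => I.ix e) ?_ ?_ ?_ ?_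
  · intro m hm; simpa [imp] using (Finset.mem_filter.1 hm).2
  · intro e he; exact Finset.mem_filter.2 ⟨Finset.mem_range.2 (I.ix_lt e), by simpa [imp] using he⟩
  · intro m hm; exact I.ix_pair (by simpa using (Finset.mem_filter.1 hm).1)
  · intro e _; exact I.pair_ix e

/-- The costs at a position of the adjacency matrix. -/
def cq (m : ℕ) : ℚ := if I.pair m ∈ I.E then I.c (I.pair m) else 0

/-- The input at a position of the adjacency matrix. -/
def cell (m : ℕ) : List ℤ := [if I.pair m ∈ I.E then 1 else 0, (I.cq m).num, ((I.cq m).den : ℤ),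
  if I.imp m then 1 else 0]

theorem encodePair_eq (e : Fin I.n × Fin I.n) : I.encodePair e = I.cell (I.ix e) := by
  by_cases h : e ∈ I.E
  · simp [encodePair, cell, cq, imp, encodeRat, h]
  · have : e ∉ I.E' := fun h' => h (I.E'_subset h')
    simp [encodePair, cell, cq, imp, h, this]

/-- The coefficients. -/
def lamq (i : ℕ) : ℚ := if h : i < I.N then I.lam ⟨i, h⟩ else 0

/-- The historic solutions. -/
def histl (i : ℕ) : List (Fin I.n) := if h : i < I.N then I.hist ⟨i, h⟩ else []

/-- The input for a historic solution. -/
def hcell (i : ℕ) : List ℤ := (I.lamq i).num :: ((I.lamq i).den : ℤ) ::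
  ((I.histl i).length : ℤ) :: (I.histl i).map fun v : Fin I.n => ((v : ℕ) : ℤ)

/-- The input as a list, with flattened loops. -/
theorem encode_eq : I.encode = (I.n : ℤ) :: ((I.s : ℕ) : ℤ) :: ((I.t : ℕ) : ℤ) :: I.α.num ::
    (I.α.den : ℤ) :: ((List.range (I.n * I.n)).flatMap I.cell ++
      (I.N : ℤ) :: (List.range I.N).flatMap I.hcell) := by
  have h1 : (List.finRange I.n).flatMap (fun u => (List.finRange I.n).flatMap fun v =>
      I.encodePair (u, v)) = (List.range (I.n * I.n)).flatMap I.cell := by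
    rw [← List.flatMap_range_mul]
    refine List.flatMap_finRange _ _ _ fun u => ?_
    exact List.flatMap_finRange _ _ _ fun v => I.encodePair_eq (u, v)
  have h2 : (List.finRange I.N).flatMap I.encodeHist = (List.range I.N).flatMap I.hcell := by
    refine List.flatMap_finRange _ _ _ fun i => ?_
    simp [encodeHist, hcell, lamq, histl, encodeRat, ← List.map_eq_flatMap]
  simp [encode, encodeRat, h1, h2]

/-- The product of the first denominators of costs. -/
def dc (m : ℕ) : ℤ := ∏ j ∈ Finset.range m, ((I.cq j).den : ℤ)

/-- The product of the first denominators of coefficients. -/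
def dl (i : ℕ) : ℤ := ∏ j ∈ Finset.range i, ((I.lamq j).den : ℤ)

theorem dc_succ (m : ℕ) : I.dc (m + 1) = I.dc m * (I.cq m).den := Finset.prod_range_succ _ _

theorem dl_succ (m : ℕ) : I.dl (m + 1) = I.dl m * (I.lamq m).den := Finset.prod_range_succ _ _

theorem dc_pos (m : ℕ) : 0 < I.dc m := Finset.prod_pos fun _ _ => by exact_mod_cast Rat.den_pos _

theorem dl_pos (m : ℕ) : 0 < I.dl m := Finset.prod_pos fun _ _ => by exact_mod_cast Rat.den_pos _

/-- The sign with which a coefficient contributes to the weight of an important edge. -/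
def sgn (i m : ℕ) : ℤ := if I.pair m ∈ edgeSeq (I.histl i) then -1 else 1

/-- The weights of important edges that result from the first coefficients, times the product
of the denominators. -/
def acc : ℕ → ℕ → ℤ
  | 0, _ => 0
  | i + 1, m => if I.imp m then acc i m * (I.lamq i).den + I.sgn i m * (I.lamq i).num * I.dl i
      else 0

theorem acc_of_not_imp {m : ℕ} (h : ¬ I.imp m) : ∀ i, I.acc i m = 0
  | 0 => rfl
  | _ + 1 => if_neg h

/-- The common denominator is the plain product `dl`, so no greatest common divisors are computed:
passing to the next coefficient, the old sum is multiplied by the new denominator and the new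
numerator by the old product. -/
theorem acc_eq {m : ℕ} (h : I.imp m) (i : ℕ) :
    (I.acc i m : ℚ) = I.dl i * ∑ j ∈ Finset.range i, I.lamq j * I.sgn j m := by
  induction i with
  | zero => simp [acc]
  | succ i ih =>
    rw [acc, if_pos h, dl_succ, Finset.sum_range_succ]
    push_cast
    rw [ih]
    have : (I.lamq i).num = I.lamq i * (I.lamq i).den := (Rat.mul_den_eq_num _).symm
    rw [this]; ring

/-- The scaled weight at a position of the adjacency matrix. -/
def wgt (m : ℕ) : ℤ := I.α.num * ((I.cq m).num * I.dc (I.n * I.n) / (I.cq m).den) * I.dl I.N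

/-- The scaled additional weight of an important edge. -/
def bonus (m : ℕ) : ℤ := (I.α.den - I.α.num) * I.acc I.N m * I.dc (I.n * I.n)

/-- The scaling factor. -/
def scale : ℚ := I.α.den * I.dc (I.n * I.n) * I.dl I.N

theorem scale_pos : 0 < I.scale := by
  have h1 : (0 : ℚ) < I.α.den := by exact_mod_cast Rat.den_pos _
  have h2 : (0 : ℚ) < I.dc (I.n * I.n) := by exact_mod_cast I.dc_pos _
  have h3 : (0 : ℚ) < I.dl I.N := by exact_mod_cast I.dl_pos _
  unfold scale
  positivity

/-- The integer division in `wgt` is exact, because for positions inside the matrix the denominator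
is one of the factors of `dc`. -/
theorem wgt_eq {m : ℕ} (hm : m < I.n * I.n) : (I.wgt m : ℚ) = I.scale * (I.α * I.cq m) := by
  have hd : ((I.cq m).den : ℤ) ∣ (I.cq m).num * I.dc (I.n * I.n) :=
    Dvd.dvd.mul_left (Finset.dvd_prod_of_mem _ (Finset.mem_range.2 hm)) _
  have h0 : ((I.cq m).den : ℚ) ≠ 0 := by exact_mod_cast (I.cq m).den_nz
  unfold wgt scale
  rw [Int.cast_mul, Int.cast_mul, Int.cast_div hd (by exact_mod_cast h0)]
  push_cast
  have h1 : (I.cq m).num = I.cq m * (I.cq m).den := (Rat.mul_den_eq_num _).symm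
  have h2 : I.α.num = I.α * I.α.den := (Rat.mul_den_eq_num _).symm
  rw [h1, h2]
  field_simp

theorem bonus_eq {m : ℕ} (h : I.imp m) : (I.bonus m : ℚ) =
    I.scale * (1 - I.α) * ∑ j ∈ Finset.range I.N, I.lamq j * I.sgn j m := by
  unfold bonus scale
  push_cast
  rw [acc_eq I h]
  have h2 : I.α.num = I.α * I.α.den := (Rat.mul_den_eq_num _).symm
  rw [h2]
  ring

/-- The network that belongs to an instance. -/
def net : Net I.n where
  E := I.E
  E' := I.E'
  t := I.t
  W e := I.wgt (I.ix e)
  G e := I.bonus (I.ix e)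
  num e := Nat.count I.imp (I.ix e)
  k := I.E'.card
  num_lt e he := by
    rw [← count_imp]
    exact Nat.count_strict_mono (by simpa [imp] using he) (I.ix_lt e)
  num_inj e he f hf h :=
    I.ix_inj (Nat.count_injective (by simpa [imp] using he) (by simpa [imp] using hf) h)
  G_eq_zero e he := by
    rw [bonus, acc_of_not_imp _ (by simpa [imp] using he)]; simp

theorem sum_W {l : List (Fin I.n × Fin I.n)} (hl : ∀ e ∈ l, e ∈ I.E) :
    (((l.map I.net.W).sum : ℤ) : ℚ) = I.scale * (I.α * (l.map I.c).sum) := by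
  induction l with
  | nil => simp
  | cons e l ih =>
    have h := I.wgt_eq (I.ix_lt e)
    have he : e ∈ I.E := hl e (by simp)
    simp only [cq, pair_ix, he, if_true] at h
    rw [List.map_cons, List.sum_cons, List.map_cons, List.sum_cons, Int.cast_add,
      ih fun f hf => hl f (by simp [hf])]
    rw [show I.net.W e = I.wgt (I.ix e) from rfl, h]
    ring

theorem conservative (h : I.NoNegativeCycle) : I.net.Conservative := by
  intro v x hx
  have h1 := cost_closed_nonneg h _ x v le_rfl hx
  have h2 := I.sum_W hx.2.2
  have h3 := I.scale_pos
  have h4 := I.α_pos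
  have : (0 : ℚ) ≤ (((edgeSeq x).map I.net.W).sum : ℤ) := by
    rw [h2]; unfold cost at h1; positivity
  exact_mod_cast this

/-- Edge by edge, with `a` and `b` the indicators for `w` and `x`: `a` and `b` differ if and only if
`b + a * (1 - 2 * b)` is 1. The first summand does not depend on `w`, the second yields the bonus.
-/
theorem hammingDist_eq (w x : List (Fin I.n)) :
    (hammingDist (indicator I.E' w) (indicator I.E' x) : ℚ) =
      (∑ e ∈ I.E', if e ∈ edgeSeq x then 1 else 0) +
      ∑ e ∈ I.E', if e ∈ edgeSeq w then (if e ∈ edgeSeq x then -1 else 1) else 0 := by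
  rw [← Finset.sum_add_distrib, hammingDist, Finset.card_filter, Nat.cast_sum,
    ← Finset.sum_coe_sort I.E']
  refine Finset.sum_congr rfl fun e _ => ?_
  by_cases h1 : e.1 ∈ edgeSeq w <;> by_cases h2 : e.1 ∈ edgeSeq x <;>
    simp [indicator, h1, h2]

/-- Up to scaling and a constant, the objective function is the weight in the network. -/
theorem objective_eq {w : List (Fin I.n)} (hw : w ∈ I.feasible) :
    I.scale * I.objective w = I.scale * (1 - I.α) *
      (∑ i, I.lam i * ∑ e ∈ I.E', if e ∈ edgeSeq (I.hist i) then 1 else 0) + I.net.val 0 w := by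
  have h1 := I.sum_W (l := edgeSeq w) hw.2.2
  have h0 : ∀ f, ¬ I.net.Has 0 f := by simp [Net.Has]
  have h2 : ((∑ f ∈ I.E', if f ∈ edgeSeq w then I.bonus (I.ix f) else 0 : ℤ) : ℚ) =
      I.scale * (1 - I.α) * ∑ i, I.lam i *
        ∑ e ∈ I.E', if e ∈ edgeSeq w then (if e ∈ edgeSeq (I.hist i) then -1 else 1) else 0 := by
    simp only [Finset.mul_sum]
    -- Interchanging the sums over edges and historic solutions collects the coefficient of each
    -- edge.
    rw [Finset.sum_comm]
    push_cast
    refine Finset.sum_congr rfl fun e he => ?_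
    split_ifs with h
    · rw [bonus_eq I (by simpa [imp] using he), Finset.mul_sum, Finset.sum_range]
      refine Finset.sum_congr rfl fun i _ => ?_
      simp [lamq, sgn, histl]
    · simp
  have h3 : I.net.val 0 w = ((edgeSeq w).map I.net.W).sum +
      ∑ f ∈ I.E', if f ∈ edgeSeq w then I.bonus (I.ix f) else 0 := by
    rw [Net.val, Net.ev_eq]
    simp only [h0, not_false_eq_true, and_true]
    congr 1
  rw [h3, Int.cast_add, h1, h2]
  simp only [objective, hammingDist_eq, mul_add, Finset.sum_add_distrib, cost]
  ring

theorem objective_le {w x : List (Fin I.n)} (hw : w ∈ I.feasible) (hx : x ∈ I.feasible)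
    (h : I.net.val 0 w ≤ I.net.val 0 x) : I.objective w ≤ I.objective x := by
  have h1 := I.objective_eq hw
  have h2 := I.objective_eq hx
  have h3 : (I.net.val 0 w : ℚ) ≤ I.net.val 0 x := by exact_mod_cast h
  have h4 := I.scale_pos
  exact le_of_mul_le_mul_left (by linarith) h4

/-! ### Sizes -/

/-- The length of the input. -/
def len : ℕ := RAM.inputSize I.encode

theorem cell_size_le : ∑ m ∈ Finset.range (I.n * I.n), RAM.inputSize (I.cell m) ≤ I.len := by
  rw [len, encode_eq, ← RAM.inputSize_flatMap_range]
  simp only [RAM.inputSize_cons, RAM.inputSize_append]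
  omega

theorem hcell_size_le : ∑ i ∈ Finset.range I.N, RAM.inputSize (I.hcell i) ≤ I.len := by
  rw [len, encode_eq, ← RAM.inputSize_flatMap_range]
  simp only [RAM.inputSize_cons, RAM.inputSize_append]
  omega

theorem sq_le_len : I.n * I.n ≤ I.len := by
  refine le_trans ?_ I.cell_size_le
  have := Finset.card_nsmul_le_sum (Finset.range (I.n * I.n)) (fun m => RAM.inputSize (I.cell m)) 1
    fun m _ => le_trans (by simp [cell]) (RAM.length_le_inputSize _)
  simpa using this

theorem N_le_len : I.N ≤ I.len := by
  refine le_trans ?_ I.hcell_size_le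
  have := Finset.card_nsmul_le_sum (Finset.range I.N) (fun m => RAM.inputSize (I.hcell m)) 1
    fun m _ => le_trans (by simp [hcell]) (RAM.length_le_inputSize _)
  simpa using this

theorem hist_length_le_len {i : ℕ} (hi : i < I.N) : (I.histl i).length ≤ I.len := by
  refine le_trans ?_ (le_trans (Finset.single_le_sum (f := fun i => RAM.inputSize (I.hcell i))
    (fun _ _ => Nat.zero_le _) (Finset.mem_range.2 hi)) I.hcell_size_le)
  refine le_trans ?_ (RAM.length_le_inputSize _)
  simp only [hcell, List.length_cons, List.length_map]
  omega

theorem n_le_len : I.n ≤ I.len := by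
  have := I.sq_le_len
  have := I.n_pos
  nlinarith

theorem abs_le_of_mem_encode {z : ℤ} (h : z ∈ I.encode) : |z| ≤ 2 ^ I.len := RAM.abs_le_of_mem h

/-- Each denominator is at most 2 to the length of its own input cell, and the lengths of the cells
add up to at most `len`. -/
theorem dc_le {m : ℕ} (hm : m ≤ I.n * I.n) : I.dc m ≤ 2 ^ I.len := by
  have h1 : I.dc m ≤ 2 ^ ∑ j ∈ Finset.range m, RAM.inputSize (I.cell j) := by
    rw [← Finset.prod_pow_eq_pow_sum]
    refine Finset.prod_le_prod (fun _ _ => by positivity) fun j _ => ?_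
    refine le_trans (le_abs_self _) (RAM.abs_le_of_mem ?_)
    simp [cell]
  refine h1.trans (pow_le_pow_right₀ (by norm_num) ?_)
  refine le_trans ?_ I.cell_size_le
  exact Finset.sum_le_sum_of_subset (by simpa using hm)

/-- This product dominates both `dl` and `acc`, which are bounded through it. -/
theorem prod_le {i : ℕ} (hi : i ≤ I.N) :
    ∏ j ∈ Finset.range i, (((I.lamq j).den : ℤ) + |(I.lamq j).num|) ≤ 2 ^ I.len := by
  have h1 : ∏ j ∈ Finset.range i, (((I.lamq j).den : ℤ) + |(I.lamq j).num|) ≤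
      2 ^ ∑ j ∈ Finset.range i, RAM.inputSize (I.hcell j) := by
    rw [← Finset.prod_pow_eq_pow_sum]
    refine Finset.prod_le_prod (fun _ _ => by positivity) fun j _ => ?_
    have h2 := RAM.abs_lt_two_pow_bitLength ((I.lamq j).den : ℤ)
    have h3 := RAM.abs_lt_two_pow_bitLength (I.lamq j).num
    have h4 : RAM.bitLength ((I.lamq j).den : ℤ) + RAM.bitLength (I.lamq j).num ≤
        RAM.inputSize (I.hcell j) := by
      simp only [hcell, RAM.inputSize_cons]; omega
    refine le_trans ?_ (pow_le_pow_right₀ (by norm_num) h4)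
    rw [pow_add]
    -- A sum of two numbers is at most their product once both are at least 2; this turns `den +
    -- |num|` into a product of powers of two.
    have h5 : (2 : ℤ) ≤ 2 ^ RAM.bitLength ((I.lamq j).den : ℤ) :=
      le_self_pow₀ (by norm_num) (by have := RAM.bitLength_pos ((I.lamq j).den : ℤ); omega)
    have h6 : (2 : ℤ) ≤ 2 ^ RAM.bitLength (I.lamq j).num :=
      le_self_pow₀ (by norm_num) (by have := RAM.bitLength_pos (I.lamq j).num; omega)
    have h7 := le_abs_self ((I.lamq j).den : ℤ)
    nlinarith
  refine h1.trans (pow_le_pow_right₀ (by norm_num) ?_)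
  refine le_trans ?_ I.hcell_size_le
  exact Finset.sum_le_sum_of_subset (by simpa using hi)

theorem dl_le_prod (i : ℕ) :
    I.dl i ≤ ∏ j ∈ Finset.range i, (((I.lamq j).den : ℤ) + |(I.lamq j).num|) :=
  Finset.prod_le_prod (fun _ _ => by positivity) fun j _ => by simp

/-- If `P` bounds both `|acc i|` and `dl i`, then the recursion gives at most `P * den + |num| * P`,
which is `P` times the next factor. -/
theorem acc_le_prod (m i : ℕ) :
    |I.acc i m| ≤ ∏ j ∈ Finset.range i, (((I.lamq j).den : ℤ) + |(I.lamq j).num|) := by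
  induction i with
  | zero => simp [acc]
  | succ i ih =>
    have h1 := I.dl_le_prod i
    have h2 := I.dl_pos i
    rw [Finset.prod_range_succ]
    set P := ∏ j ∈ Finset.range i, (((I.lamq j).den : ℤ) + |(I.lamq j).num|)
    have hP : 0 ≤ P := h2.le.trans h1
    rw [acc]
    split_ifs
    · have h3 : |I.sgn i m| = 1 := by unfold sgn; split_ifs <;> simp
      have h4 : (0 : ℤ) ≤ (I.lamq i).den := by positivity
      calc |I.acc i m * (I.lamq i).den + I.sgn i m * (I.lamq i).num * I.dl i|
          ≤ |I.acc i m * (I.lamq i).den| + |I.sgn i m * (I.lamq i).num * I.dl i| :=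
            abs_add_le _ _
        _ = |I.acc i m| * (I.lamq i).den + |(I.lamq i).num| * I.dl i := by
            rw [abs_mul, abs_mul, abs_mul, h3, abs_of_nonneg h4, abs_of_pos h2, one_mul]
        _ ≤ P * (I.lamq i).den + |(I.lamq i).num| * P :=
            add_le_add (mul_le_mul_of_nonneg_right ih h4)
              (mul_le_mul_of_nonneg_left h1 (abs_nonneg _))
        _ = _ := by ring
    · rw [abs_zero]; positivity

theorem dl_le {i : ℕ} (hi : i ≤ I.N) : I.dl i ≤ 2 ^ I.len := (I.dl_le_prod i).trans (I.prod_le hi)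

theorem acc_le {i : ℕ} (hi : i ≤ I.N) (m : ℕ) : |I.acc i m| ≤ 2 ^ I.len :=
  (I.acc_le_prod m i).trans (I.prod_le hi)

theorem num_pos : 0 < I.α.num := Rat.num_pos.2 I.α_pos

theorem num_lt_den : I.α.num < I.α.den := by
  have h := I.α_lt_one
  have h1 := Rat.mul_den_eq_num I.α
  have h2 : (0 : ℚ) < I.α.den := by exact_mod_cast Rat.den_pos _
  have : (I.α.num : ℚ) < I.α.den := by rw [← h1]; nlinarith
  exact_mod_cast this

theorem den_le : (I.α.den : ℤ) ≤ 2 ^ I.len :=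
  (le_abs_self _).trans (I.abs_le_of_mem_encode (by simp [encode_eq]))

theorem abs_cq_num_le {m : ℕ} (hm : m < I.n * I.n) : |(I.cq m).num| ≤ 2 ^ I.len := by
  refine I.abs_le_of_mem_encode ?_
  have : (I.cq m).num ∈ I.cell m := by simp [cell]
  simp only [encode_eq, List.mem_cons, List.mem_append, List.mem_flatMap, List.mem_range]
  exact Or.inr (Or.inr (Or.inr (Or.inr (Or.inr (Or.inl ⟨m, hm, this⟩)))))

/-- Four factors of at most `2 ^ len`: the numerators of `α` and of the cost, and the two products
of denominators. -/
theorem abs_wgt_le {m : ℕ} (hm : m < I.n * I.n) : |I.wgt m| ≤ (2 ^ I.len) ^ 4 := by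
  have h1 : |(I.cq m).num * I.dc (I.n * I.n) / (I.cq m).den| ≤ 2 ^ I.len * 2 ^ I.len := by
    refine (Int.abs_ediv_le_abs _ _).trans ?_
    rw [abs_mul, abs_of_pos (I.dc_pos _)]
    exact mul_le_mul (I.abs_cq_num_le hm) (I.dc_le le_rfl) (I.dc_pos _).le (by positivity)
  have h2 : |I.α.num| ≤ 2 ^ I.len := by
    rw [abs_of_pos I.num_pos]; exact I.num_lt_den.le.trans I.den_le
  rw [wgt, abs_mul, abs_mul, abs_of_pos (I.dl_pos _)]
  calc _ ≤ 2 ^ I.len * (2 ^ I.len * 2 ^ I.len) * 2 ^ I.len :=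
        mul_le_mul (mul_le_mul h2 h1 (abs_nonneg _) (by positivity)) (I.dl_le le_rfl)
          (I.dl_pos _).le (by positivity)
    _ = _ := by ring

theorem abs_bonus_le (m : ℕ) : |I.bonus m| ≤ (2 ^ I.len) ^ 3 := by
  have h1 := I.num_pos
  have h2 := I.num_lt_den
  have h3 := I.den_le
  have h4 : |(I.α.den : ℤ) - I.α.num| ≤ 2 ^ I.len := by rw [abs_of_pos (by omega)]; omega
  rw [bonus, abs_mul, abs_mul, abs_of_pos (I.dc_pos _)]
  calc _ ≤ 2 ^ I.len * 2 ^ I.len * 2 ^ I.len :=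
        mul_le_mul (mul_le_mul h4 (I.acc_le le_rfl m) (abs_nonneg _) (by positivity))
          (I.dc_le le_rfl) (I.dc_pos _).le (by positivity)
    _ = _ := by ring

end WSExpH.Instance
/-! ## The program -/

namespace WSExpH.Instance

open RAM RAM.Ex

infixr:60 " ⨟ " => RAM.Prog.seq

/-- Reads the graph: flags, numerators, denominators and the bits of important edges. -/
def graphBody : Prog :=
  Prog.input 20 ⨟ Prog.put 0 (var 10) (var 20) ⨟ Prog.input 20 ⨟ Prog.put 1 (var 10) (var 20) ⨟
  Prog.input 20 ⨟ Prog.put 2 (var 10) (var 20) ⨟ Prog.set 5 (var 5 * var 20) ⨟ Prog.input 20 ⨟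
  Prog.cond (var 20) (Prog.put 3 (var 10) (var 7) ⨟ Prog.set 7 (var 7 * lit 2)) Prog.skip

variable (I : Instance)

/-- The number of sets of important edges. -/
def K : ℕ := 2 ^ I.E'.card

/-- The number of pairs of a vertex and a set of important edges. -/
def M : ℕ := I.n * I.K

/-- A bound for all numbers that occur in the computation. -/
def bound : ℕ := I.M * I.M + I.M + (I.M + 1) * (2 * (2 ^ I.len) ^ 4)

theorem K_pos : 0 < I.K := Nat.two_pow_pos _

theorem M_pos : 0 < I.M := Nat.mul_pos I.n_pos I.K_pos

theorem n_le_M : I.n ≤ I.M := Nat.le_mul_of_pos_right _ I.K_pos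

theorem K_le_M : I.K ≤ I.M := Nat.le_mul_of_pos_left _ I.n_pos

/-- The table has `M + 1` layers of `M` entries, so this covers all its positions. -/
theorem sq_le_bound : I.M * I.M + I.M ≤ I.bound := Nat.le_add_right _ _

/-- Covers the table values: one edge contributes its weight and possibly a bonus, each at most `(2
^ len) ^ 4`, and there are at most `M` such contributions. -/
theorem weights_le_bound : I.M * (2 * (2 ^ I.len) ^ 4) ≤ I.bound := by
  unfold bound
  have : I.M * (2 * (2 ^ I.len) ^ 4) ≤ (I.M + 1) * (2 * (2 ^ I.len) ^ 4) :=
    Nat.mul_le_mul_right _ (by omega)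
  omega

theorem pow_four_le_bound : 2 * (2 ^ I.len) ^ 4 ≤ I.bound :=
  (Nat.le_mul_of_pos_left _ I.M_pos).trans I.weights_le_bound

theorem pow_le_bound : 2 ^ I.len ≤ I.bound := by
  have h : 2 ^ I.len ≤ (2 ^ I.len) ^ 4 := Nat.le_self_pow (by norm_num) _
  have := I.pow_four_le_bound
  omega

theorem nn_le_bound : I.n * I.n ≤ I.bound := by
  have := Nat.mul_le_mul I.n_le_M I.n_le_M
  have := I.sq_le_bound
  omega

theorem N_lt_bound : I.N < I.bound := by
  have h1 := I.N_le_len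
  have h2 : I.len < 2 ^ I.len := Nat.lt_two_pow_self
  have h3 := I.pow_le_bound
  omega

theorem abs_le_bound {z : ℤ} (h : |z| ≤ 2 ^ I.len) : |z| ≤ (I.bound : ℤ) :=
  h.trans (by exact_mod_cast I.pow_le_bound)

/-- The bit of a position of the adjacency matrix. -/
def bit (m : ℕ) : ℕ := if I.imp m then 2 ^ Nat.count I.imp m else 0

theorem count_le {m : ℕ} (hm : m ≤ I.n * I.n) : Nat.count I.imp m ≤ I.E'.card :=
  I.count_imp ▸ Nat.count_monotone _ hm

theorem net_pw (e : Fin I.n × Fin I.n) : I.net.pw e = I.bit (I.ix e) := by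
  simp only [Net.pw, net, bit, imp, pair_ix]
  congr

/-- The data that never changes after the header has been read. -/
structure Header (st : St) : Prop where
  n : st.v 0 = I.n
  s : st.v 1 = (I.s : ℕ)
  t : st.v 2 = (I.t : ℕ)
  a : st.v 3 = I.α.num
  b : st.v 4 = I.α.den
  out : st.out = []

theorem Header.of_eq {I : Instance} {st st' : St} (h : I.Header st)
    (hv : ∀ x < 5, st'.v x = st.v x) (ho : st'.out = st.out) : I.Header st' :=
  ⟨by rw [hv _ (by norm_num), h.n], by rw [hv _ (by norm_num), h.s],
    by rw [hv _ (by norm_num), h.t], by rw [hv _ (by norm_num), h.a],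
    by rw [hv _ (by norm_num), h.b], by rw [ho, h.out]⟩

/-- The state after reading the first `j` entries of the adjacency matrix. -/
structure GraphInv (rest : List ℤ) (j : ℕ) (st : St) : Prop where
  header : I.Header st
  dc : st.v 5 = I.dc j
  K : st.v 7 = ((2 ^ Nat.count I.imp j : ℕ) : ℤ)
  edge : ∀ m < j, st.arr 0 m = if I.pair m ∈ I.E then 1 else 0
  num : ∀ m < j, st.arr 1 m = (I.cq m).num
  den : ∀ m < j, st.arr 2 m = (I.cq m).den
  bit : ∀ m < j, st.arr 3 m = I.bit m
  bit_zero : ∀ m, j ≤ m → st.arr 3 m = 0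
  zero : ∀ a : Fin 8, 4 ≤ a → ∀ m, st.arr a m = 0
  inp : st.inp = (List.range' j (I.n * I.n - j)).flatMap I.cell ++ rest

/-- Variable 7 holds the bit for the next important edge and is doubled after each one, so that it
ends up as `K`. -/
theorem graphBody_spec {rest : List ℤ} {j : ℕ} {st : St} (hj : j < I.n * I.n)
    (h : I.GraphInv rest j st) (hi : st.v 10 = j) : Wp I.bound graphBody 3000 st fun st' =>
      st'.v 10 = j ∧ st'.v 11 = st.v 11 ∧ I.GraphInv rest (j + 1) st' := by
  have hin : st.inp = I.cell j ++
      ((List.range' (j + 1) (I.n * I.n - (j + 1))).flatMap I.cell ++ rest) := by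
    rw [h.inp, show I.n * I.n - j = (I.n * I.n - (j + 1)) + 1 by omega, List.range'_succ,
      List.flatMap_cons, List.append_assoc]
  have hdc := I.dc_succ j
  have hdb : |I.dc (j + 1)| ≤ (I.bound : ℤ) := by
    refine I.abs_le_bound ?_
    rw [abs_of_pos (I.dc_pos _)]; exact I.dc_le hj
  have hKb : ∀ m ≤ I.n * I.n, (2 : ℤ) ^ Nat.count I.imp m ≤ I.bound := fun m hm => by
    have h1 : 2 ^ Nat.count I.imp m ≤ I.K := Nat.pow_le_pow_right (by norm_num) (I.count_le hm)
    have h2 := I.K_le_M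
    have h3 := I.sq_le_bound
    have h4 : 2 ^ Nat.count I.imp m ≤ I.bound := by omega
    exact_mod_cast h4
  generalize hR : (List.range' (j + 1) (I.n * I.n - (j + 1))).flatMap I.cell ++ rest = R at hin
  unfold cell at hin
  unfold graphBody
  refine Wp.step (by decide) (Wp.input hin fun h1 => ?_)
  refine Wp.step (by decide) (Wp.put_eq j _ trivial (by simp [hi]) trivial (by simp) h1 ?_)
  refine Wp.step (by decide) (Wp.input rfl fun h2 => ?_)
  refine Wp.step (by decide) (Wp.put_eq j _ trivial (by simp [hi]) trivial (by simp) h2 ?_)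
  refine Wp.step (by decide) (Wp.input rfl fun h3 => ?_)
  refine Wp.step (by decide) (Wp.put_eq j _ trivial (by simp [hi]) trivial (by simp) h3 ?_)
  refine Wp.step (by decide) (Wp.set_eq (I.dc (j + 1)) ⟨trivial, trivial⟩
    (by simp [h.dc, hdc]) hdb ?_)
  refine Wp.step (by decide) (Wp.input rfl fun h4 => ?_)
  -- Both branches of the final test end in states of this shape; they differ only in the bit and in
  -- variable 7.
  have common : ∀ st' : St, (∀ x < 5, st'.v x = st.v x) → st'.v 5 = I.dc (j + 1) →
      st'.v 7 = ((2 ^ Nat.count I.imp (j + 1) : ℕ) : ℤ) → st'.v 10 = j → st'.v 11 = st.v 11 →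
      (∀ m, st'.arr 0 m = if m = j then (if I.pair j ∈ I.E then 1 else 0) else st.arr 0 m) →
      (∀ m, st'.arr 1 m = if m = j then (I.cq j).num else st.arr 1 m) →
      (∀ m, st'.arr 2 m = if m = j then ((I.cq j).den : ℤ) else st.arr 2 m) →
      (∀ m, st'.arr 3 m = if m = j then (I.bit j : ℤ) else st.arr 3 m) →
      (∀ a : Fin 8, 4 ≤ a → ∀ m, st'.arr a m = st.arr a m) → st'.out = st.out →
      st'.inp = R →
      st'.v 10 = j ∧ st'.v 11 = st.v 11 ∧ I.GraphInv rest (j + 1) st' := by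
    intro st' hv h5 h7 h10 h11 a0 a1 a2 a3 a4 ho hinp
    refine ⟨h10, h11, h.header.of_eq hv ho, h5, h7, ?_, ?_, ?_, ?_, ?_, ?_, by rw [hinp, hR]⟩
    · intro m hm
      by_cases hmj : m = j
      · simp [a0, hmj]
      · simpa [a0, hmj] using h.edge m (by omega)
    · intro m hm
      by_cases hmj : m = j
      · simp [a1, hmj]
      · simpa [a1, hmj] using h.num m (by omega)
    · intro m hm
      by_cases hmj : m = j
      · simp [a2, hmj]
      · simpa [a2, hmj] using h.den m (by omega)
    · intro m hm
      by_cases hmj : m = j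
      · simp [a3, hmj]
      · simpa [a3, hmj] using h.bit m (by omega)
    · intro m hm
      simpa [a3, show m ≠ j by omega] using h.bit_zero m (by omega)
    · intro a ha m
      rw [a4 a ha, h.zero a ha]
  refine Wp.cond_step trivial (by decide) (fun hp => ?_) (fun hp => ?_)
  · have him : I.imp j := by
      by_contra him
      simp [him] at hp
    have hb : I.bit j = 2 ^ Nat.count I.imp j := if_pos him
    refine Wp.step (by decide) (Wp.put_eq j (I.bit j) trivial (by simp [hi]) trivial
      (by simp [h.K, hb]) ?_ ?_)
    · rw [hb]; simpa using hKb j hj.le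
    refine Wp.weaken_time (Wp.set_eq ((2 ^ Nat.count I.imp (j + 1) : ℕ) : ℤ) ⟨trivial, trivial⟩
      (by simp [h.K, Nat.count_succ, him, pow_succ]) (by simpa using hKb (j + 1) hj) ?_)
      (by decide)
    refine common _ (fun x hx => ?_) ?_ ?_ ?_ ?_ ?_ ?_ ?_ ?_ ?_ ?_ ?_
    · simp [show x ≠ 7 by omega, show x ≠ 20 by omega, show x ≠ 5 by omega]
    all_goals try simp [hi]
    intro a ha m
    simp [show a ≠ 0 by omega, show a ≠ 1 by omega, show a ≠ 2 by omega, show a ≠ 3 by omega]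
  · have him : ¬ I.imp j := by
      intro him
      simp [him] at hp
    have hb : I.bit j = 0 := if_neg him
    refine Wp.weaken_time (Wp.skip ?_) (by decide)
    refine common _ (fun x hx => ?_) ?_ ?_ ?_ ?_ ?_ ?_ ?_ ?_ ?_ ?_ ?_
    · simp [show x ≠ 20 by omega, show x ≠ 5 by omega]
    all_goals try simp [hi, h.K, Nat.count_succ, him]
    · rw [h.bit_zero j le_rfl, hb]; rfl
    · intro a ha m
      simp [show a ≠ 0 by omega, show a ≠ 1 by omega, show a ≠ 2 by omega]

/-- Reads the adjacency matrix. -/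
def graphProg : Prog := Prog.for_ 10 11 (var 0 * var 0) graphBody

theorem graphProg_spec {rest : List ℤ} {st : St} (h : I.GraphInv rest 0 st) :
    Wp I.bound graphProg (I.n * I.n * 3050 + 100) st (I.GraphInv rest (I.n * I.n)) := by
  refine Wp.weaken_time (Wp.for_ (I.n * I.n) (I.GraphInv rest) (by norm_num) ⟨trivial, trivial⟩
    (by simp [h.header.n]) I.nn_le_bound ?_ h
    (fun j st' hj hinv hi => I.graphBody_spec hj hinv hi) fun _ => id) ?_
  · intro j st' y z h
    exact ⟨h.header.of_eq (fun x hx => by simp [show x ≠ 10 by omega, show x ≠ 11 by omega]) rfl,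
      by simp [h.dc], by simp [h.K], h.edge, h.num, h.den, h.bit, h.bit_zero, h.zero, h.inp⟩
  · have : (var 0 * var 0).time = 13 := rfl
    omega

end WSExpH.Instance

/-! ### Reading the historic solutions and accumulating the bonuses -/

namespace WSExpH.Instance

open RAM RAM.Ex

/-- Reads a vertex of a historic solution and marks the edge that leads to it. -/
def markBody : Prog :=
  Prog.input 18 ⨟ Prog.put 5 (var 17 * var 0 + var 18) (var 10 + lit 1) ⨟ Prog.set 17 (var 18)

/-- Updates the additional weight of an important edge. -/
def accBody : Prog :=
  Prog.cond (get 3 (var 15)) (Prog.cond (get 5 (var 15) - var 10)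
    (Prog.put 4 (var 15) (get 4 (var 15) * var 13 - var 12 * var 6))
    (Prog.put 4 (var 15) (get 4 (var 15) * var 13 + var 12 * var 6))) Prog.skip

/-- Reads a historic solution and updates the additional weights of the important edges. -/
def histBody : Prog :=
  Prog.input 12 ⨟ Prog.input 13 ⨟ Prog.input 14 ⨟ Prog.input 17 ⨟
  Prog.for_ 15 16 (var 14 - lit 1) markBody ⨟ Prog.for_ 15 16 (var 0 * var 0) accBody ⨟
  Prog.set 6 (var 6 * var 13)

/-- Reads the historic solutions. -/
def histProg : Prog := Prog.set 6 (lit 1) ⨟ Prog.input 9 ⨟ Prog.for_ 10 11 (var 9) histBody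

variable (I : Instance)

/-- The data that is not changed while the historic solutions are read. -/
structure Data (st : St) : Prop where
  header : I.Header st
  dc : st.v 5 = I.dc (I.n * I.n)
  K : st.v 7 = I.K
  edge : ∀ m < I.n * I.n, st.arr 0 m = if I.pair m ∈ I.E then 1 else 0
  num : ∀ m < I.n * I.n, st.arr 1 m = (I.cq m).num
  den : ∀ m < I.n * I.n, st.arr 2 m = (I.cq m).den
  bit : ∀ m < I.n * I.n, st.arr 3 m = I.bit m
  zero : ∀ a : Fin 8, 6 ≤ a → ∀ m, st.arr a m = 0

variable {I} in
theorem Data.of_eq {st st' : St} (h : I.Data st) (hv : ∀ x < 8, x ≠ 6 → st'.v x = st.v x)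
    (ha : ∀ a : Fin 8, a ≠ 4 → a ≠ 5 → st'.arr a = st.arr a) (ho : st'.out = st.out) :
    I.Data st' where
  header := h.header.of_eq (fun x hx => hv x (by omega) (by omega)) ho
  dc := by rw [hv _ (by norm_num) (by norm_num), h.dc]
  K := by rw [hv _ (by norm_num) (by norm_num), h.K]
  edge := by rw [ha 0 (by decide) (by decide)]; exact h.edge
  num := by rw [ha 1 (by decide) (by decide)]; exact h.num
  den := by rw [ha 2 (by decide) (by decide)]; exact h.den
  bit := by rw [ha 3 (by decide) (by decide)]; exact h.bit
  zero a h6 m := by rw [ha a (by omega) (by omega)]; exact h.zero a h6 m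

variable {I} in
theorem GraphInv.data {rest : List ℤ} {st : St} (h : I.GraphInv rest (I.n * I.n) st) :
    I.Data st where
  header := h.header
  dc := h.dc
  K := by rw [h.K, count_imp]; rfl
  edge := h.edge
  num := h.num
  den := h.den
  bit := h.bit
  zero a ha := h.zero a (by omega)

/-- The state before reading the second and later vertices of a historic solution, relative to
the state `st₀` before. -/
structure MarkInv (i : ℕ) (rest : List ℤ) (st₀ : St) (j : ℕ) (st : St) : Prop where
  v : ∀ x < 15, st.v x = st₀.v x
  arr : ∀ a, a ≠ 5 → st.arr a = st₀.arr a
  out : st.out = st₀.out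
  last : ∃ h : j < (I.histl i).length, st.v 17 = ((I.histl i)[j] : ℕ)
  inp : st.inp = ((I.histl i).drop (j + 1)).map (fun v : Fin I.n => ((v : ℕ) : ℤ)) ++ rest
  le : ∀ m, st.arr 5 m ≤ i + 1
  mark : ∀ m < I.n * I.n, st.arr 5 m = i + 1 ↔ I.pair m ∈ (edgeSeq (I.histl i)).take j

/-- The array of marks is never cleared. Solution `i` stamps its edges with `i + 1`, whereas all
older stamps are at most `i`, so the stamp `i + 1` means that the edge occurs in the current
solution. -/
theorem markBody_spec {i : ℕ} {rest : List ℤ} {st₀ : St} {j : ℕ} {st : St}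
    (h0 : I.Header st₀) (hi : i < I.N) (h10 : st₀.v 10 = i)
    (hj : j < (I.histl i).length - 1) (h : I.MarkInv i rest st₀ j st) (h15 : st.v 15 = j) :
    Wp I.bound markBody 1000 st fun st' =>
      st'.v 15 = j ∧ st'.v 16 = st.v 16 ∧ I.MarkInv i rest st₀ (j + 1) st' := by
  have hl : j + 1 < (I.histl i).length := by omega
  obtain ⟨hj', h17⟩ := h.last
  have hin := h.inp
  rw [List.drop_eq_getElem_cons hl, List.map_cons, List.cons_append] at hin
  set u := (I.histl i)[j] with hu
  set w := (I.histl i)[j + 1] with hw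
  have hn : st.v 0 = I.n := (h.v _ (by norm_num)).trans h0.n
  have hi10 : st.v 10 = i := (h.v _ (by norm_num)).trans h10
  have hN := I.N_lt_bound
  unfold markBody
  refine Wp.step (by decide) (Wp.input hin fun h1 => ?_)
  refine Wp.step (by decide) (Wp.put_eq (I.ix (u, w)) (i + 1) ⟨⟨trivial, trivial⟩, trivial⟩
    (by simp [h17, hn, ix]) ⟨trivial, trivial⟩ (by simp [hi10]) ?_ ?_)
  · rw [abs_of_nonneg (by positivity)]; exact_mod_cast (by omega : i + 1 ≤ I.bound)
  refine Wp.weaken_time (Wp.set_eq (w : ℕ) trivial (by simp) h1 ?_) (by decide)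
  refine ⟨by simp [h15], by simp, ?_, ?_, ?_, ⟨hl, by simp [← hw]⟩, by simp, ?_, ?_⟩
  · intro x hx
    simp [show x ≠ 17 by omega, show x ≠ 18 by omega, h.v x hx]
  · intro a ha
    funext m
    simp [ha, h.arr a ha]
  · simp [h.out]
  · intro m
    have := h.le m
    by_cases hm : m = I.ix (u, w) <;> simp [hm, h.le]
  · intro m hm
    have hlen : j < (edgeSeq (I.histl i)).length := by
      simp [edgeSeq]; omega
    have hget : (edgeSeq (I.histl i))[j] = (u, w) := by
      simp [edgeSeq, hu, hw]
    rw [List.take_succ_eq_append_getElem hlen, hget, List.mem_append, List.mem_singleton,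
      ← h.mark m hm]
    by_cases hm' : m = I.ix (u, w)
    · simp [hm']
    · have : I.pair m ≠ (u, w) := fun e => hm' (by rw [← e, I.ix_pair hm])
      simp [hm', this]

/-- The state while the additional weights are updated, relative to the state `st₀` before. -/
structure AccInv (i : ℕ) (st₀ : St) (j : ℕ) (st : St) : Prop where
  v : ∀ x < 15, st.v x = st₀.v x
  arr : ∀ a, a ≠ 4 → st.arr a = st₀.arr a
  out : st.out = st₀.out
  inp : st.inp = st₀.inp
  acc : ∀ m < I.n * I.n, st.arr 4 m = I.acc (if m < j then i + 1 else i) m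

/-- Both tests are signs: the bit of an edge is positive exactly for important edges, and since
stamps are at most `i + 1`, stamp minus `i` is positive exactly for edges of the current solution.
-/
theorem accBody_spec {i : ℕ} {st₀ : St} {j : ℕ} {st : St} (h0 : I.Data st₀) (hi : i < I.N)
    (h6 : st₀.v 6 = I.dl i) (h10 : st₀.v 10 = i) (h12 : st₀.v 12 = (I.lamq i).num)
    (h13 : st₀.v 13 = (I.lamq i).den) (hle : ∀ m, st₀.arr 5 m ≤ i + 1)
    (hmark : ∀ m < I.n * I.n, st₀.arr 5 m = i + 1 ↔ I.pair m ∈ edgeSeq (I.histl i))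
    (hj : j < I.n * I.n) (h : I.AccInv i st₀ j st) (h15 : st.v 15 = j) :
    Wp I.bound accBody 2000 st fun st' =>
      st'.v 15 = j ∧ st'.v 16 = st.v 16 ∧ I.AccInv i st₀ (j + 1) st' := by
  have a3 : st.arr 3 j = I.bit j := by rw [h.arr 3 (by decide)]; exact h0.bit j hj
  have a5 : st.arr 5 j = st₀.arr 5 j := by rw [h.arr 5 (by decide)]
  have a4 : st.arr 4 j = I.acc i j := by rw [h.acc j hj, if_neg (lt_irrefl j)]
  have v6 := (h.v 6 (by norm_num)).trans h6
  have v10 := (h.v 10 (by norm_num)).trans h10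
  have v12 := (h.v 12 (by norm_num)).trans h12
  have v13 := (h.v 13 (by norm_num)).trans h13
  have hb := I.abs_le_bound (I.acc_le (i := i + 1) hi j)
  have upd : ∀ st' : St, st'.v = st.v → (∀ a m, st'.arr a m = if a = 4 ∧ m = j then
      I.acc (i + 1) j else st.arr a m) → st'.out = st.out → st'.inp = st.inp →
      st'.v 15 = j ∧ st'.v 16 = st.v 16 ∧ I.AccInv i st₀ (j + 1) st' := by
    intro st' hv ha ho hin
    refine ⟨by rw [hv, h15], by rw [hv], ⟨fun x hx => by rw [hv, h.v x hx], fun a h4 => ?_,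
      ho.trans h.out, hin.trans h.inp, fun m hm => ?_⟩⟩
    · funext m
      rw [ha, if_neg (by tauto), h.arr a h4]
    · rw [ha, h.acc m hm]
      by_cases hmj : m = j
      · simp [hmj]
      · have : m < j + 1 ↔ m < j := by omega
        simp [hmj, this]
  unfold accBody
  refine Wp.cond_step (by simp [h15]) (by decide) (fun hp => ?_) (fun hp => ?_)
  · have him : I.imp j := by
      by_contra him
      simp [h15, a3, bit, him] at hp
    have hacc : I.acc (i + 1) j = I.acc i j * (I.lamq i).den +
      I.sgn i j * (I.lamq i).num * I.dl i := if_pos him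
    refine Wp.cond_step (by simp [h15]) (by decide) (fun hp' => ?_) (fun hp' => ?_)
    · have hs : I.sgn i j = -1 := by
        refine if_pos ((hmark j hj).1 ?_)
        simp only [eval_sub, eval_get, eval_var, h15, Int.toNat_natCast, a5, v10] at hp'
        have := hle j
        omega
      refine Wp.weaken_time (Wp.put_eq j (I.acc (i + 1) j) trivial (by simp [h15])
        (by simp [h15]) ?_ hb ?_) (by decide)
      · simp [h15, a4, v13, v12, v6, hacc, hs]; ring
      · exact upd _ rfl (by simp) rfl rfl
    · have hs : I.sgn i j = 1 := by
        refine if_neg fun hin => ?_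
        have := (hmark j hj).2 hin
        simp only [eval_sub, eval_get, eval_var, h15, Int.toNat_natCast, a5, v10] at hp'
        omega
      refine Wp.weaken_time (Wp.put_eq j (I.acc (i + 1) j) trivial (by simp [h15])
        (by simp [h15]) ?_ hb ?_) (by decide)
      · simp [h15, a4, v13, v12, v6, hacc, hs]
      · exact upd _ rfl (by simp) rfl rfl
  · have him : ¬ I.imp j := by
      intro him
      have : (0 : ℤ) < 2 ^ Nat.count I.imp j := by positivity
      simp [h15, a3, bit, him] at hp
      omega
    refine Wp.weaken_time (Wp.skip (upd _ rfl (fun a m => ?_) rfl rfl)) (by decide)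
    split_ifs with hc
    · rw [hc.1, hc.2, a4, acc_of_not_imp _ him, acc_of_not_imp _ him]
    · rfl

/-- The state after reading the first `i` historic solutions. -/
structure HistInv (i : ℕ) (st : St) : Prop where
  data : I.Data st
  dl : st.v 6 = I.dl i
  N : st.v 9 = I.N
  acc : ∀ m < I.n * I.n, st.arr 4 m = I.acc i m
  le : ∀ m, st.arr 5 m ≤ i
  inp : st.inp = (List.range' i (I.N - i)).flatMap I.hcell

/-- Needed because the first vertex is read before the marking loop, which then runs once per edge.
-/
theorem histl_ne_nil {i : ℕ} (hi : i < I.N) : 0 < (I.histl i).length := by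
  have h := (I.hist_mem ⟨i, hi⟩).1
  simp only [histl, hi, dif_pos]
  rw [List.length_pos_iff]
  intro h'
  simp [h'] at h

theorem histBody_spec {i : ℕ} {st : St} (hi : i < I.N) (h : I.HistInv i st) (h10 : st.v 10 = i) :
    Wp I.bound histBody (I.len * 4000 + 1000) st fun st' =>
      st'.v 10 = i ∧ st'.v 11 = st.v 11 ∧ I.HistInv (i + 1) st' := by
  have hpos := I.histl_ne_nil hi
  have hlen := I.hist_length_le_len hi
  have hnn := I.sq_le_len
  have hin : st.inp = I.hcell i ++ (List.range' (i + 1) (I.N - (i + 1))).flatMap I.hcell := by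
    rw [h.inp, show I.N - i = (I.N - (i + 1)) + 1 by omega, List.range'_succ, List.flatMap_cons]
  generalize hR : (List.range' (i + 1) (I.N - (i + 1))).flatMap I.hcell = R at hin
  obtain ⟨u, y, huy⟩ := List.exists_cons_of_length_pos hpos
  have hin' : st.inp = (I.lamq i).num :: ((I.lamq i).den : ℤ) :: ((I.histl i).length : ℤ) ::
      ((u : ℕ) : ℤ) :: (y.map (fun v : Fin I.n => ((v : ℕ) : ℤ)) ++ R) := by
    rw [hin, hcell, huy]; simp
  unfold histBody
  -- Four reads, the marking loop over the edges of the solution, the loop over the matrix, and one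
  -- assignment; both loop lengths are at most `len`.
  refine Wp.weaken_time (T₁ := 2 + (2 + (2 + (2 + ((((I.histl i).length - 1) * (1000 + 50) + 12 + 50)
    + ((I.n * I.n * (2000 + 50) + 13 + 50) + 18)))))) ?_ ?_
  rotate_left
  · have : (I.histl i).length - 1 ≤ I.len := by omega
    nlinarith
  refine Wp.seq (Wp.input hin' fun h1 => ?_)
  refine Wp.seq (Wp.input rfl fun h2 => ?_)
  refine Wp.seq (Wp.input rfl fun h3 => ?_)
  refine Wp.seq (Wp.input rfl fun h4 => ?_)
  -- The nested updates are hidden behind a name; only the values recorded next are used afterwards.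
  generalize hst : ((((((((st.seti _).setv 12 _).seti _).setv 13 _).seti _).setv 14 _).seti _).setv
    17 _) = st₁
  have e : ∀ x < 12, st₁.v x = st.v x := by
    intro x hx
    rw [← hst]
    simp [show x ≠ 12 by omega, show x ≠ 13 by omega, show x ≠ 14 by omega, show x ≠ 17 by omega]
  have e12 : st₁.v 12 = (I.lamq i).num := by rw [← hst]; simp
  have e13 : st₁.v 13 = (I.lamq i).den := by rw [← hst]; simp
  have e14 : st₁.v 14 = (I.histl i).length := by rw [← hst]; simp
  have e17 : st₁.v 17 = (u : ℕ) := by rw [← hst]; simp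
  have ein : st₁.inp = y.map (fun v : Fin I.n => ((v : ℕ) : ℤ)) ++ R := by rw [← hst]; simp
  have earr : st₁.arr = st.arr := by rw [← hst]; simp
  have eout : st₁.out = st.out := by rw [← hst]; simp
  clear hst
  have hd₁ : I.Data st₁ := h.data.of_eq (fun x hx _ => e x (by omega))
    (fun a _ _ => by rw [earr]) eout
  have hlb : ((I.histl i).length : ℤ) ≤ I.bound := (le_abs_self _).trans h3
  refine Wp.seq (Wp.mono (Wp.for_ (T := 1000) ((I.histl i).length - 1) (I.MarkInv i R st₁) (by norm_num)
    ⟨trivial, trivial⟩ ?_ ?_ ?_ ?_ (fun j st' hj hinv h15 => I.markBody_spec hd₁.header hi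
      ((e 10 (by norm_num)).trans h10) hj hinv h15) fun _ => id) le_rfl ?_)
  · simp [e14]; omega
  · omega
  · intro j st' a b hm
    exact ⟨fun x hx => by simp [show x ≠ 15 by omega, show x ≠ 16 by omega, hm.v x hx], hm.arr,
      hm.out, by simpa using hm.last, hm.inp, hm.le, hm.mark⟩
  · refine ⟨fun _ _ => rfl, fun _ _ => rfl, rfl, ⟨hpos, by simp [e17, huy]⟩, by simp [ein, huy],
      fun m => ?_, fun m _ => ?_⟩
    · rw [earr]; have := h.le m; omega
    · rw [earr]; have := h.le m; simp; omega
  intro st₂ hm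
  have e2 : ∀ x < 12, st₂.v x = st.v x := fun x hx => (hm.v x (by omega)).trans (e x hx)
  have hd₂ : I.Data st₂ := hd₁.of_eq (fun x hx _ => hm.v x (by omega))
    (fun a _ h5 => hm.arr a h5) hm.out
  have hmark : ∀ m < I.n * I.n, st₂.arr 5 m = i + 1 ↔ I.pair m ∈ edgeSeq (I.histl i) := by
    intro m hm'
    rw [hm.mark m hm', List.take_of_length_le (by simp [edgeSeq])]
  refine Wp.seq (Wp.mono (Wp.for_ (T := 2000) (I.n * I.n) (I.AccInv i st₂) (by norm_num) ⟨trivial, trivial⟩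
    (by simp [hd₂.header.n]) I.nn_le_bound ?_ ?_ (fun j st' hj hinv h15 => I.accBody_spec hd₂ hi
      ((e2 6 (by norm_num)).trans h.dl) ((e2 10 (by norm_num)).trans h10)
      ((hm.v _ (by norm_num)).trans e12) ((hm.v _ (by norm_num)).trans e13) hm.le hmark hj hinv h15)
      fun _ => id) le_rfl ?_)
  · intro j st' a b ha
    exact ⟨fun x hx => by simp [show x ≠ 15 by omega, show x ≠ 16 by omega, ha.v x hx], ha.arr,
      ha.out, ha.inp, ha.acc⟩
  · exact ⟨fun _ _ => rfl, fun _ _ => rfl, rfl, rfl, fun m hm' => by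
      rw [hm.arr 4 (by decide), earr, h.acc m hm']; simp⟩
  intro st₃ ha
  have e3 : ∀ x < 12, st₃.v x = st.v x := fun x hx => (ha.v x (by omega)).trans (e2 x hx)
  have hd₃ : I.Data st₃ := hd₂.of_eq (fun x hx _ => ha.v x (by omega))
    (fun a h4 _ => ha.arr a h4) ha.out
  refine Wp.weaken_time (Wp.set_eq (I.dl (i + 1)) ⟨trivial, trivial⟩ ?_ ?_ ?_) (by decide)
  · simp [e3, h.dl, ha.v 13, hm.v 13, e13, I.dl_succ]
  · refine I.abs_le_bound ?_
    rw [abs_of_pos (I.dl_pos _)]; exact I.dl_le hi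
  refine ⟨by simp [e3, h10], by simp [e3], hd₃.of_eq (fun x _ h6 => by simp [h6])
    (fun _ _ _ => rfl) rfl, by simp, by simp [e3, h.N], ?_, ?_, ?_⟩
  · intro m hm'
    simp [ha.acc m hm', hm']
  · intro m
    have := hm.le m
    simpa [ha.arr 5] using this
  · simp [ha.inp, hm.inp, hR]
    omega

theorem histProg_spec {st : St}
    (h : I.GraphInv ((I.N : ℤ) :: (List.range I.N).flatMap I.hcell) (I.n * I.n) st) :
    Wp I.bound histProg (I.N * (I.len * 4000 + 1050) + 200) st (I.HistInv I.N) := by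
  have hin : st.inp = (I.N : ℤ) :: (List.range I.N).flatMap I.hcell := by
    rw [h.inp]; simp
  unfold histProg
  refine Wp.weaken_time (T₁ := 8 + (2 + (I.N * (I.len * 4000 + 1000 + 50) + 5 + 50))) ?_
    (by rw [Nat.add_assoc (I.len * 4000)]; omega)
  refine Wp.seq (Wp.set_eq 1 trivial (by simp) ?_ ?_)
  · have := I.N_lt_bound
    simp; omega
  refine Wp.seq (Wp.input hin fun h1 => ?_)
  refine Wp.for_ I.N I.HistInv (by norm_num) trivial (by simp) I.N_lt_bound.le ?_ ?_
    (fun j st' hj hinv h10 => I.histBody_spec hj hinv h10) fun _ => id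
  · intro j st' a b hh
    exact ⟨hh.data.of_eq (fun x hx _ => by simp [show x ≠ 10 by omega, show x ≠ 11 by omega])
      (fun _ _ _ => rfl) rfl, by simp [hh.dl], by simp [hh.N], hh.acc, hh.le, hh.inp⟩
  · refine ⟨h.data.of_eq (fun x hx h6 => by simp [h6, show x ≠ 9 by omega]) (fun _ _ _ => rfl) rfl,
      by simp [Instance.dl], by simp, ?_, ?_, ?_⟩
    · intro m _; simpa [Instance.acc] using h.zero 4 (by decide) m
    · intro m; simpa using (h.zero 5 (by decide) m).le
    · simp [List.range_eq_range']

end WSExpH.Instance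

/-! ### Scaling the weights, and one Bellman update -/

namespace WSExpH

namespace Net

variable {n : ℕ} {N : Net n} {d f : Fin n → ℕ → ℤ} {v : Fin n} {S m : ℕ} {d' f' : ℤ}

/-- `Best` with growing `m` is the invariant of the loop over the next vertices. It starts with
stopping as the only option; `skip`, `keep` and `update` match the outcomes of one iteration. -/
theorem Best.init (d f : Fin n → ℕ → ℤ) (v : Fin n) (S : ℕ) :
    N.Best d f v S 0 (if v = N.t then 1 else 0) 0 where
  valid := by by_cases h : v = N.t <;> simp [h]
  halt h := by simp [h]
  go w hw := absurd hw (Nat.not_lt_zero _)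

theorem Best.skip {w : Fin n} (h : N.Best d f v S w d' f')
    (hw : ¬ ((v, w) ∈ N.E ∧ d w (N.step S (v, w)) ≠ 0)) : N.Best d f v S (w + 1) d' f' where
  valid := h.valid
  halt := h.halt
  go w' hw' he hd := by
    rcases Nat.lt_succ_iff_lt_or_eq.1 hw' with h' | h'
    · exact h.go w' h' he hd
    · obtain rfl : w' = w := Fin.ext h'
      exact absurd ⟨he, hd⟩ hw

theorem Best.keep {w : Fin n} (h : N.Best d f v S w d' f') (hd' : d' ≠ 0)
    (hf : f' ≤ N.via f v S w) : N.Best d f v S (w + 1) d' f' where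
  valid := h.valid
  halt := h.halt
  go w' hw' he hd := by
    rcases Nat.lt_succ_iff_lt_or_eq.1 hw' with h' | h'
    · exact h.go w' h' he hd
    · obtain rfl : w' = w := Fin.ext h'
      exact ⟨hd', hf⟩

theorem Best.update {w : Fin n} (h : N.Best d f v S w d' f') (he : (v, w) ∈ N.E)
    (hd : d w (N.step S (v, w)) ≠ 0) (hf : d' ≠ 0 → N.via f v S w ≤ f') :
    N.Best d f v S (w + 1) (((w : ℕ) : ℤ) + 2) (N.via f v S w) where
  valid := Or.inr (Or.inr ⟨w, he, hd, rfl, rfl⟩)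
  halt ht := ⟨by omega, (hf (h.halt ht).1).trans (h.halt ht).2⟩
  go w' hw' he' hd' := by
    refine ⟨by omega, ?_⟩
    rcases Nat.lt_succ_iff_lt_or_eq.1 hw' with h' | h'
    · obtain ⟨h1, h2⟩ := h.go w' h' he' hd'
      exact (hf h1).trans h2
    · obtain rfl : w' = w := Fin.ext h'
      exact le_rfl

end Net

namespace Instance

open RAM RAM.Ex

/-- Scales the weights. -/
def scaleBody : Prog :=
  Prog.put 1 (var 10) (var 3 * (get 1 (var 10) * var 5 / get 2 (var 10)) * var 6) ⨟
  Prog.put 4 (var 10) ((var 4 - var 3) * get 4 (var 10) * var 5)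

/-- Scales all weights. -/
def scaleProg : Prog := Prog.for_ 10 11 (var 0 * var 0) scaleBody

/-- Improves the decision for a state with the next vertex. -/
def innerBody : Prog :=
  Prog.set 19 (var 13 * var 0 + var 17) ⨟
  Prog.set 20 (lit 1 - (var 14 / get 3 (var 19) - var 14 / get 3 (var 19) / lit 2 * lit 2)) ⨟
  Prog.set 21 (var 12 * var 8 + (var 17 * var 7 + (var 14 + var 20 * get 3 (var 19)))) ⨟
  Prog.cond (get 0 (var 19) * get 7 (var 21))
    (Prog.set 22 (get 1 (var 19) + var 20 * get 4 (var 19) + get 6 (var 21)) ⨟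
      Prog.cond (var 15)
        (Prog.cond (var 16 - var 22) (Prog.set 15 (var 17 + lit 2) ⨟ Prog.set 16 (var 22)) Prog.skip)
        (Prog.set 15 (var 17 + lit 2) ⨟ Prog.set 16 (var 22)))
    Prog.skip

/-- Computes an entry of the dynamic programming table. -/
def tableBody : Prog :=
  Prog.set 12 (var 10 / var 8) ⨟
  Prog.set 13 ((var 10 - var 12 * var 8) / var 7) ⨟
  Prog.set 14 (var 10 - var 12 * var 8 - var 13 * var 7) ⨟
  Prog.set 15 (lit 0) ⨟ Prog.set 16 (lit 0) ⨟
  Prog.cond (lit 1 - (var 13 - var 2) * (var 13 - var 2)) (Prog.set 15 (lit 1)) Prog.skip ⨟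
  Prog.for_ 17 18 (var 0) innerBody ⨟
  Prog.put 6 (var 10 + var 8) (var 16) ⨟ Prog.put 7 (var 10 + var 8) (var 15)

/-- Computes the dynamic programming table. -/
def tableProg : Prog :=
  Prog.set 8 (var 0 * var 7) ⨟ Prog.for_ 10 11 (var 8 * var 8) tableBody

variable (I : Instance)

/-- The state after scaling the first `j` weights. -/
structure ScaleInv (j : ℕ) (st : St) : Prop where
  header : I.Header st
  dc : st.v 5 = I.dc (I.n * I.n)
  dl : st.v 6 = I.dl I.N
  K : st.v 7 = I.K
  edge : ∀ m < I.n * I.n, st.arr 0 m = if I.pair m ∈ I.E then 1 else 0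
  den : ∀ m < I.n * I.n, st.arr 2 m = (I.cq m).den
  bit : ∀ m < I.n * I.n, st.arr 3 m = I.bit m
  W : ∀ m < I.n * I.n, st.arr 1 m = if m < j then I.wgt m else (I.cq m).num
  G : ∀ m < I.n * I.n, st.arr 4 m = if m < j then I.bonus m else I.acc I.N m
  zero : ∀ a : Fin 8, 6 ≤ a → ∀ m, st.arr a m = 0

theorem abs_wgt_le_bound {m : ℕ} (hm : m < I.n * I.n) : |I.wgt m| ≤ (I.bound : ℤ) := by
  have h1 := I.abs_wgt_le hm
  have h2 : ((2 : ℤ) * (2 ^ I.len) ^ 4) ≤ I.bound := by exact_mod_cast I.pow_four_le_bound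
  have h3 : (0 : ℤ) ≤ (2 ^ I.len) ^ 4 := by positivity
  omega

theorem abs_bonus_le' (m : ℕ) : |I.bonus m| ≤ (2 ^ I.len) ^ 4 :=
  (I.abs_bonus_le m).trans (pow_le_pow_right₀ (one_le_pow₀ (by norm_num)) (by norm_num))

theorem abs_bonus_le_bound (m : ℕ) : |I.bonus m| ≤ (I.bound : ℤ) := by
  have h1 := I.abs_bonus_le' m
  have h2 : ((2 : ℤ) * (2 ^ I.len) ^ 4) ≤ I.bound := by exact_mod_cast I.pow_four_le_bound
  have h3 : (0 : ℤ) ≤ (2 ^ I.len) ^ 4 := by positivity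
  omega

theorem scaleBody_spec {j : ℕ} {st : St} (hj : j < I.n * I.n) (h : I.ScaleInv j st)
    (hi : st.v 10 = j) : Wp I.bound scaleBody 3000 st fun st' =>
      st'.v 10 = j ∧ st'.v 11 = st.v 11 ∧ I.ScaleInv (j + 1) st' := by
  have h1 : st.arr 1 j = (I.cq j).num := by rw [h.W j hj, if_neg (lt_irrefl j)]
  have h4 : st.arr 4 j = I.acc I.N j := by rw [h.G j hj, if_neg (lt_irrefl j)]
  have hlt : ∀ m, m ≠ j → (m < j + 1 ↔ m < j) := by omega
  unfold scaleBody
  refine Wp.step (by decide) (Wp.put_eq j (I.wgt j) trivial (by simp [hi]) (by simp [hi])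
    (by simp [hi, h1, h.header.a, h.dc, h.den j hj, h.dl, wgt]) (I.abs_wgt_le_bound hj) ?_)
  refine Wp.weaken_time (Wp.put_eq j (I.bonus j) trivial (by simp [hi]) (by simp [hi])
    (by simp [hi, h4, h.header.a, h.header.b, h.dc, bonus]) (I.abs_bonus_le_bound j) ?_) (by decide)
  refine ⟨by simp [hi], by simp, h.header.of_eq (fun _ _ => rfl) rfl, h.dc, h.dl, h.K, ?_, ?_, ?_,
    ?_, ?_, ?_⟩
  · intro m hm; simpa using h.edge m hm
  · intro m hm; simpa using h.den m hm
  · intro m hm; simpa using h.bit m hm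
  · intro m hm
    by_cases hmj : m = j
    · simp [hmj]
    · simpa [hmj, hlt m hmj] using h.W m hm
  · intro m hm
    by_cases hmj : m = j
    · simp [hmj]
    · simpa [hmj, hlt m hmj] using h.G m hm
  · intro a ha m
    simpa [show a ≠ 1 by omega, show a ≠ 4 by omega] using h.zero a ha m

theorem scaleProg_spec {st : St} (h : I.HistInv I.N st) :
    Wp I.bound scaleProg (I.n * I.n * 3050 + 100) st (I.ScaleInv (I.n * I.n)) := by
  refine Wp.weaken_time (Wp.for_ (I.n * I.n) I.ScaleInv (by norm_num) ⟨trivial, trivial⟩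
    (by simp [h.data.header.n]) I.nn_le_bound ?_ ?_
    (fun j st' hj hinv hi => I.scaleBody_spec hj hinv hi) fun _ => id) ?_
  · intro j st' y z h
    exact ⟨h.header.of_eq (fun x hx => by simp [show x ≠ 10 by omega, show x ≠ 11 by omega]) rfl,
      by simp [h.dc], by simp [h.dl], by simp [h.K], h.edge, h.den, h.bit, h.W, h.G, h.zero⟩
  · exact ⟨h.data.header, h.data.dc, h.dl, h.data.K, h.data.edge, h.data.den, h.data.bit,
      fun m hm => by simpa using h.data.num m hm, fun m hm => by simpa using h.acc m hm,
      h.data.zero⟩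
  · have : (var 0 * var 0).time = 13 := rfl
    omega

/-- The data that is not changed during the computation of the dynamic programming table. -/
structure Static (st : St) : Prop where
  header : I.Header st
  K : st.v 7 = I.K
  M : st.v 8 = I.M
  edge : ∀ e, st.arr 0 (I.ix e) = if e ∈ I.E then 1 else 0
  bit : ∀ e, st.arr 3 (I.ix e) = I.net.pw e
  W : ∀ e, st.arr 1 (I.ix e) = I.net.W e
  G : ∀ e, st.arr 4 (I.ix e) = I.net.G e

variable {I} in
theorem Static.of_eq {st st' : St} (h : I.Static st) (hv : ∀ x < 9, st'.v x = st.v x)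
    (ha : ∀ a : Fin 8, a < 6 → st'.arr a = st.arr a) (ho : st'.out = st.out) : I.Static st' where
  header := h.header.of_eq (fun x hx => hv x (by omega)) ho
  K := by rw [hv _ (by norm_num), h.K]
  M := by rw [hv _ (by norm_num), h.M]
  edge := by rw [ha 0 (by decide)]; exact h.edge
  bit := by rw [ha 3 (by decide)]; exact h.bit
  W := by rw [ha 1 (by decide)]; exact h.W
  G := by rw [ha 4 (by decide)]; exact h.G

/-- The weight that an edge contributes to the bound for the table entries. -/
def wmax : ℤ := 2 * (2 ^ I.len) ^ 4

theorem wmax_nonneg : 0 ≤ I.wmax := by unfold wmax; positivity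

/-- The value of `1 - S / p % 2` as computed by the program. -/
theorem fresh_cast (S p : ℕ) : (1 : ℤ) - ((S : ℤ) / p - (S : ℤ) / p / 2 * 2) =
    ((1 - S / p % 2 : ℕ) : ℤ) := by
  rw [← Int.natCast_div]
  generalize S / p = x
  omega

/-- The state before an iteration of the inner loop, relative to the state `st₀` before the
loop. -/
structure InnerInv (lay : ℕ) (v : Fin I.n) (S : ℕ) (st₀ : St) (j : ℕ) (st : St) : Prop where
  vars : ∀ x < 15, st.v x = st₀.v x
  arr : st.arr = st₀.arr
  out : st.out = st₀.out
  best : I.net.Best (fun w S => st₀.arr 7 (lay * I.M + (w * I.K + S)))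
    (fun w S => st₀.arr 6 (lay * I.M + (w * I.K + S))) v S j (st.v 15) (st.v 16)
  value : |st.v 16| ≤ (lay + 1) * I.wmax
  decision : 0 ≤ st.v 15 ∧ st.v 15 ≤ I.n + 1

variable {I} in
theorem state_lt {w : Fin I.n} {S : ℕ} (hS : S < I.K) : (w : ℕ) * I.K + S < I.M := by
  have : ((w : ℕ) + 1) * I.K ≤ I.n * I.K := Nat.mul_le_mul_right _ w.2
  unfold M
  rw [Nat.succ_mul] at this
  omega

set_option maxHeartbeats 1000000 in
-- The hypothesis `hval` bounds the entries of layer `lay` by `lay * wmax`. A candidate value is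
-- such an entry plus the contribution of one edge, hence at most `(lay + 1) * wmax`, which fits
-- below `bound` as `lay < M`.
theorem innerBody_spec {lay : ℕ} {v : Fin I.n} {S : ℕ} {st₀ : St} {j : ℕ} {st : St}
    (h0 : I.Static st₀) (hlay : lay < I.M) (hS : S < I.K) (h12 : st₀.v 12 = lay)
    (h13 : st₀.v 13 = (v : ℕ)) (h14 : st₀.v 14 = S)
    (hval : ∀ i, |st₀.arr 6 i| ≤ (i / I.M : ℕ) * I.wmax) (hdec : ∀ i, 0 ≤ st₀.arr 7 i)
    (hj : j < I.n) (h : I.InnerInv lay v S st₀ j st) (h17 : st.v 17 = j) :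
    Wp I.bound innerBody 3000 st fun st' =>
      st'.v 17 = j ∧ st'.v 18 = st.v 18 ∧ I.InnerInv lay v S st₀ (j + 1) st' := by
  obtain ⟨w, rfl⟩ : ∃ w : Fin I.n, j = w := ⟨⟨j, hj⟩, rfl⟩
  have hs : I.Static st := h0.of_eq (fun x hx => h.vars x (by omega)) (fun a _ => by rw [h.arr]) h.out
  have v12 := (h.vars 12 (by norm_num)).trans h12
  have v13 := (h.vars 13 (by norm_num)).trans h13
  have v14 := (h.vars 14 (by norm_num)).trans h14
  have hn : (I.n : ℤ) + 1 ≤ I.bound := by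
    have h1 := I.n_le_M
    have h2 := I.sq_le_bound
    have h3 : 1 ≤ I.M * I.M := Nat.mul_pos I.M_pos I.M_pos
    exact_mod_cast (by omega : I.n + 1 ≤ I.bound)
  have hstep : I.net.step S (v, w) < I.K := I.net.step_lt hS _
  have hy : w * I.K + I.net.step S (v, w) < I.M := state_lt hstep
  have hyb : lay * I.M + (w * I.K + I.net.step S (v, w)) ≤ I.bound := by
    have h1 : lay * I.M ≤ I.M * I.M := Nat.mul_le_mul_right _ hlay.le
    have h2 := I.sq_le_bound
    omega
  have hydiv : (lay * I.M + (w * I.K + I.net.step S (v, w))) / I.M = lay := by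
    rw [Nat.add_comm, Nat.add_mul_div_right _ _ I.M_pos, Nat.div_eq_of_lt hy, Nat.zero_add]
  -- The table position of the state that is reached through the edge `(v, w)`.
  set y := lay * I.M + (w * I.K + I.net.step S (v, w)) with hydef
  have hf6 := hval y
  rw [hydiv] at hf6
  have hvia : |I.net.via (fun w S => st₀.arr 6 (lay * I.M + (w * I.K + S))) v S w| ≤
      (lay + 1) * I.wmax := by
    have h1 := I.abs_wgt_le (I.ix_lt (v, w))
    have h2 := I.abs_bonus_le' (I.ix (v, w))
    have h3 := I.net.fresh_le S (v, w)
    have h4 : |(I.net.fresh S (v, w) : ℤ) * I.net.G (v, w)| ≤ (2 ^ I.len) ^ 4 := by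
      rw [abs_mul, Nat.abs_cast]
      have h5 : (I.net.fresh S (v, w) : ℤ) ≤ 1 := by exact_mod_cast h3
      calc _ ≤ 1 * |I.net.G (v, w)| := mul_le_mul_of_nonneg_right h5 (abs_nonneg _)
        _ ≤ _ := by rw [one_mul]; exact h2
    have h5 : |I.net.W (v, w)| ≤ (2 ^ I.len) ^ 4 := h1
    unfold Net.via
    refine (abs_add_three _ _ _).trans ?_
    rw [add_mul, one_mul]
    have h6 : I.wmax = (2 ^ I.len) ^ 4 + (2 ^ I.len) ^ 4 := by unfold wmax; ring
    change _ + _ + |st₀.arr 6 y| ≤ _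
    linarith
  have hviab : (lay + 1) * I.wmax ≤ (I.bound : ℤ) := by
    have h1 : (I.M : ℤ) * I.wmax ≤ I.bound := by
      unfold wmax; exact_mod_cast I.weights_le_bound
    have h2 : ((lay : ℤ) + 1) ≤ I.M := by exact_mod_cast hlay
    exact (mul_le_mul_of_nonneg_right h2 I.wmax_nonneg).trans h1
  set z := I.net.via (fun w S => st₀.arr 6 (lay * I.M + (w * I.K + S))) v S w with hz
  have hixb : (I.ix (v, w) : ℤ) ≤ I.bound := by
    have h1 := I.ix_lt (v, w)
    have h2 := I.nn_le_bound
    exact_mod_cast (by omega : I.ix (v, w) ≤ I.bound)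
  have hdc : (I.net.fresh S (v, w) : ℤ) ≤ 1 := by exact_mod_cast I.net.fresh_le S (v, w)
  unfold innerBody
  refine Wp.step (by decide) (Wp.set_eq (I.ix (v, w)) ⟨⟨trivial, trivial⟩, trivial⟩
    (by simp [v13, h17, hs.header.n, ix]) (by simpa using hixb) ?_)
  refine Wp.step (by decide) (Wp.set_eq (I.net.fresh S (v, w)) (by simp) ?_ ?_ ?_)
  · simp only [eval_sub, eval_lit, eval_div, eval_var, St.setv_v, eval_get, eval_mul,
      St.setv_arr]
    norm_num
    rw [v14, hs.bit, fresh_cast]; rfl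
  · rw [Nat.abs_cast]; linarith
  refine Wp.step (by decide) (Wp.set_eq y (by simp) ?_ ?_ ?_)
  · simp [v12, hs.M, h17, hs.K, v14, hs.bit, hydef, Net.step]
  · simpa using (by exact_mod_cast hyb : (y : ℤ) ≤ I.bound)
  generalize hst : ((st.setv 19 _).setv 20 _).setv 21 _ = st₁
  have w19 : st₁.v 19 = I.ix (v, w) := by rw [← hst]; simp
  have w20 : st₁.v 20 = I.net.fresh S (v, w) := by rw [← hst]; simp
  have w21 : st₁.v 21 = y := by rw [← hst]; simp
  have wlt : ∀ x < 19, st₁.v x = st.v x := by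
    intro x hx
    rw [← hst]
    simp [show x ≠ 19 by omega, show x ≠ 20 by omega, show x ≠ 21 by omega]
  have warr : st₁.arr = st.arr := by rw [← hst]; simp
  have wout : st₁.out = st.out := by rw [← hst]; simp
  clear hst
  have keep : ∀ st' : St, (∀ x < 19, st'.v x = st.v x) → st'.arr = st.arr → st'.out = st.out →
      I.net.Best (fun w S => st₀.arr 7 (lay * I.M + (w * I.K + S)))
        (fun w S => st₀.arr 6 (lay * I.M + (w * I.K + S))) v S (w + 1) (st.v 15) (st.v 16) →
      st'.v 17 = (w : ℕ) ∧ st'.v 18 = st.v 18 ∧ I.InnerInv lay v S st₀ (w + 1) st' := by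
    intro st' hv ha ho hb
    refine ⟨by rw [hv _ (by norm_num), h17], hv _ (by norm_num), fun x hx => ?_, ha.trans h.arr,
      ho.trans h.out, ?_, ?_, ?_⟩
    · rw [hv x (by omega), h.vars x hx]
    · rwa [hv _ (by norm_num), hv _ (by norm_num)]
    · rw [hv _ (by norm_num)]; exact h.value
    · rw [hv _ (by norm_num)]; exact h.decision
  -- Since decisions are nonnegative, the product of edge flag and decision is positive if and only
  -- if `(v, w)` is an edge and the next state is feasible.
  refine Wp.cond_step (by simp [w19, w21]) (by decide) (fun hp => ?_) (fun hp => ?_)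
  · simp only [eval_mul, eval_get, eval_var, w19, w21, Int.toNat_natCast, warr, hs.edge] at hp
    have he : (v, w) ∈ I.E := by
      by_contra he
      simp [he] at hp
    have hd : st₀.arr 7 y ≠ 0 := by
      rw [← h.arr]
      intro hd
      simp [hd] at hp
    refine Wp.step (by decide) (Wp.set_eq z (by simp [w19, w21]) ?_ (hvia.trans hviab) ?_)
    · simp only [eval_add, eval_mul, eval_get, eval_var, w19, w21, w20, Int.toNat_natCast, warr,
        hs.W, hs.G, hz, Net.via, hydef, h.arr]
    have upd : (st.v 15 ≠ 0 → z ≤ st.v 16) → ∀ T, 1000 ≤ T →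
        Wp I.bound (Prog.set 15 (var 17 + lit 2) ⨟ Prog.set 16 (var 22)) T (st₁.setv 22 z)
        fun st' => st'.v 17 = (w : ℕ) ∧ st'.v 18 = st.v 18 ∧
          I.InnerInv lay v S st₀ (w + 1) st' := by
      intro hle T hT
      refine Wp.weaken_time ?_ hT
      have hwn : ((w : ℕ) : ℤ) + 2 ≤ I.n + 1 := by have := w.2; omega
      refine Wp.step (by decide) (Wp.set_eq (((w : ℕ) : ℤ) + 2) ⟨trivial, trivial⟩
        (by simp [wlt, h17]) (by rw [abs_of_nonneg (by positivity)]; omega) ?_)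
      refine Wp.weaken_time (Wp.set_eq z trivial (by simp) (hvia.trans hviab) ?_) (by decide)
      refine ⟨by simp [wlt, h17], by simp [wlt], fun x hx => ?_, warr.trans h.arr,
        wout.trans h.out, ?_, ?_, ?_⟩
      · simp [show x ≠ 16 by omega, show x ≠ 15 by omega, show x ≠ 22 by omega,
          wlt x (by omega), h.vars x hx]
      · simpa using h.best.update he hd hle
      · simpa using hvia
      · simp; omega
    refine Wp.cond_step trivial (by decide) (fun hp15 => ?_) (fun hp15 => ?_)
    · simp only [eval_var, St.setv_v] at hp15
      norm_num [wlt] at hp15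
      refine Wp.cond_step (by simp) (by decide) (fun hlt => ?_) (fun hlt => ?_)
      · simp [wlt] at hlt
        exact upd (fun _ => by omega) _ (by decide)
      · simp [wlt] at hlt
        refine Wp.weaken_time (Wp.skip (keep _ (fun x hx => ?_) warr wout ?_)) (by decide)
        · simp [show x ≠ 22 by omega, wlt x hx]
        · exact h.best.keep hp15.ne' (by rw [← hz]; omega)
    · simp only [eval_var, St.setv_v] at hp15
      norm_num [wlt] at hp15
      -- The current decision is 0: no option has been found yet, and there is no value to compare
      -- with.
      exact upd (fun h15 => absurd (le_antisymm hp15 h.decision.1) h15) _ (by decide)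
  · refine Wp.weaken_time (Wp.skip (keep _ wlt warr wout (h.best.skip ?_))) (by decide)
    rintro ⟨he, hd⟩
    simp only [eval_mul, eval_get, eval_var, w19, w21, Int.toNat_natCast, warr, hs.edge] at hp
    have he' : (v, w) ∈ I.E := he
    have h1 := hdec y
    rw [if_pos he', one_mul, h.arr] at hp
    exact hd (le_antisymm hp h1)

end Instance

end WSExpH

/-! ### Filling the whole table -/

namespace WSExpH

/-- `Best` looks at the tables only in states one edge away, so it survives writing to any other
entry. -/
theorem Net.Best.congr {n : ℕ} {N : Net n} {d f d₂ f₂ : Fin n → ℕ → ℤ} {v : Fin n} {S m : ℕ}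
    {d' f' : ℤ} (h : N.Best d f v S m d' f')
    (hd : ∀ w, d₂ w (N.step S (v, w)) = d w (N.step S (v, w)))
    (hf : ∀ w, f₂ w (N.step S (v, w)) = f w (N.step S (v, w))) : N.Best d₂ f₂ v S m d' f' := by
  have hvia : ∀ w, N.via f₂ v S w = N.via f v S w := fun w => by unfold Net.via; rw [hf]
  refine ⟨?_, h.halt, ?_⟩
  · simp only [hd, hvia]; exact h.valid
  · simp only [hd, hvia]; exact h.go

namespace Instance

open RAM RAM.Ex

variable (I : Instance)

/-- The position of the state `(v, S)` with `lay` remaining vertices. -/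
def pos (lay : ℕ) (v : Fin I.n) (S : ℕ) : ℕ := lay * I.M + (v * I.K + S)

variable {I} in
theorem pos_lt {lay : ℕ} {v : Fin I.n} {S : ℕ} (hS : S < I.K) :
    I.pos lay v S < (lay + 1) * I.M := by
  have := state_lt (w := v) hS
  rw [Nat.succ_mul]
  unfold pos
  omega

theorem pos_succ (lay : ℕ) (v : Fin I.n) (S : ℕ) : I.pos (lay + 1) v S = I.pos lay v S + I.M := by
  unfold pos; ring

variable {I} in
theorem pos_div {lay : ℕ} {v : Fin I.n} {S : ℕ} (hS : S < I.K) : I.pos lay v S / I.M = lay := by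
  rw [pos, Nat.add_comm, Nat.add_mul_div_right _ _ I.M_pos, Nat.div_eq_of_lt (state_lt hS),
    Nat.zero_add]

variable {I} in
theorem pos_inj {lay lay' : ℕ} {v v' : Fin I.n} {S S' : ℕ} (hS : S < I.K) (hS' : S' < I.K)
    (h : I.pos lay v S = I.pos lay' v' S') : lay = lay' ∧ v = v' ∧ S = S' := by
  have h1 : lay = lay' := by
    rw [← pos_div (lay := lay) (v := v) hS, h, pos_div hS']
  subst h1
  have h2 : (v : ℕ) * I.K + S = v' * I.K + S' := by unfold pos at h; omega
  have h3 : ∀ (v : Fin I.n) (S : ℕ), S < I.K → ((v : ℕ) * I.K + S) / I.K = v := by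
    intro v S hS
    rw [Nat.add_comm, Nat.add_mul_div_right _ _ I.K_pos, Nat.div_eq_of_lt hS, Nat.zero_add]
  have h4 : v = v' := Fin.ext (by rw [← h3 v S hS, h2, h3 v' S' hS'])
  subst h4
  exact ⟨rfl, rfl, by omega⟩

/-- Layer, vertex and set are the mixed radix digits of `q`, so a single counter runs through the
states layer by layer. -/
theorem exists_pos (q : ℕ) : ∃ lay v S, S < I.K ∧ q = I.pos lay v S := by
  have h1 : q % I.M < I.n * I.K := Nat.mod_lt _ I.M_pos
  refine ⟨q / I.M, ⟨q % I.M / I.K, Nat.div_lt_of_lt_mul (by rwa [Nat.mul_comm])⟩, q % I.M % I.K,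
    Nat.mod_lt _ I.K_pos, ?_⟩
  simp only [pos, Nat.div_add_mod']

/-- The state after the computation of the first `q` entries of the table. -/
structure TableInv (q : ℕ) (st : St) : Prop where
  static : I.Static st
  value : ∀ i, |st.arr 6 i| ≤ (i / I.M : ℕ) * I.wmax
  decision : ∀ i, 0 ≤ st.arr 7 i ∧ st.arr 7 i ≤ I.n + 1
  zero : ∀ i < I.M, st.arr 7 i = 0 ∧ st.arr 6 i = 0
  best : ∀ lay v S, S < I.K → I.pos lay v S < q →
    I.net.Best (fun w S => st.arr 7 (I.pos lay w S)) (fun w S => st.arr 6 (I.pos lay w S)) v S I.n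
      (st.arr 7 (I.pos (lay + 1) v S)) (st.arr 6 (I.pos (lay + 1) v S))

/-- For integers, `1 - (v - t) ^ 2` is positive if and only if `v = t`, which makes equality a sign
test. -/
theorem initial_decision {st : St} {v : Fin I.n} {B : ℕ} (hB : 1 ≤ B) (h2 : st.v 2 = (I.t : ℕ))
    (h13 : st.v 13 = (v : ℕ)) (h15 : st.v 15 = 0) :
    Wp B (.cond (lit 1 - (var 13 - var 2) * (var 13 - var 2)) (.set 15 (lit 1)) .skip) 500 st
      fun st' => st' = st.setv 15 (if v = I.t then 1 else 0) := by
  refine Wp.cond_step (by simp) (by decide) (fun hp => ?_) (fun hp => ?_)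
  · refine Wp.weaken_time (Wp.set_eq 1 trivial rfl (by simpa using hB) ?_) (by decide)
    simp only [eval_sub, eval_lit, eval_mul, eval_var, h13, h2] at hp
    have hv : v = I.t := by
      by_contra hv
      have h0 : (((v : ℕ) : ℤ) - ((I.t : ℕ) : ℤ)) ≠ 0 := fun h => hv (Fin.ext (by omega))
      have := mul_self_pos.2 h0
      omega
    rw [if_pos hv]
  · refine Wp.weaken_time (Wp.skip ?_) (by decide)
    simp only [eval_sub, eval_lit, eval_mul, eval_var, h13, h2] at hp
    have hv : v ≠ I.t := by
      rintro rfl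
      simp at hp
    rw [if_neg hv]
    simp only [St.setv, ← h15, Function.update_eq_self]

set_option maxHeartbeats 1000000 in
-- Iteration `q` treats the state at position `q` and writes at position `q + M`, the same state one
-- layer higher. It reads only layer `lay`, and writes only to layer `lay + 1`.
theorem tableBody_spec {q : ℕ} {st : St} (hq : q < I.M * I.M) (h : I.TableInv q st)
    (h10 : st.v 10 = q) : Wp I.bound tableBody (I.n * 3050 + 3000) st fun st' =>
      st'.v 10 = q ∧ st'.v 11 = st.v 11 ∧ I.TableInv (q + 1) st' := by
  obtain ⟨lay, v, S, hS, rfl⟩ := I.exists_pos q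
  have hlay : lay < I.M := by
    rw [← pos_div (lay := lay) (v := v) hS]; exact Nat.div_lt_of_lt_mul hq
  have hMb := I.sq_le_bound
  have hM1 : I.M ≤ I.M * I.M := Nat.le_mul_of_pos_left _ I.M_pos
  have hM0 := I.M_pos
  have hn := I.n_le_M
  have hK := I.K_le_M
  have hv2 := v.2
  have hpos : (I.pos lay v S : ℤ) = lay * I.M + (v * I.K + S) := by unfold pos; push_cast; ring
  have hs := h.static
  unfold tableBody
  refine Wp.weaken_time (T₁ := 19 + (500 + (500 + (7 + (7 + (500 + ((I.n * (3000 + 50) + 5 + 50) +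
    (500 + 500)))))))) ?_ (by omega)
  refine Wp.seq (Wp.weaken_time (Wp.set_eq lay ⟨trivial, trivial⟩ ?_ ?_ ?_) (by decide))
  · simp only [eval_div, eval_var, h10, hs.M]
    rw [← Int.natCast_div, pos_div hS]
  · rw [Nat.abs_cast]; exact_mod_cast (by omega : lay ≤ I.bound)
  refine Wp.seq (Wp.weaken_time (Wp.set_eq (v : ℕ) (by simp) ?_ ?_ ?_) (by decide))
  · simp [h10, hs.M, hs.K]
    rw [hpos, add_sub_cancel_left]
    have hd : ((v : ℕ) * I.K + S) / I.K = v := by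
      rw [Nat.add_comm, Nat.add_mul_div_right _ _ I.K_pos, Nat.div_eq_of_lt hS, Nat.zero_add]
    exact_mod_cast hd
  · rw [Nat.abs_cast]; exact_mod_cast (by omega : (v : ℕ) ≤ I.bound)
  refine Wp.seq (Wp.weaken_time (Wp.set_eq S (by simp) ?_ ?_ ?_) (by decide))
  · simp [h10, hs.M, hs.K, hpos]
  · rw [Nat.abs_cast]; exact_mod_cast (by omega : S ≤ I.bound)
  refine Wp.seq (Wp.set_eq 0 trivial rfl (by simp) ?_)
  refine Wp.seq (Wp.set_eq 0 trivial rfl (by simp) ?_)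
  refine Wp.seq (Wp.mono (I.initial_decision (v := v) (by omega) (by simp [hs.header.t]) (by simp)
    (by simp)) le_rfl ?_)
  rintro _ rfl
  generalize hst : (((((st.setv 12 _).setv 13 _).setv 14 _).setv 15 _).setv 16 _).setv 15 _ = st₁
  have e : ∀ x < 12, st₁.v x = st.v x := by
    intro x hx
    rw [← hst]
    simp [show x ≠ 12 by omega, show x ≠ 13 by omega, show x ≠ 14 by omega, show x ≠ 15 by omega,
      show x ≠ 16 by omega]
  have e12 : st₁.v 12 = lay := by rw [← hst]; simp
  have e13 : st₁.v 13 = (v : ℕ) := by rw [← hst]; simp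
  have e14 : st₁.v 14 = S := by rw [← hst]; simp
  have e15 : st₁.v 15 = if v = I.t then 1 else 0 := by rw [← hst]; simp
  have e16 : st₁.v 16 = 0 := by rw [← hst]; simp
  have earr : st₁.arr = st.arr := by rw [← hst]; simp
  have eout : st₁.out = st.out := by rw [← hst]; simp
  clear hst
  have hs₁ : I.Static st₁ := hs.of_eq (fun x hx => e x (by omega)) (fun _ _ => by rw [earr]) eout
  refine Wp.seq (Wp.mono (Wp.for_ (T := 3000) I.n (I.InnerInv lay v S st₁) (by norm_num) trivial
    (by simp [hs₁.header.n]) (by omega) ?_ ?_ (fun j st' hj hinv h17 => I.innerBody_spec hs₁ hlay hS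
      e12 e13 e14 (by rw [earr]; exact h.value) (by rw [earr]; exact fun i => (h.decision i).1)
      hj hinv h17) fun _ => id) le_rfl ?_)
  · intro j st' a b hh
    exact ⟨fun x hx => by simp [show x ≠ 17 by omega, show x ≠ 18 by omega, hh.vars x hx], hh.arr,
      hh.out, by simpa using hh.best, by simpa using hh.value, by simpa using hh.decision⟩
  · refine ⟨fun _ _ => rfl, rfl, rfl, ?_, ?_, ?_⟩
    · rw [e15, e16]; exact Net.Best.init _ _ _ _
    · rw [e16, abs_zero]
      have := I.wmax_nonneg
      positivity
    · rw [e15]; split_ifs <;> omega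
  intro st₂ h₂
  have hs₂ : I.Static st₂ := hs₁.of_eq (fun x hx => h₂.vars x (by omega))
    (fun _ _ => by rw [h₂.arr]) h₂.out
  have i10 : st₂.v 10 = I.pos lay v S := by
    rw [h₂.vars _ (by norm_num), e _ (by norm_num), h10]
  have iarr : st₂.arr = st.arr := h₂.arr.trans earr
  have hvb : (lay + 1) * I.wmax ≤ (I.bound : ℤ) := by
    have h1 : (I.M : ℤ) * I.wmax ≤ I.bound := by
      unfold wmax; exact_mod_cast I.weights_le_bound
    have h2 : ((lay : ℤ) + 1) ≤ I.M := by exact_mod_cast hlay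
    exact (mul_le_mul_of_nonneg_right h2 I.wmax_nonneg).trans h1
  refine Wp.seq (Wp.weaken_time (Wp.put_eq (I.pos (lay + 1) v S) (st₂.v 16) ⟨trivial, trivial⟩
    (by simp [i10, hs₂.M, pos_succ]) trivial rfl (h₂.value.trans hvb) ?_) (by decide))
  refine Wp.weaken_time (Wp.put_eq (I.pos (lay + 1) v S) (st₂.v 15) ⟨trivial, trivial⟩
    (by simp [i10, hs₂.M, pos_succ]) trivial (by simp) ?_ ?_) (by decide)
  · rw [abs_of_nonneg h₂.decision.1]
    refine h₂.decision.2.trans ?_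
    exact_mod_cast (by omega : I.n + 1 ≤ I.bound)
  have a7 : ∀ i, ((st₂.seta 6 (I.pos (lay + 1) v S) (st₂.v 16)).seta 7 (I.pos (lay + 1) v S)
      (st₂.v 15)).arr 7 i = if i = I.pos (lay + 1) v S then st₂.v 15 else st.arr 7 i := by
    intro i; simp [iarr]
  have a6 : ∀ i, ((st₂.seta 6 (I.pos (lay + 1) v S) (st₂.v 16)).seta 7 (I.pos (lay + 1) v S)
      (st₂.v 15)).arr 6 i = if i = I.pos (lay + 1) v S then st₂.v 16 else st.arr 6 i := by
    intro i; simp [iarr]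
  refine ⟨i10, ?_, hs₂.of_eq (fun _ _ => rfl) (fun a ha => ?_) rfl, ?_, ?_, ?_, ?_⟩
  · simp [h₂.vars, e]
  · funext i
    simp [show a ≠ 6 by omega, show a ≠ 7 by omega]
  · intro i
    rw [a6]
    split_ifs with hi
    · rw [hi, pos_div hS]; exact_mod_cast h₂.value
    · exact h.value i
  · intro i
    rw [a7]
    split_ifs with hi
    · exact h₂.decision
    · exact h.decision i
  · intro i hi
    have : i ≠ I.pos (lay + 1) v S := by rw [pos_succ]; omega
    rw [a7, a6, if_neg this, if_neg this]
    exact h.zero i hi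
  · intro lay' v' S' hS' hlt
    -- The entries treated so far depend on layers up to `lay`, whereas the new entry lies in layer
    -- `lay + 1`; hence the earlier statements remain true.
    have hle : lay' ≤ lay := by
      rw [← pos_div (lay := lay') (v := v') hS', ← pos_div (lay := lay) (v := v) hS]
      exact Nat.div_le_div_right (by omega)
    have hne : ∀ (w : Fin I.n) (S'' : ℕ), S'' < I.K → I.pos lay' w S'' ≠ I.pos (lay + 1) v S := by
      intro w S'' hS'' heq
      have := (pos_inj hS'' hS heq).1
      omega
    have hstep : ∀ w, I.net.step S' (v', w) < I.K := fun w => I.net.step_lt hS' _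
    by_cases heq : I.pos lay' v' S' = I.pos lay v S
    · obtain ⟨rfl, rfl, rfl⟩ := pos_inj hS' hS heq
      rw [a7, a6, if_pos rfl, if_pos rfl]
      refine h₂.best.congr (fun w => ?_) (fun w => ?_)
      · rw [a7, if_neg (hne w _ (hstep w)), earr]; rfl
      · rw [a6, if_neg (hne w _ (hstep w)), earr]; rfl
    · have hne' : I.pos (lay' + 1) v' S' ≠ I.pos (lay + 1) v S := by
        rw [pos_succ, pos_succ]; omega
      rw [a7, a6, if_neg hne', if_neg hne']
      refine (h.best lay' v' S' hS' (by omega)).congr (fun w => ?_) (fun w => ?_)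
      · rw [a7, if_neg (hne w _ (hstep w))]
      · rw [a6, if_neg (hne w _ (hstep w))]

theorem tableProg_spec {st : St} (h : I.ScaleInv (I.n * I.n) st) :
    Wp I.bound tableProg (I.M * I.M * (I.n * 3050 + 3050) + 200) st (I.TableInv (I.M * I.M)) := by
  have hMb := I.sq_le_bound
  unfold tableProg
  refine Wp.weaken_time (T₁ := 18 + (I.M * I.M * (I.n * 3050 + 3000 + 50) + 13 + 50)) ?_
    (by rw [Nat.add_assoc (I.n * 3050)]; omega)
  refine Wp.seq (Wp.set_eq I.M ⟨trivial, trivial⟩ (by simp [h.header.n, h.K, M]) ?_ ?_)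
  · rw [Nat.abs_cast]; exact_mod_cast (by omega : I.M ≤ I.bound)
  refine Wp.for_ (T := I.n * 3050 + 3000) (I.M * I.M) I.TableInv (by norm_num) ⟨trivial, trivial⟩
    (by simp) (by omega) ?_ ?_ (fun j st' hj hinv h10 => I.tableBody_spec hj hinv h10) fun _ => id
  · intro j st' a b hh
    exact ⟨hh.static.of_eq (fun x hx => by simp [show x ≠ 10 by omega, show x ≠ 11 by omega])
      (fun _ _ => rfl) rfl, hh.value, hh.decision, hh.zero, hh.best⟩
  · have hlt := I.ix_lt
    refine ⟨⟨h.header.of_eq (fun x hx => by simp [show x ≠ 8 by omega]) rfl, by simp [h.K], by simp,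
      fun e => ?_, fun e => ?_, fun e => ?_, fun e => ?_⟩, fun i => ?_, fun i => ?_, fun i _ => ?_,
      fun _ _ _ _ h0 => absurd h0 (Nat.not_lt_zero _)⟩
    · simpa using h.edge _ (hlt e)
    · rw [net_pw]; exact h.bit _ (hlt e)
    · have := h.W _ (hlt e)
      rw [if_pos (hlt e)] at this; exact this
    · have := h.G _ (hlt e)
      rw [if_pos (hlt e)] at this; exact this
    · have := I.wmax_nonneg
      rw [St.setv_arr, h.zero 6 (by decide), abs_zero]
      positivity
    · rw [St.setv_arr, h.zero 7 (by decide)]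
      omega
    · exact ⟨h.zero 7 (by decide) i, h.zero 6 (by decide) i⟩

variable {I} in
theorem TableInv.table {st : St} (h : I.TableInv (I.M * I.M) st) :
    I.net.Table (fun lay v S => st.arr 7 (I.pos lay v S)) (fun lay v S => st.arr 6 (I.pos lay v S))
      (I.n * 2 ^ I.net.k) where
  zero v S hS := h.zero _ (by
    have := pos_lt (I := I) (lay := 0) (v := v) (S := S) hS
    rwa [Nat.zero_add, Nat.one_mul] at this)
  succ lay hlay v S hS := h.best lay v S hS (by
    have h1 : I.pos lay v S < (lay + 1) * I.M := pos_lt hS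
    have h2 : (lay + 1) * I.M ≤ I.M * I.M := Nat.mul_le_mul_right _ hlay
    omega)

end Instance

end WSExpH

/-! ### Writing the answer, and assembling the program -/

namespace WSExpH.Instance

open RAM RAM.Ex

/-- Goes to the next vertex of the optimal edge progression. -/
def stepBody : Prog :=
  Prog.set 16 (var 15 - lit 2) ⨟
  Prog.set 17 (var 13 * var 0 + var 16) ⨟
  Prog.set 18 (lit 1 - (var 14 / get 3 (var 17) - var 14 / get 3 (var 17) / lit 2 * lit 2)) ⨟
  Prog.set 14 (var 14 + var 18 * get 3 (var 17)) ⨟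
  Prog.set 13 (var 16) ⨟
  Prog.set 12 (var 12 - lit 1) ⨟
  Prog.set 15 (get 7 (var 12 * var 8 + (var 13 * var 7 + var 14)))

/-- Writes the optimal edge progression. -/
def outputProg : Prog :=
  Prog.set 12 (var 8) ⨟ Prog.set 13 (var 1) ⨟ Prog.set 14 (lit 0) ⨟
  Prog.set 15 (get 7 (var 12 * var 8 + (var 13 * var 7 + var 14))) ⨟
  Prog.loopv 15 (Prog.output (var 13) ⨟ Prog.cond (var 15 - lit 1) stepBody (Prog.set 15 (lit 0)))

/-- The input is read, and the first numbers are stored. -/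
def headerProg : Prog :=
  Prog.input 0 ⨟ Prog.input 1 ⨟ Prog.input 2 ⨟ Prog.input 3 ⨟ Prog.input 4 ⨟
  Prog.set 5 (lit 1) ⨟ Prog.set 7 (lit 1)

/-- The program that solves the problem. -/
def solver : Prog :=
  headerProg ⨟ graphProg ⨟ histProg ⨟ scaleProg ⨟ tableProg ⨟ outputProg

variable (I : Instance)

/-- The state while the answer `ans` is written, if `m` vertices are left. -/
structure OutInv (tab : Fin 8 → ℕ → ℤ) (ans : List ℤ) (m : ℕ) (st : St) : Prop where
  n : st.v 0 = I.n
  K : st.v 7 = I.K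
  M : st.v 8 = I.M
  arr : st.arr = tab
  rest : (m = 0 ∧ st.v 15 = 0 ∧ st.out = ans) ∨ ∃ (lay : ℕ) (v : Fin I.n) (S : ℕ)
    (x : List (Fin I.n)), S < I.K ∧ lay ≤ I.M ∧
    st.v 12 = (lay : ℕ) ∧ st.v 13 = (v : ℕ) ∧ st.v 14 = (S : ℕ) ∧
    st.v 15 = tab 7 (I.pos lay v S) ∧ x.length = m ∧
    I.net.Follows (fun lay v S => tab 7 (I.pos lay v S)) lay v S x ∧
    st.out ++ x.map (fun v : Fin I.n => ((v : ℕ) : ℤ)) = ans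

/-- The table stores only the next vertex. The new set is recomputed with the arithmetic of
`innerBody`, and the layer decreases by one, in accordance with `Net.Follows`. -/
theorem stepBody_spec {st₀ st : St} {lay : ℕ} {v w : Fin I.n} {S : ℕ} {x : List (Fin I.n)}
    {ans : List ℤ} (h₀ : I.TableInv (I.M * I.M) st₀) (hn : st.v 0 = I.n) (hK : st.v 7 = I.K)
    (hM : st.v 8 = I.M) (harr : st.arr = st₀.arr) (hS : S < I.K) (hlay : lay + 1 ≤ I.M)
    (h12 : st.v 12 = ((lay + 1 : ℕ) : ℤ)) (h13 : st.v 13 = (v : ℕ)) (h14 : st.v 14 = S)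
    (h15 : st.v 15 = ((w : ℕ) : ℤ) + 2)
    (hf : I.net.Follows (fun lay v S => st₀.arr 7 (I.pos lay v S)) lay w (I.net.step S (v, w)) x)
    (hans : st.out ++ x.map (fun v : Fin I.n => ((v : ℕ) : ℤ)) = ans) :
    Wp I.bound stepBody 3000 st (I.OutInv st₀.arr ans x.length) := by
  have hMb := I.sq_le_bound
  have hM1 : I.M ≤ I.M * I.M := Nat.le_mul_of_pos_left _ I.M_pos
  have hM0 := I.M_pos
  have hnM := I.n_le_M
  have hKM := I.K_le_M
  have hw := w.2
  have hix : I.ix (v, w) ≤ I.bound := (I.ix_lt _).le.trans I.nn_le_bound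
  have hstep : I.net.step S (v, w) < I.K := I.net.step_lt hS _
  have hbit : st.arr 3 (I.ix (v, w)) = I.net.pw (v, w) := by rw [harr]; exact h₀.static.bit _
  have hfr : I.net.fresh S (v, w) ≤ 1 := I.net.fresh_le S _
  unfold stepBody
  refine Wp.step (by decide) (Wp.set_eq (w : ℕ) ⟨trivial, trivial⟩ (by simp [h15]) ?_ ?_)
  · rw [Nat.abs_cast]; exact_mod_cast (by omega : (w : ℕ) ≤ I.bound)
  refine Wp.step (by decide) (Wp.set_eq (I.ix (v, w)) ⟨⟨trivial, trivial⟩, trivial⟩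
    (by simp [h13, hn, ix]) ?_ ?_)
  · rw [Nat.abs_cast]; exact_mod_cast hix
  refine Wp.step (by decide) (Wp.set_eq (I.net.fresh S (v, w)) (by simp) ?_ ?_ ?_)
  · simp only [eval_sub, eval_lit, eval_div, eval_var, St.setv_v, eval_get, eval_mul,
      St.setv_arr]
    norm_num
    rw [h14, hbit, fresh_cast]; rfl
  · rw [Nat.abs_cast]; exact_mod_cast (by omega : I.net.fresh S (v, w) ≤ I.bound)
  refine Wp.step (by decide) (Wp.set_eq (I.net.step S (v, w)) (by simp) ?_ ?_ ?_)
  · simp [h14, hbit, Net.step]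
  · rw [Nat.abs_cast]; exact_mod_cast (by omega : I.net.step S (v, w) ≤ I.bound)
  refine Wp.step (by decide) (Wp.set_eq (w : ℕ) trivial (by simp) ?_ ?_)
  · rw [Nat.abs_cast]; exact_mod_cast (by omega : (w : ℕ) ≤ I.bound)
  refine Wp.step (by decide) (Wp.set_eq lay ⟨trivial, trivial⟩ (by simp [h12]) ?_ ?_)
  · rw [Nat.abs_cast]; exact_mod_cast (by omega : lay ≤ I.bound)
  generalize hst : (((((st.setv 16 _).setv 17 _).setv 18 _).setv 14 _).setv 13 _).setv 12 _ = st₁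
  have e0 : ∀ x < 12, st₁.v x = st.v x := by
    intro x hx
    rw [← hst]
    simp [show x ≠ 12 by omega, show x ≠ 13 by omega, show x ≠ 14 by omega, show x ≠ 16 by omega,
      show x ≠ 17 by omega, show x ≠ 18 by omega]
  have e12 : st₁.v 12 = lay := by rw [← hst]; simp
  have e13 : st₁.v 13 = (w : ℕ) := by rw [← hst]; simp
  have e14 : st₁.v 14 = I.net.step S (v, w) := by rw [← hst]; simp
  have earr : st₁.arr = st₀.arr := by rw [← hst]; simp [harr]
  have eout : st₁.out = st.out := by rw [← hst]; simp
  clear hst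
  have epos : (var 12 * var 8 + (var 13 * var 7 + var 14)).eval st₁ =
      I.pos lay w (I.net.step S (v, w)) := by
    simp [e0, e12, e13, e14, hM, hK, pos]
  refine Wp.weaken_time (Wp.set_eq (st₀.arr 7 (I.pos lay w (I.net.step S (v, w)))) ?_ ?_ ?_ ?_)
    (by decide)
  · refine ⟨⟨⟨trivial, trivial⟩, ⟨trivial, trivial⟩, trivial⟩, ?_⟩
    rw [epos]; positivity
  · rw [eval_get, epos, earr, Int.toNat_natCast]
  · rw [abs_of_nonneg (h₀.decision _).1]
    exact (h₀.decision _).2.trans (by exact_mod_cast (by omega : I.n + 1 ≤ I.bound))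
  · exact ⟨by simp [e0, hn], by simp [e0, hK], by simp [e0, hM], earr, Or.inr ⟨lay, w, _, x, hstep,
      by omega, by simp [e12], by simp [e13], by simp [e14], by simp, rfl, hf, by
        rw [← hans, ← eout]; rfl⟩⟩

set_option maxHeartbeats 1000000 in
theorem outputProg_spec {st : St} (h : I.TableInv (I.M * I.M) st) (hI : I.NoNegativeCycle) :
    Wp I.bound outputProg (I.M * 4002 + 3000) st
      fun st' => ∃ o, I.IsAnswer o ∧ st'.out = I.encodeAnswer o := by
  have hN := I.conservative hI
  have hMb := I.sq_le_bound
  have hM1 : I.M ≤ I.M * I.M := Nat.le_mul_of_pos_left _ I.M_pos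
  have hM0 := I.M_pos
  have hnM := I.n_le_M
  have hs := I.s.2
  have hst := h.static
  -- The answer is fixed before the loop is analysed, together with the number `m` of iterations,
  -- one per written vertex. It is 0 if the decision at the start is 0, and then the loop is not
  -- entered.
  obtain ⟨o, m, hm, ho, hinv⟩ : ∃ o m, m ≤ I.M ∧ I.IsAnswer o ∧ ∀ st' : St, st'.v 0 = I.n →
      st'.v 7 = I.K → st'.v 8 = I.M → st'.arr = st.arr → st'.out = [] → st'.v 12 = I.M →
      st'.v 13 = (I.s : ℕ) → st'.v 14 = 0 → st'.v 15 = st.arr 7 (I.pos I.M I.s 0) →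
      I.OutInv st.arr (I.encodeAnswer o) m st' := by
    by_cases hd : st.arr 7 (I.pos I.M I.s 0) = 0
    · refine ⟨none, 0, Nat.zero_le _, ?_, fun st' h0 h7 h8 ha ho _ _ _ h15 =>
        ⟨h0, h7, h8, ha, Or.inl ⟨rfl, by rw [h15, hd], ho⟩⟩⟩
      exact Set.eq_empty_iff_forall_notMem.2 fun x hx => h.table.infeasible hN hd x hx
    · obtain ⟨x, h1, h2, h3, h4⟩ := h.table.optimal hN hd
      refine ⟨some x, x.length, h2, ⟨h3, fun y hy => I.objective_le h3 hy (h4 y hy)⟩,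
        fun st' h0 h7 h8 ha ho h12 h13 h14 h15 => ⟨h0, h7, h8, ha, Or.inr
          ⟨I.M, I.s, 0, x, I.K_pos, le_rfl, h12, h13, by simpa using h14, h15, rfl, h1, ?_⟩⟩⟩
      rw [ho]
      simp [encodeAnswer, ← List.map_eq_flatMap]
  unfold outputProg
  refine Wp.weaken_time (T₁ := 500 + (500 + (500 + (500 + (m * (4000 + 2) + 2))))) ?_
    (by have : m * (4000 + 2) ≤ I.M * 4002 := Nat.mul_le_mul_right _ hm
        omega)
  refine Wp.seq (Wp.weaken_time (Wp.set_eq I.M trivial (by simp [hst.M]) ?_ ?_) (by decide))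
  · rw [Nat.abs_cast]; exact_mod_cast (by omega : I.M ≤ I.bound)
  refine Wp.seq (Wp.weaken_time (Wp.set_eq (I.s : ℕ) trivial (by simp [hst.header.s]) ?_ ?_)
    (by decide))
  · rw [Nat.abs_cast]; exact_mod_cast (by omega : (I.s : ℕ) ≤ I.bound)
  refine Wp.seq (Wp.weaken_time (Wp.set_eq 0 trivial rfl (by simp) ?_) (by decide))
  refine Wp.seq (Wp.weaken_time (Wp.set_eq (st.arr 7 (I.pos I.M I.s 0)) ?_ ?_ ?_ ?_) (by decide))
  · refine ⟨⟨⟨trivial, trivial⟩, ⟨trivial, trivial⟩, trivial⟩, ?_⟩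
    simp [hst.M, hst.K]
    positivity
  · have : ((I.M : ℤ) * I.M + ((I.s : ℕ) : ℤ) * I.K) = (I.pos I.M I.s 0 : ℕ) := by simp [pos]
    simp [hst.M, hst.K, this]
  · rw [abs_of_nonneg (h.decision _).1]
    exact (h.decision _).2.trans (by exact_mod_cast (by omega : I.n + 1 ≤ I.bound))
  refine Wp.loopv (I.OutInv st.arr (I.encodeAnswer o)) ?_ ?_ m _ ?_
  · rintro st' ⟨-, -, -, -, h0 | ⟨lay, v, S, x, -, -, -, -, -, -, hx, hf, -⟩⟩
    · exact ⟨h0.2.1.le, o, ho, h0.2.2⟩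
    · have : x = [] := List.length_eq_zero_iff.1 hx
      subst this
      -- No empty list follows the decisions, so with no vertex left the loop must have stopped.
      cases lay <;> simp [Net.Follows] at hf
  · rintro j st' ⟨h0, h7, h8, ha, hr | ⟨lay, v, S, x, hS, hlay, h12, h13, h14, h15, hx, hf, hans⟩⟩
    · omega
    obtain _ | lay := lay
    · exact hf.elim
    rcases hf with ⟨hd, rfl⟩ | ⟨w, y, hd, rfl, hf⟩
    -- The decision 1 means stopping here: the last vertex is written, and variable 15 is set to 0
    -- to leave the loop.
    · replace h15 := h15.trans hd
      refine ⟨by omega, Wp.step (by decide) (Wp.output trivial ?_)⟩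
      have hj : j = 0 := by simpa using hx.symm
      refine Wp.cond_step ⟨trivial, trivial⟩ (by decide) (fun hp => ?_) (fun _ => ?_)
      · simp [h15] at hp
      · refine Wp.weaken_time (Wp.set_eq 0 trivial rfl (by simp) ?_) (by decide)
        exact ⟨by simp [h0], by simp [h7], by simp [h8], ha, Or.inl ⟨hj, by simp, by
          simpa [h13] using hans⟩⟩
    · replace h15 := h15.trans hd
      refine ⟨by omega, Wp.step (by decide) (Wp.output trivial ?_)⟩
      have hj : y.length = j := by simpa using hx
      refine Wp.cond_step ⟨trivial, trivial⟩ (by decide) (fun _ => ?_) (fun hp => ?_)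
      · subst hj
        exact Wp.weaken_time (I.stepBody_spec h h0 h7 h8 ha hS hlay h12 h13 h14 h15 hf
          (by simpa [h13] using hans)) (by decide)
      · simp [h15] at hp
        omega
  · exact hinv _ (by simp [hst.header.n]) (by simp [hst.K]) (by simp [hst.M]) rfl
      (by simp [hst.header.out]) (by simp) (by simp) (by simp) (by simp)

theorem headerProg_spec {st : St} (hin : st.inp = I.encode) (hout : st.out = [])
    (harr : ∀ a m, st.arr a m = 0) : Wp I.bound headerProg 100 st
      (I.GraphInv ((I.N : ℤ) :: (List.range I.N).flatMap I.hcell) 0) := by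
  rw [encode_eq] at hin
  have hb : |(1 : ℤ)| ≤ I.bound := by
    have h1 := I.sq_le_bound
    have h2 := I.M_pos
    rw [abs_one]; exact_mod_cast (by omega : 1 ≤ I.bound)
  unfold headerProg
  refine Wp.step (by decide) (Wp.input hin fun h1 => ?_)
  refine Wp.step (by decide) (Wp.input rfl fun h2 => ?_)
  refine Wp.step (by decide) (Wp.input rfl fun h3 => ?_)
  refine Wp.step (by decide) (Wp.input rfl fun h4 => ?_)
  refine Wp.step (by decide) (Wp.input rfl fun h5 => ?_)
  refine Wp.step (by decide) (Wp.set_eq 1 trivial rfl hb ?_)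
  refine Wp.weaken_time (Wp.set_eq 1 trivial rfl hb ?_) (by decide)
  refine ⟨⟨by simp, by simp, by simp, by simp, by simp, by simp [hout]⟩, by simp [Instance.dc],
    by simp, ?_, ?_, ?_, ?_, ?_, ?_, ?_⟩
  · exact fun m hm => absurd hm (Nat.not_lt_zero _)
  · exact fun m hm => absurd hm (Nat.not_lt_zero _)
  · exact fun m hm => absurd hm (Nat.not_lt_zero _)
  · exact fun m hm => absurd hm (Nat.not_lt_zero _)
  · exact fun m _ => harr 3 m
  · exact fun a _ m => harr a m
  · simp [List.range_eq_range']

theorem solver_spec {st : St} (hI : I.NoNegativeCycle) (hin : st.inp = I.encode)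
    (hout : st.out = []) (harr : ∀ a m, st.arr a m = 0) :
    Wp I.bound solver (100 + ((I.n * I.n * 3050 + 100) + ((I.N * (I.len * 4000 + 1050) + 200) +
      ((I.n * I.n * 3050 + 100) + ((I.M * I.M * (I.n * 3050 + 3050) + 200) +
        (I.M * 4002 + 3000)))))) st fun st' => ∃ o, I.IsAnswer o ∧ st'.out = I.encodeAnswer o :=
  Wp.weaken_time (Wp.seq ((I.headerProg_spec hin hout harr).mono le_rfl fun _ h =>
    Wp.seq ((I.graphProg_spec h).mono le_rfl fun _ h =>
      Wp.seq ((I.histProg_spec h).mono le_rfl fun _ h =>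
        Wp.seq ((I.scaleProg_spec h).mono le_rfl fun _ h =>
          Wp.seq ((I.tableProg_spec h).mono le_rfl fun _ h => I.outputProg_spec h hI))))))
    (by omega)

/-! ### The polynomial bound for the running time -/

/-- Here `L` stands for the input length, which bounds `n * n`, `n` and `N`, and `κ` for `2 ^ k`, so
that `L * κ` bounds `M`. The dominant term is the table, with `M * M` entries and `n` successors
each. -/
theorem time_aux {L κ : ℕ} (hK : 1 ≤ κ) :
    100 + ((L * 3050 + 100) + ((L * (L * 4000 + 1050) + 200) +
      ((L * 3050 + 100) + ((L * κ * (L * κ) * (L * 3050 + 3050) + 200) +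
        (L * κ * 4002 + 3000))))) ≤ 30000 * κ ^ 2 * (L + 1) ^ 3 := by
  have a1 : κ ≤ κ ^ 2 := Nat.le_self_pow (by norm_num) κ
  have a2 : 1 ≤ κ ^ 2 := hK.trans a1
  have b1 : (L * (L * 4000 + 7150) + 3700) * 1 ≤ (L * (L * 4000 + 7150) + 3700) * κ ^ 2 :=
    Nat.mul_le_mul_left _ a2
  have b2 : L * 4002 * κ ≤ L * 4002 * κ ^ 2 := Nat.mul_le_mul_left _ a1
  calc _ = (L * (L * 4000 + 7150) + 3700) * 1 + L * 4002 * κ +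
        L * L * (L * 3050 + 3050) * κ ^ 2 := by ring
    _ ≤ (L * (L * 4000 + 7150) + 3700) * κ ^ 2 + L * 4002 * κ ^ 2 +
        L * L * (L * 3050 + 3050) * κ ^ 2 := by gcongr
    _ = (L * (L * 4000 + 7150) + 3700 + L * 4002 + L * L * (L * 3050 + 3050)) * κ ^ 2 := by ring
    _ ≤ (30000 * (L + 1) ^ 3) * κ ^ 2 := by
        refine Nat.mul_le_mul_right _ ?_
        ring_nf
        omega
    _ = _ := by ring

theorem time_le {k : ℕ} (hk : I.E'.card ≤ k) :
    100 + ((I.n * I.n * 3050 + 100) + ((I.N * (I.len * 4000 + 1050) + 200) +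
      ((I.n * I.n * 3050 + 100) + ((I.M * I.M * (I.n * 3050 + 3050) + 200) +
        (I.M * 4002 + 3000))))) ≤ 30000 * (2 ^ k) ^ 2 * (I.len + 1) ^ 3 := by
  have h1 := I.sq_le_len
  have h2 := I.N_le_len
  have h3 := I.n_le_len
  have hM : I.M ≤ I.len * 2 ^ k := by
    unfold M K
    exact Nat.mul_le_mul h3 (Nat.pow_le_pow_right (by norm_num) hk)
  have hK : 1 ≤ 2 ^ k := Nat.one_le_two_pow
  refine le_trans ?_ (time_aux (L := I.len) hK)
  gcongr

/-- Put `U = 2 ^ len` and `κ = 2 ^ k`. As `M ≤ U * κ`, `bound` is at most a sum of monomials in `U`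
and `κ` with coefficients of total 6, each monomial at most `U ^ 5 * κ ^ 2`; hence it is less than
`8 * U ^ 5 * κ ^ 2`. -/
theorem unit_bound_le {k : ℕ} (hk : I.E'.card ≤ k) : unit I.bound ≤ 5 * I.len + 2 * k + 4 := by
  have hn : I.n ≤ 2 ^ I.len := I.n_le_len.trans Nat.lt_two_pow_self.le
  have hM : I.M ≤ 2 ^ I.len * 2 ^ k := by
    unfold M K
    exact Nat.mul_le_mul hn (Nat.pow_le_pow_right (by norm_num) hk)
  have hU : 1 ≤ 2 ^ I.len := Nat.one_le_two_pow
  have hK : 1 ≤ 2 ^ k := Nat.one_le_two_pow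
  rw [unit, show 5 * I.len + 2 * k + 4 = (5 * I.len + 2 * k + 3) + 1 from rfl, bitLength_le_succ,
    Int.natAbs_natCast]
  have e : 2 ^ (5 * I.len + 2 * k + 3) = 8 * ((2 ^ I.len) ^ 5 * (2 ^ k) ^ 2) := by
    rw [← pow_mul, ← pow_mul, pow_add, pow_add, Nat.mul_comm 5, Nat.mul_comm 2]; ring
  rw [e]
  unfold bound
  generalize 2 ^ I.len = U at *
  generalize 2 ^ k = κ at *
  generalize I.M = m at *
  have c1 : ∀ i ≤ 5, ∀ j ≤ 2, U ^ i * κ ^ j ≤ U ^ 5 * κ ^ 2 := fun i hi j hj =>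
    Nat.mul_le_mul (Nat.pow_le_pow_right hU hi) (Nat.pow_le_pow_right hK hj)
  have c2 := c1 2 (by norm_num) 2 le_rfl
  have c3 := c1 1 (by norm_num) 1 (by norm_num)
  have c4 := c1 5 le_rfl 1 (by norm_num)
  have c5 := c1 4 (by norm_num) 0 (by norm_num)
  have c6 : 0 < U ^ 5 * κ ^ 2 := by positivity
  have d1 : m * m ≤ U * κ * (U * κ) := Nat.mul_le_mul hM hM
  have d2 : (m + 1) * (2 * U ^ 4) ≤ (U * κ + 1) * (2 * U ^ 4) := Nat.mul_le_mul_right _ (by omega)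
  have e1 : U * κ * (U * κ) = U ^ 2 * κ ^ 2 := by ring
  have e2 : (U * κ + 1) * (2 * U ^ 4) = 2 * (U ^ 5 * κ ^ 1) + 2 * (U ^ 4 * κ ^ 0) := by ring
  have e3 : U * κ = U ^ 1 * κ ^ 1 := by ring
  omega

end WSExpH.Instance

/-- There is a single program that solves the problem on all instances without negative cycles and
whose running time is, for each constant bound `k` on `|E'|`, polynomial in the input length. -/
theorem theorem4 :
    ∃ P : RAM.Prog, ∀ k : ℕ, ∃ p : Polynomial ℕ, ∀ I : WSExpH.Instance,
      I.E'.card ≤ k → I.NoNegativeCycle →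
        ∃ o : Option (List (Fin I.n)), I.IsAnswer o ∧
          RAM.OutputsInTime P I.encode (I.encodeAnswer o)
            (p.eval (RAM.inputSize I.encode)) := by
  -- The polynomial is the bound for the number of units times the bound for the unit. The program
  -- does not depend on `k`, which enters only through the coefficients.
  refine ⟨WSExpH.Instance.solver, fun k => ⟨Polynomial.C (30000 * (2 ^ k) ^ 2) * (Polynomial.X + 1) ^ 3 *
    (5 * Polynomial.X + Polynomial.C (2 * k + 4)), fun I hk hI => ?_⟩⟩
  obtain ⟨c, τ, st, hrun, hc, hsim, -, o, ho, hout⟩ :=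
    I.solver_spec hI (st := ⟨fun _ => 0, fun _ _ => 0, I.encode, []⟩) rfl rfl (fun _ _ => rfl)
      (RAM.Config.init I.encode) ⟨fun _ => rfl, fun _ _ => rfl, rfl, rfl⟩
      ⟨fun _ => by simp, fun _ _ => by simp, fun z hz => I.abs_le_bound (I.abs_le_of_mem_encode hz)⟩
  refine ⟨o, ho, c, τ, hrun, hc.trans ?_, by rw [hsim.out, hout]⟩
  have h := Nat.mul_le_mul (I.time_le hk) (I.unit_bound_le hk)
  refine h.trans (le_of_eq ?_)
  simp [WSExpH.Instance.len]
  ring
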